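/- Let $k$ be a perfect field of characteristic $p>0$ and $n\ge 0$ an integer. For a $k$-algebra $B$ let $W_{n+1}(B)$ be the ring of $p$-typical Witt vectors of length $n+1$, with Verschiebung $V$ and $\Phi=W_{n+1}(\mathrm{Frob})$. Elements $z_1,\dots,z_m\in B$ are called coordinates of $B$ if $k[t_1,\dots,t_m]\to B$, $t_i\mapsto z_i$, is étale. Let $\partial_i^{[r]}$ be the divided power operators $t^{s}\mapsto\binom{s_i}{r}t^{s-re_i}$ on $W_{n+1}(k)[t_1,\dots,t_m]$, and let $\tilde w_n\colon W_{n+1}(k[t_1,\dots,t_m])\to W_{n+1}(k)[t_1,\dots,t_m]$, $(g_0,\dots,g_n)\mapsto\sum_j p^j\tilde g_j^{\,p^{n-j}}$ with $\tilde g_j$ any lift of $g_j$. The operators $\partial_{i,n+1}^{[r]}$ on $W_{n+1}(B)$ are the $W_{n+1}(k)$-linear maps such that, for each $i$, $(\partial_{i,n+1}^{[r]})_{r\ge0}$ is a Hasse--Schmidt derivation ($\partial^{[0]}_{i,n+1}=\mathrm{id}$, $\partial_{i,n+1}^{[r]}(xy)=\sum_{a+b=r}\partial_{i,n+1}^{[a]}(x)\,\partial_{i,n+1}^{[b]}(y)$)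 extending the restrictions of $\partial_i^{[r]}$ along $\tilde w_n$ to $W_{n+1}(k[t_1,\dots,t_m])$. For $a\in W_{n+1}(B)$ put $a\bullet\partial_{i,n+1}^{[r]}:=\Phi^{v_p(r)-n}(a)\,\partial_{i,n+1}^{[r]}$; for $r\neq0$ and $v_p(r)\le n$ this means $x\mapsto V^{n-v_p(r)}(ay)$ where $\partial_{i,n+1}^{[r]}(x)=V^{n-v_p(r)}(y)$, and for $r=0$ it means multiplication by $a$. Let $X$ be a smooth $k$-scheme (for instance $X=\mathrm{Spec}\,A$ with $A$ a smooth $k$-algebra). A local chart of $X$ is an affine open $U\subseteq X$ such that $\mathcal O_X(U)$ has coordinates. Then: 1. The local charts form a basis of the topology of $X$. For a local chart $U$, with $B=\mathcal O_X(U)$, and coordinates $z$ of $B$, the operators $\partial_{i,n+1}^{[r]}$ exist and are unique, the operators $a\bullet\partial_{i,n+1}^{[r]}$ are well defined, and the $W_{n+1}(B)$-algebra $\mathcal D_{W_{n+1}}(U)$ of endomorphisms of $W_{n+1}(B)$ generated by them does not depend on $z$ and consists of $W_{n+1}(k)$-linear differential operators. 2. If $U$ is a local chart and $g\in\mathcal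 O_X(U)$, then $U_g$ is a local chart, and restriction induces an isomorphism $\mathcal D_{W_{n+1}}(U)\otimes_{W_{n+1}(\mathcal O_X(U))}W_{n+1}(\mathcal O_X(U_g))\cong\mathcal D_{W_{n+1}}(U_g)$. 3. The presheaf $\mathcal D_{W_{n+1}(X)}$ whose sections over an open $V$ are the families $(\theta_U)_U$, $\theta_U\in\mathcal D_{W_{n+1}}(U)$, indexed by the local charts $U\subseteq V$ and compatible with restriction, is a sheaf and a quasi-coherent $W_{n+1}\mathcal O_X$-module, and $\Gamma(U,\mathcal D_{W_{n+1}(X)})=\mathcal D_{W_{n+1}}(U)$ for every local chart $U$. It is the unique such sheaf: if $(U_i)$ is a covering of $X$ by local charts and $G$ is a sheaf of $W_{n+1}\mathcal O_X$-modules with isomorphisms $G(U)\cong\mathcal D_{W_{n+1}}(U)$, compatible with restriction, for all local charts $U$ contained in some $U_i$, then there is a unique isomorphism $G\cong\mathcal D_{W_{n+1}(X)}$ inducing them. 4. For $n=0$, under the identification $W_1(B)=B$, the sheaf $\mathcal D_{W_1(X)}$ is Grothendieck's sheaf of rings of differential operators $\mathcal D_X$, i.e. the sheaf with $\Gamma(U,\mathcal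 D_X)=\mathcal D(\mathcal O_X(U))$, the ring of $k$-linear differential operators of $\mathcal O_X(U)$, for every affine open $U\subseteq X$. -/

import Mathlib

universe u

noncomputable section

namespace WittDiff

/-! ### Truncated Witt vectors -/

section Witt

variable (p n : ℕ) [Fact p.Prime]

/-- `W p n B` is the ring `W_{n+1}(B)` of `p`-typical Witt vectors of length `n + 1`. -/
abbrev W (B : Type*) : Type _ := TruncatedWittVector p (n + 1) B

variable {p n}

/-- The ring homomorphism `W_{n+1}(g)`, i.e. `g` applied to all Witt components. -/
def wittMap {B C : Type*} [CommRing B] [CommRing C] (g : B →+* C) : W p n B →+* W p n C :=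
  have key : ∀ x : WittVector p B,
      TruncatedWittVector.mk p (fun i => g ((WittVector.truncate (n + 1) x).coeff i)) =
        WittVector.truncate (n + 1) (WittVector.map g x) := fun x => by
    ext i; simp [WittVector.map_coeff]
  { toFun := fun x => TruncatedWittVector.mk p fun i => g (x.coeff i)
    map_one' := by
      have := key 1
      rwa [map_one, map_one, map_one] at this
    map_zero' := by
      have := key 0
      rwa [map_zero, map_zero, map_zero] at this
    map_add' := fun x y => by
      obtain ⟨x, rfl⟩ := WittVector.truncate_surjective p (n + 1) B x
      obtain ⟨y, rfl⟩ := WittVector.truncate_surjective p (n + 1) B y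
      rw [← map_add, key, key, key, map_add, map_add]
    map_mul' := fun x y => by
      obtain ⟨x, rfl⟩ := WittVector.truncate_surjective p (n + 1) B x
      obtain ⟨y, rfl⟩ := WittVector.truncate_surjective p (n + 1) B y
      rw [← map_mul, key, key, key, map_mul, map_mul] }

@[simp]
theorem coeff_wittMap {B C : Type*} [CommRing B] [CommRing C] (g : B →+* C) (x : W p n B)
    (i : Fin (n + 1)) : (wittMap g x).coeff i = g (x.coeff i) :=
  TruncatedWittVector.coeff_mk _ _

/-- `W_{n+1}(B)` as a `W_{n+1}(k)`-algebra, for a `k`-algebra `B`. -/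
instance (priority := low) wittAlgebra {k B : Type*} [CommRing k] [CommRing B] [Algebra k B] :
    Algebra (W p n k) (W p n B) :=
  (wittMap (algebraMap k B)).toAlgebra

/-- The Verschiebung `(x₀, …, xₙ) ↦ (0, x₀, …, xₙ₋₁)` on `W_{n+1}(B)`. -/
def versch {B : Type*} [CommRing B] (x : W p n B) : W p n B :=
  TruncatedWittVector.mk p (Fin.cases 0 fun j : Fin n => x.coeff j.castSucc)

/-- The map `Φ_B = W_{n+1}(Frob) : (x₀, …, xₙ) ↦ (x₀ᵖ, …, xₙᵖ)` on `W_{n+1}(B)`,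
for `B` of characteristic `p`. -/
def frob {B : Type*} [CommRing B] (x : W p n B) : W p n B :=
  TruncatedWittVector.mk p fun i => x.coeff i ^ p

/-- The Teichmüller representative `[c] = (c, 0, …, 0)` in `W_{n+1}(B)`. -/
def teich {B : Type*} [CommRing B] (c : B) : W p n B :=
  TruncatedWittVector.mk p (Fin.cases c fun _ : Fin n => 0)

end Witt

/-! ### The operators on polynomial rings -/

section Polynomial

open MvPolynomial

/-- The divided power differential operator `∂ᵢ^[r]` on the polynomial ring `R[t₁, …, t_m]`:
`t^s ↦ (sᵢ choose r) t^(s - r eᵢ)`. -/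
def divPow {R : Type*} [CommRing R] {m : ℕ} (i : Fin m) (r : ℕ) (g : MvPolynomial (Fin m) R) :
    MvPolynomial (Fin m) R :=
  ∑ s ∈ g.support, monomial (s - Finsupp.single i r) (((s i).choose r : R) * g.coeff s)

variable {p n : ℕ} [Fact p.Prime] {k : Type*} [CommRing k] {m : ℕ}

/-- A lift to `W_{n+1}(k)[t₁, …, t_m]` of a polynomial over `k`. -/
def polyLift (g : MvPolynomial (Fin m) k) : MvPolynomial (Fin m) (W p n k) :=
  ∑ s ∈ g.support, monomial s (teich (g.coeff s))

/-- The map `w̃ₙ : W_{n+1}(k[t₁, …, t_m]) → W_{n+1}(k)[t₁, …, t_m]` induced by the `n`-th ghost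
component: `(g₀, …, gₙ) ↦ ∑ᵢ pⁱ g̃ᵢ^(p^(n-i))` with `g̃ᵢ` a lift of `gᵢ`. -/
def ghostLift (x : W p n (MvPolynomial (Fin m) k)) : MvPolynomial (Fin m) (W p n k) :=
  ∑ i : Fin (n + 1), (p : MvPolynomial (Fin m) (W p n k)) ^ (i : ℕ) *
    polyLift (x.coeff i) ^ p ^ (n - (i : ℕ))

end Polynomial

/-! ### Grothendieck's differential operators -/

section Diff

variable (R A : Type*) [CommRing R] [CommRing A] [Algebra R A]

/-- The commutator `[a, θ]` of (the multiplication by) `a ∈ A` and `θ ∈ End_R(A)`. -/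
def comm (a : A) (θ : Module.End R A) : Module.End R A :=
  Algebra.lmul R A a * θ - θ * Algebra.lmul R A a

/-- `θ` is a differential operator of order at most `m`:
`[a₀, [a₁, …, [a_m, θ] …]] = 0` for all `a₀, …, a_m ∈ A`. -/
def IsDiffOp : ℕ → Module.End R A → Prop
  | 0, θ => ∀ a, comm R A a θ = 0
  | m + 1, θ => ∀ a, IsDiffOp m (comm R A a θ)

variable {R A}

theorem comm_mul (a : A) (θ η : Module.End R A) :
    comm R A a (θ * η) = comm R A a θ * η + θ * comm R A a η := by
  simp only [comm, sub_mul, mul_sub, mul_assoc]; abel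

theorem comm_add (a : A) (θ η : Module.End R A) :
    comm R A a (θ + η) = comm R A a θ + comm R A a η := by
  simp only [comm]; noncomm_ring

theorem comm_lmul (a b : A) : comm R A a (Algebra.lmul R A b) = 0 := by
  simp only [comm, ← map_mul, mul_comm b a, sub_self]

theorem isDiffOp_zero (m : ℕ) : IsDiffOp R A m 0 := by
  induction m with
  | zero => intro a; simp [comm]
  | succ m ih => intro a; simpa [comm] using ih

theorem IsDiffOp.succ {m : ℕ} {θ : Module.End R A} (h : IsDiffOp R A m θ) :
    IsDiffOp R A (m + 1) θ := by
  induction m generalizing θ with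
  | zero => intro a; rw [h a]; exact isDiffOp_zero 0
  | succ m ih => intro a; exact ih (h a)

theorem IsDiffOp.mono {m m' : ℕ} (hm : m ≤ m') {θ : Module.End R A} (h : IsDiffOp R A m θ) :
    IsDiffOp R A m' θ := by
  induction hm with
  | refl => exact h
  | step _ ih => exact ih.succ

theorem IsDiffOp.add {m : ℕ} {θ η : Module.End R A} (h : IsDiffOp R A m θ)
    (h' : IsDiffOp R A m η) : IsDiffOp R A m (θ + η) := by
  induction m generalizing θ η with
  | zero => intro a; rw [comm_add, h a, h' a, add_zero]
  | succ m ih => intro a; rw [comm_add]; exact ih (h a) (h' a)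

theorem IsDiffOp.mul {m m' : ℕ} {θ η : Module.End R A} (h : IsDiffOp R A m θ)
    (h' : IsDiffOp R A m' η) : IsDiffOp R A (m + m') (θ * η) := by
  induction hN : m + m' generalizing m m' θ η with
  | zero =>
    obtain ⟨rfl, rfl⟩ : m = 0 ∧ m' = 0 := by omega
    intro a; rw [comm_mul, h a, h' a, zero_mul, mul_zero, add_zero]
  | succ N ih =>
    intro a
    rw [comm_mul]
    refine IsDiffOp.add ?_ ?_
    · cases m with
      | zero => rw [h a, zero_mul]; exact isDiffOp_zero N
      | succ m => exact ih (h a) h' (by omega)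
    · cases m' with
      | zero => rw [h' a, mul_zero]; exact isDiffOp_zero N
      | succ m' => exact ih h (h' a) (by omega)

variable (R A)

/-- Grothendieck's algebra `𝒟(A)` of `R`-linear differential operators on `A`. -/
def diffOps : Subalgebra R (Module.End R A) where
  carrier := {θ | ∃ m, IsDiffOp R A m θ}
  mul_mem' := fun ⟨_, h⟩ ⟨_, h'⟩ => ⟨_, h.mul h'⟩
  add_mem' := fun ⟨m, h⟩ ⟨m', h'⟩ =>
    ⟨max m m', (h.mono (le_max_left _ _)).add (h'.mono (le_max_right _ _))⟩
  algebraMap_mem' := fun c => ⟨0, fun a => by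
    rw [show algebraMap R (Module.End R A) c = Algebra.lmul R A (algebraMap R A c) by
      ext x; simp [Algebra.smul_def]]
    exact comm_lmul a _⟩

end Diff

/-! ### Witt differential operators on an algebra -/

section Algebra

variable (p n : ℕ) [Fact p.Prime] (k : Type*) [CommRing k]

/-- The sections `z₁, …, z_m` of the `k`-algebra `B` are coordinates: `k[t₁, …, t_m] → B`,
`tᵢ ↦ zᵢ`, is étale. -/
def IsCoord {B : Type*} [CommRing B] [Algebra k B] {m : ℕ} (z : Fin m → B) : Prop :=
  (MvPolynomial.aeval z : MvPolynomial (Fin m) k →ₐ[k] B).toRingHom.Etale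

variable {k}

/-- `δ i r` is the lift `∂_{i,n+1}^[r]` of `∂_{z_i}^[r]` to `W_{n+1}(B)`: the restrictions along
`w̃ₙ` of the operators `∂ᵢ^[r]` of `W_{n+1}(k)[t₁, …, t_m]` to `W_{n+1}(k[t₁, …, t_m])` exist, and
`δ i` is a Hasse-Schmidt derivation of `W_{n+1}(B)` which extends them along
`W_{n+1}(k[t₁, …, t_m]) → W_{n+1}(B)`. -/
structure IsWittLift {B : Type*} [CommRing B] [Algebra k B] {m : ℕ} (z : Fin m → B)
    (δ : Fin m → ℕ → Module.End (W p n k) (W p n B)) : Prop where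
  zero : ∀ i, δ i 0 = 1
  leibniz : ∀ i r x y, δ i r (x * y) =
    ∑ c ∈ Finset.HasAntidiagonal.antidiagonal r, δ i c.1 x * δ i c.2 y
  compat : ∃ δ₀ : Fin m → ℕ → Module.End (W p n k) (W p n (MvPolynomial (Fin m) k)),
    (∀ i r x, ghostLift (δ₀ i r x) = divPow i r (ghostLift x)) ∧
    ∀ i r x, δ i r (wittMap (MvPolynomial.aeval (R := k) z).toRingHom x) =
      wittMap (MvPolynomial.aeval (R := k) z).toRingHom (δ₀ i r x)

variable {p n}

/-- `θ = a • δ = Φ^(v_p(r) - n)(a) δ` for an operator `δ` on `W_{n+1}(B)` of index `r`.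
If `v_p(r) ≤ n`, the operator `δ` has values in `V^(n - v_p(r)) W_{n+1}(B)`, on which
`Φ^(v_p(r) - n)(a)` acts by `V^(n - v_p(r)) y ↦ V^(n - v_p(r)) (a y)`. If `v_p(r) ≥ n`, the
coefficient is the honest Witt vector `Φ^(v_p(r) - n)(a)`. (One of the two truncated
differences below is always `0`.) For `r = 0` the coefficient is `a` by convention. -/
def IsBullet {B : Type*} [CommRing B] (r : ℕ) (a : W p n B) (δ θ : W p n B → W p n B) : Prop :=
  if r = 0 then ∀ x, θ x = a * δ x
  else ∀ x, ∃ y, δ x = versch^[n - padicValNat p r] y ∧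
    θ x = versch^[n - padicValNat p r] (frob^[padicValNat p r - n] a * y)

variable (p n)

/-- The operators `a • ∂_{i,n+1}^[r]` on `W_{n+1}(B)` for coordinates `z₁, …, z_m` of `B`. -/
def wittGen {B : Type*} [CommRing B] [Algebra k B] {m : ℕ} (z : Fin m → B) :
    Set (Module.End (W p n k) (W p n B)) :=
  {θ | ∃ δ : Fin m → ℕ → Module.End (W p n k) (W p n B),
    IsWittLift p n z δ ∧ ∃ i r a, IsBullet r a (δ i r) θ}

/-- The `W_{n+1}(B)`-algebra generated by the operators `a • ∂_{i,n+1}^[r]` for the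
coordinates `z₁, …, z_m` of `B`. -/
def wittDiffOfCoord {B : Type*} [CommRing B] [Algebra k B] {m : ℕ} (z : Fin m → B) :
    Subalgebra (W p n k) (Module.End (W p n k) (W p n B)) :=
  Algebra.adjoin (W p n k)
    (Set.range (Algebra.lmul (W p n k) (W p n B)) ∪ wittGen p n z)

variable (k)

/-- The `W_{n+1}(B)`-algebra `𝒟_{W_{n+1}(B)}` generated by the operators `a • ∂_{i,n+1}^[r]`, for
all systems of coordinates of `B`. (Every single system generates the same algebra.) -/
def wittDiff (B : Type*) [CommRing B] [Algebra k B] :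
    Subalgebra (W p n k) (Module.End (W p n k) (W p n B)) :=
  Algebra.adjoin (W p n k)
    (Set.range (Algebra.lmul (W p n k) (W p n B)) ∪
      {θ | ∃ (m : ℕ) (z : Fin m → B), IsCoord k z ∧ θ ∈ wittGen p n z})

theorem lmul_mem_wittDiff {B : Type*} [CommRing B] [Algebra k B] (b : W p n B) :
    Algebra.lmul (W p n k) (W p n B) b ∈ wittDiff p n k B :=
  Algebra.subset_adjoin (Or.inl ⟨b, rfl⟩)

/-- Multiplication operators. -/
def lmulWittDiff (B : Type*) [CommRing B] [Algebra k B] : W p n B →+* wittDiff p n k B :=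
  (Algebra.lmul (W p n k) (W p n B)).toRingHom.codRestrict _ (lmul_mem_wittDiff p n k)

/-- The left `W_{n+1}(B)`-module structure. -/
instance wittDiffModule (B : Type*) [CommRing B] [Algebra k B] :
    Module (W p n B) (wittDiff p n k B) :=
  Module.compHom _ (lmulWittDiff p n k B)

end Algebra

/-- For a `σ`-semilinear map `ρ : M → N` over a ring map `σ : R → S`, the induced map
`S ⊗_R M → N` is an isomorphism. -/
def IsBaseChangeAlong {R S M N : Type*} [CommRing R] [CommRing S] [AddCommMonoid M]
    [AddCommMonoid N] [Module R M] [Module S N] {σ : R →+* S} (ρ : M →ₛₗ[σ] N) : Prop :=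
  letI : Algebra R S := σ.toAlgebra
  letI : Module R N := Module.compHom N σ
  haveI : IsScalarTower R S N := ⟨fun r s x => mul_smul (σ r) s x⟩
  IsBaseChange S ({ toFun := ρ, map_add' := map_add ρ, map_smul' := map_smulₛₗ ρ } : M →ₗ[R] N)

/-! ### The sheaves on a scheme -/

section Scheme

open CategoryTheory Opposite TopologicalSpace AlgebraicGeometry

variable {p n : ℕ} [Fact p.Prime]

variable (p n) in
/-- The functor `W_{n+1}` on commutative rings. -/
def wittFunctor : CommRingCat.{u} ⥤ RingCat.{u} where
  obj B := RingCat.of (W p n B)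
  map g := RingCat.ofHom (wittMap g.hom)
  map_id B := RingCat.hom_ext (RingHom.ext fun x =>
    TruncatedWittVector.ext fun i => coeff_wittMap _ x i)
  map_comp g h := RingCat.hom_ext (RingHom.ext fun x =>
    TruncatedWittVector.ext fun i => by
      change (wittMap (g ≫ h).hom x).coeff i = (wittMap h.hom (wittMap g.hom x)).coeff i
      simp only [coeff_wittMap]
      rfl)

variable (p n) in
/-- The presheaf of rings `U ↦ W_{n+1}(𝒪_X(U))`. -/
def wittPresheaf (X : Scheme.{u}) : X.Opensᵒᵖ ⥤ RingCat.{u} :=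
  X.presheaf ⋙ wittFunctor p n

theorem wittPresheaf_isSheaf (X : Scheme.{u}) :
    Presheaf.IsSheaf (Opens.grothendieckTopology X) (wittPresheaf p n X) := by
  change TopCat.Presheaf.IsSheaf (X := X.carrier) (wittPresheaf p n X)
  rw [TopCat.Presheaf.isSheaf_iff_isSheafUniqueGluing]
  intro ι U sf hsf
  have h : ∀ j : Fin (n + 1), ∃! s : Γ(X, iSup U),
      ∀ i, X.presheaf.map (Opens.leSupr U i).op s = TruncatedWittVector.coeff (p := p) j (sf i) := by
    intro j
    refine X.sheaf.existsUnique_gluing U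
      (fun i => TruncatedWittVector.coeff (p := p) j (sf i)) fun a b => ?_
    have := congrArg (fun x : W p n Γ(X, U a ⊓ U b) => x.coeff j) (hsf a b)
    exact this
  choose s hs hu using h
  refine ⟨(TruncatedWittVector.mk p s : W p n Γ(X, iSup U)), ?_, ?_⟩
  · intro i
    exact TruncatedWittVector.ext fun j => hs j i
  · intro t ht
    refine TruncatedWittVector.ext fun j => hu j _ fun i => ?_
    exact congrArg (fun x : W p n Γ(X, U i) => x.coeff j) (ht i)

variable (p n) in
/-- The sheaf of rings `W_{n+1}𝒪_X` on `X`. -/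
def wittSheaf (X : Scheme.{u}) : Sheaf (Opens.grothendieckTopology X) RingCat.{u} :=
  ⟨wittPresheaf p n X, wittPresheaf_isSheaf X⟩

variable {k : Type u} [CommRing k] {X : Scheme.{u}} (f : X ⟶ Spec (.of k))

/-- The ring `𝒪_X(U)`, with its structure of a `k`-algebra given by `f : X ⟶ Spec k`. -/
def Sec (_ : X ⟶ Spec (.of k)) (U : X.Opens) : Type u := Γ(X, U)

instance (U : X.Opens) : CommRing (Sec f U) := inferInstanceAs (CommRing Γ(X, U))

/-- Restriction of functions. -/
def res {U V : X.Opens} (h : V ≤ U) : Sec f U →+* Sec f V := (X.presheaf.map (homOfLE h).op).hom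

instance (U : X.Opens) : Algebra k (Sec f U) :=
  ((res f (le_top : U ≤ ⊤)).comp
    (f.appTop.hom.comp (Scheme.ΓSpecIso (.of k)).inv.hom)).toAlgebra

theorem res_self {U : X.Opens} (h : U ≤ U) (x : Sec f U) : res f h x = x := by
  exact DFunLike.congr_fun (congrArg CommRingCat.Hom.hom (X.presheaf.map_id (op U))) x

theorem res_res {U V T : X.Opens} (h : V ≤ U) (h' : T ≤ V) (x : Sec f U) :
    res f h' (res f h x) = res f (h'.trans h) x := by
  exact (DFunLike.congr_fun (congrArg CommRingCat.Hom.hom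
    (X.presheaf.map_comp (homOfLE h).op (homOfLE h').op)) x).symm

variable (p n) in
/-- Restriction of Witt vectors of functions. -/
def wres {U V : X.Opens} (h : V ≤ U) : W p n (Sec f U) →+* W p n (Sec f V) := wittMap (res f h)

theorem wres_self {U : X.Opens} (h : U ≤ U) (x : W p n (Sec f U)) : wres p n f h x = x :=
  TruncatedWittVector.ext fun i => by simp [wres, res_self]

theorem wres_wres {U V T : X.Opens} (h : V ≤ U) (h' : T ≤ V) (x : W p n (Sec f U)) :
    wres p n f h' (wres p n f h x) = wres p n f (h'.trans h) x :=
  TruncatedWittVector.ext fun i => by simp [wres, res_res]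

/-- `U` is a local chart of the `k`-scheme `X`: an affine open subset with étale coordinates. -/
def IsChart (U : X.Opens) : Prop :=
  IsAffineOpen U ∧ ∃ (m : ℕ) (z : Fin m → Sec f U), IsCoord k z

theorem algebraMap_sec {U V : X.Opens} (h : V ≤ U) (c : k) :
    res f h (algebraMap k (Sec f U) c) = algebraMap k (Sec f V) c :=
  res_res f le_top h _

theorem wres_algebraMap {U V : X.Opens} (h : V ≤ U) (c : W p n k) :
    wres p n f h (algebraMap (W p n k) (W p n (Sec f U)) c) =
      algebraMap (W p n k) (W p n (Sec f V)) c :=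
  TruncatedWittVector.ext fun i => by
    change (wittMap (res f h) (wittMap (algebraMap k (Sec f U)) c)).coeff i =
      (wittMap (algebraMap k (Sec f V)) c).coeff i
    simp [algebraMap_sec]

/-- A family of elements `θ_U ∈ 𝒟_{W_{n+1}}(𝒪_X(U))`, for the local charts `U ⊆ V`, which is
compatible with restriction. -/
structure IsWittDiffFamily {V : X.Opens}
    (θ : ∀ U : {U : X.Opens // IsChart f U ∧ U ≤ V},
      Module.End (W p n k) (W p n (Sec f U.1))) : Prop where
  mem : ∀ U, θ U ∈ wittDiff p n k (Sec f U.1)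
  compat : ∀ (U U' : {U : X.Opens // IsChart f U ∧ U ≤ V}) (h : U'.1 ≤ U.1)
    (x : W p n (Sec f U.1)), θ U' (wres p n f h x) = wres p n f h (θ U x)

variable (p n) in
/-- The sections over `V` of the presheaf of Witt differential operators: compatible families of
elements `θ_U ∈ 𝒟_{W_{n+1}}(𝒪_X(U))`, for the local charts `U ⊆ V`. -/
def wittDiffSections (V : X.Opens) :
    Subalgebra (W p n k)
      (∀ U : {U : X.Opens // IsChart f U ∧ U ≤ V}, Module.End (W p n k) (W p n (Sec f U.1))) where
  carrier := {θ | IsWittDiffFamily f θ}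
  mul_mem' := fun {θ η} hθ hη => ⟨fun U => mul_mem (hθ.mem U) (hη.mem U), fun U U' h x => by
    simp [Module.End.mul_apply, hη.compat U U' h, hθ.compat U U' h]⟩
  add_mem' := fun {θ η} hθ hη => ⟨fun U => add_mem (hθ.mem U) (hη.mem U), fun U U' h x => by
    simp [hη.compat U U' h, hθ.compat U U' h]⟩
  algebraMap_mem' := fun c => ⟨fun U => Subalgebra.algebraMap_mem _ c, fun U U' h x => by
    simp [Algebra.smul_def, wres_algebraMap]⟩

theorem wittDiffSections_prop {V : X.Opens} (θ : wittDiffSections p n f V) :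
    IsWittDiffFamily f θ.1 := θ.2

/-- The multiplication operators given by the elements of `W_{n+1}(𝒪_X(V))`. -/
def lmulSections (V : X.Opens) : W p n (Sec f V) →+* wittDiffSections p n f V where
  toFun b := ⟨fun U => Algebra.lmul (W p n k) (W p n (Sec f U.1)) (wres p n f U.2.2 b),
    fun U => lmul_mem_wittDiff p n k _, fun U U' h x => by simp [wres_wres]⟩
  map_one' := by ext; simp
  map_zero' := by ext; simp
  map_add' _ _ := by ext; simp
  map_mul' _ _ := by ext; simp [mul_assoc]

/-- The left `W_{n+1}(𝒪_X(V))`-module structure on the sections over `V`. -/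
instance wittDiffSectionsModule (V : X.Opens) :
    Module (W p n (Sec f V)) (wittDiffSections p n f V) :=
  Module.compHom _ (lmulSections f V)

variable (p n) in
/-- Restriction of sections. -/
def resSections {V V' : X.Opens} (h : V' ≤ V) :
    wittDiffSections p n f V →+* wittDiffSections p n f V' where
  toFun θ := ⟨fun U => θ.1 ⟨U.1, U.2.1, U.2.2.trans h⟩,
    fun U => (wittDiffSections_prop f θ).mem ⟨U.1, U.2.1, U.2.2.trans h⟩,
    fun U U' => (wittDiffSections_prop f θ).compat ⟨U.1, U.2.1, U.2.2.trans h⟩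
      ⟨U'.1, U'.2.1, U'.2.2.trans h⟩⟩
  map_one' := Subtype.ext (funext fun _ => rfl)
  map_zero' := Subtype.ext (funext fun _ => rfl)
  map_add' _ _ := Subtype.ext (funext fun _ => rfl)
  map_mul' _ _ := Subtype.ext (funext fun _ => rfl)

theorem resSections_smul {V V' : X.Opens} (h : V' ≤ V) (b : W p n (Sec f V))
    (θ : wittDiffSections p n f V) :
    resSections p n f h (b • θ) = wres p n f h b • resSections p n f h θ := by
  change resSections p n f h (lmulSections f V b * θ) =
    lmulSections f V' (wres p n f h b) * resSections p n f h θ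
  rw [map_mul]
  congr 1
  refine Subtype.ext (funext fun U => ?_)
  change Algebra.lmul (W p n k) (W p n (Sec f U.1)) (wres p n f _ b) =
    Algebra.lmul (W p n k) (W p n (Sec f U.1)) (wres p n f _ (wres p n f h b))
  rw [wres_wres]

instance wittSheafModule (V : X.Opensᵒᵖ) :
    Module ((wittSheaf p n X).obj.obj V) (wittDiffSections p n f V.unop) :=
  wittDiffSectionsModule f V.unop

theorem resSections_smul' {V V' : X.Opensᵒᵖ} (g : V ⟶ V') (b : (wittSheaf p n X).obj.obj V)
    (θ : wittDiffSections p n f V.unop) :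
    resSections p n f g.unop.le (b • θ) =
      ((wittSheaf p n X).obj.map g).hom b • resSections p n f g.unop.le θ :=
  resSections_smul f g.unop.le b θ

variable (p n) in
/-- The module of sections over `V`. -/
def wittDiffObj (V : X.Opensᵒᵖ) : ModuleCat.{u} ((wittSheaf p n X).obj.obj V) :=
  ModuleCat.of ((wittSheaf p n X).obj.obj V) (wittDiffSections p n f V.unop)

variable (p n) in
/-- Restriction of sections, as a morphism of modules. -/
def wittDiffMap {V V' : X.Opensᵒᵖ} (g : V ⟶ V') : wittDiffObj p n f V ⟶
    (ModuleCat.restrictScalars ((wittSheaf p n X).obj.map g).hom).obj (wittDiffObj p n f V') :=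
  ModuleCat.ofHom
    (X := wittDiffSections p n f V.unop)
    (Y := (ModuleCat.restrictScalars ((wittSheaf p n X).obj.map g).hom).obj (wittDiffObj p n f V'))
    { toFun := resSections p n f g.unop.le
      map_add' := (resSections p n f g.unop.le).map_add'
      map_smul' := resSections_smul' f g }

theorem wittDiffMap_id (V : X.Opensᵒᵖ) : wittDiffMap p n f (𝟙 V) =
    (ModuleCat.restrictScalarsId' ((wittSheaf p n X).obj.map (𝟙 V)).hom
      (congrArg RingCat.Hom.hom ((wittSheaf p n X).obj.map_id V))).inv.app _ := by
  apply ModuleCat.hom_ext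
  apply LinearMap.ext
  intro θ
  exact (Subtype.ext rfl : resSections p n f (le_refl V.unop) θ = θ)

variable (p n) in
/-- The presheaf `𝒟_{W_{n+1}(X)}` of `W_{n+1}𝒪_X`-modules. -/
def wittDiffPresheaf : PresheafOfModules.{u} (wittSheaf p n X).obj where
  obj := wittDiffObj p n f
  map := wittDiffMap p n f
  map_id := wittDiffMap_id f
  map_comp _ _ := ModuleCat.hom_ext (LinearMap.ext fun _ => Subtype.ext rfl)

variable (p n) in
/-- The value `θ_U ∈ 𝒟_{W_{n+1}}(𝒪_X(U))` of a section `θ` over a local chart `U`. -/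
def evalChart {U : X.Opens} (hU : IsChart f U) :
    wittDiffSections p n f U →ₗ[W p n (Sec f U)] wittDiff p n k (Sec f U) where
  toFun θ := ⟨θ.1 ⟨U, hU, le_rfl⟩, (wittDiffSections_prop f θ).mem ⟨U, hU, le_rfl⟩⟩
  map_add' _ _ := Subtype.ext rfl
  map_smul' b θ := by
    refine Subtype.ext ?_
    change Algebra.lmul (W p n k) (W p n (Sec f U)) (wres p n f le_rfl b) * _ =
      Algebra.lmul (W p n k) (W p n (Sec f U)) b * _
    rw [wres_self]

instance wittSheafModuleChart (U : X.Opens) :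
    Module ((wittSheaf p n X).obj.obj (op U)) (wittDiff p n k (Sec f U)) :=
  wittDiffModule p n k (Sec f U)

/-- Identifications, compatible with restriction, of the sections of a sheaf `G` of
`W_{n+1}𝒪_X`-modules over the local charts contained in one of the `𝒰 i` with the modules
`𝒟_{W_{n+1}}(𝒪_X(U))`; in other words, isomorphisms of `G|_{𝒰 i}` with the presheaf of Witt
differential operators on the charts of `𝒰 i`, which agree on the overlaps. -/
structure ChartIdent (G : SheafOfModules.{u} (wittSheaf p n X)) {ι : Type u}
    (𝒰 : ι → X.Opens) where
  iso : ∀ U : {U : X.Opens // IsChart f U ∧ ∃ i, U ≤ 𝒰 i},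
    G.val.obj (op U.1) ≃ₗ[(wittSheaf p n X).obj.obj (op U.1)] wittDiff p n k (Sec f U.1)
  compat : ∀ (U U' : {U : X.Opens // IsChart f U ∧ ∃ i, U ≤ 𝒰 i}) (h : U'.1 ≤ U.1)
    (s : G.val.obj (op U.1)) (x : W p n (Sec f U.1)),
    (iso U' ((G.val.map (homOfLE h).op).hom s)).1 (wres p n f h x) =
      wres p n f h ((iso U s).1 x)

/-- A family of elements `θ_U ∈ 𝒟(𝒪_X(U))`, for the affine open `U ⊆ V`, which is compatible
with restriction. -/
structure IsDiffFamily {V : X.Opens}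
    (θ : ∀ U : {U : X.Opens // IsAffineOpen U ∧ U ≤ V}, Module.End k (Sec f U.1)) : Prop where
  mem : ∀ U, θ U ∈ diffOps k (Sec f U.1)
  compat : ∀ (U U' : {U : X.Opens // IsAffineOpen U ∧ U ≤ V}) (h : U'.1 ≤ U.1)
    (x : Sec f U.1), θ U' (res f h x) = res f h (θ U x)

/-- The sections over `V` of Grothendieck's sheaf `𝒟_X` of differential operators: compatible
families of elements `θ_U ∈ 𝒟(𝒪_X(U))`, for the affine open `U ⊆ V`. -/
def diffSections (V : X.Opens) :
    Subalgebra k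
      (∀ U : {U : X.Opens // IsAffineOpen U ∧ U ≤ V}, Module.End k (Sec f U.1)) where
  carrier := {θ | IsDiffFamily f θ}
  mul_mem' := fun {θ η} hθ hη => ⟨fun U => mul_mem (hθ.mem U) (hη.mem U), fun U U' h x => by
    simp [Module.End.mul_apply, hη.compat U U' h, hθ.compat U U' h]⟩
  add_mem' := fun {θ η} hθ hη => ⟨fun U => add_mem (hθ.mem U) (hη.mem U), fun U U' h x => by
    simp [hη.compat U U' h, hθ.compat U U' h]⟩
  algebraMap_mem' := fun c => ⟨fun U => Subalgebra.algebraMap_mem _ c, fun U U' h x => by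
    simp [Algebra.smul_def, algebraMap_sec]⟩

theorem diffSections_prop {V : X.Opens} (θ : diffSections f V) : IsDiffFamily f θ.1 := θ.2

/-- The value `θ_U ∈ 𝒟(𝒪_X(U))` of a section `θ` of `𝒟_X` over an affine open `U`. -/
def evalAffine {U : X.Opens} (hU : IsAffineOpen U) (θ : diffSections f U) :
    diffOps k (Sec f U) :=
  ⟨θ.1 ⟨U, hU, le_rfl⟩, (diffSections_prop f θ).mem ⟨U, hU, le_rfl⟩⟩

end Scheme

end WittDiff

end

open CategoryTheory Opposite TopologicalSpace AlgebraicGeometry WittDiff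

/-! Let B be a k-algebra with coordinates z. Étale algebras lift along nilpotent thickenings, so B
has a lift C that is étale over the polynomial ring W_{n+1}(k)[t]. Since p^(n+1) = 0 in C, the n-th
ghost component of a Witt vector over C depends only on its first n + 1 components modulo p. It
therefore induces a ring map W_{n+1}(B) → C, and this map is injective because B is reduced
(`ghostHom_injective`). Operators on W_{n+1}(B) are studied as restrictions of operators on C.

Existence: formal smoothness gives Hasse-Schmidt derivations D_i : C → C⟦X⟧ with z_j ↦ z_j + δ_ij X.
The r-th coefficient of the n-th ghost component of a Witt vector over C⟦X⟧ is a sum of terms ±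
p^(n-u) b^(p^u) with p^u ∣ r (`coeff_ghostComponent_mem`). For r ≠ 0 it is thus the ghost component
of some V^(n-v_p(r)) y. Hence the coefficients D_{i,r} preserve W_{n+1}(B), and a • ∂ is, inside C,
multiplication by the ghost component of index v_p(r) of a lift of a (`isBullet_iff`).

Rigidity: where p^(n+1) = 0, a differential operator commutes with all p^M-th powers for large M,
and Hasse-Schmidt components are linear over such powers too. An étale algebra in characteristic p
is generated over its base by p^M-th powers, so W_{n+1}(B) is additively generated by elements
V^j[a] [c]^(p^M) with a coming from k[t]. Operators are thus determined on W_{n+1}(k[t])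
(`eq_zero_of_isCoord`). This gives uniqueness of the lifts and compatibility with restriction.

Independence of coordinates: two systems lift to the same C, and each D'_r has a Taylor expansion in
the compositions D^s with coefficients taken from ∏ (D' z_i - z_i)^(s_i) (`hsCoeff_eq_sum_hsMulti`).
If p^v is the exact power of p dividing all s_i, this product is a p^v-th power. Its r-th
coefficient, times the ghost component attached to a, is a v-th ghost component, which is what a
bullet operator of index s_{i₀} with v_p(s_{i₀}) = v requires (`isBullet_mem`).

Globally, W_{n+1}(B_g) is W_{n+1}(B) with [g] inverted, and denominators of operators are cleared by
powers of [g] (`exists_mem_wittDiff_of_away`). Membership in the algebra is local because the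
multipliers bringing an operator into it form an ideal. Gluing is done value by value and
componentwise. Over a chart all sections and all relations present the sheaf, since linear maps on
sections over the chart extend to morphisms of sheaves.

For n = 0 the lift can be taken to be W_1(B) itself, and étale coordinates generate all differential
operators (`IsDiffOp.mem_of_hsCoeff_mem`). -/

noncomputable section
namespace WittDiff

/-! ### Witt vectors: additive generators, Teichmüller elements, Verschiebung, truncation -/

section WittBasics

variable {p n : ℕ} [Fact p.Prime]

/-- A Witt vector whose components in degrees `< m` vanish lies in the image of `V^m`. -/
theorem exists_iterate_verschiebung {B : Type*} [CommRing B] {x : WittVector p B} {m : ℕ}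
    (h : ∀ i < m, x.coeff i = 0) : ∃ y, x = (WittVector.verschiebung)^[m] y :=
  ⟨_, WittVector.eq_iterate_verschiebung h⟩

theorem exists_sub_eq_verschiebung {B : Type*} [CommRing B] {x y : WittVector p B}
    (h : x.coeff 0 = y.coeff 0) : ∃ z, x = y + WittVector.verschiebung z := by
  obtain ⟨z, hz⟩ := exists_iterate_verschiebung (x := x - y) (m := 1) (by
    intro i hi
    obtain rfl : i = 0 := by omega
    exact (map_sub (WittVector.constantCoeff (p := p) (R := B)) x y).trans (by
      simpa [sub_eq_zero] using h))
  exact ⟨z, by rw [← sub_eq_iff_eq_add', hz]; rfl⟩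

/-- The iterated Verschiebung as an additive map. -/
theorem iterate_verschiebung_add {B : Type*} [CommRing B] (j : ℕ) (x y : WittVector p B) :
    (WittVector.verschiebung)^[j] (x + y) =
      (WittVector.verschiebung)^[j] x + (WittVector.verschiebung)^[j] y := by
  induction j generalizing x y with
  | zero => rfl
  | succ j ih => simp [Function.iterate_succ_apply, ih]

theorem iterate_verschiebung_zero {B : Type*} [CommRing B] (j : ℕ) :
    (WittVector.verschiebung)^[j] (0 : WittVector p B) = 0 := by
  induction j with
  | zero => rfl
  | succ j ih => simp [Function.iterate_succ_apply, ih]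

/-- Up to `V^N`, Witt vectors are sums of elements `V^j [g]` with `g` in a given set of additive
generators of the ring. -/
theorem addSubgroup_eq_top_of_verschiebung_teichmuller {B : Type*} [CommRing B] {G : Set B}
    (hG : AddSubgroup.closure G = ⊤) (N : ℕ) (H : AddSubgroup (WittVector p B))
    (hN : ∀ y, (WittVector.verschiebung)^[N] y ∈ H)
    (hH : ∀ j < N, ∀ g ∈ G,
      (WittVector.verschiebung)^[j] (WittVector.teichmuller p g) ∈ H) : H = ⊤ := by
  -- Descending induction on the power of V, from V^N down to V^0.
  suffices h : ∀ i ≤ N, ∀ y, (WittVector.verschiebung)^[N - i] y ∈ H by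
    rw [eq_top_iff]
    intro y _
    simpa using h N le_rfl y
  intro i
  induction i with
  | zero => intro _; simpa using hN
  | succ i ih =>
    intro hi
    have ih' := ih (by omega)
    obtain ⟨j, hj, hj'⟩ : ∃ j, N - (i + 1) = j ∧ N - i = j + 1 := ⟨_, rfl, by omega⟩
    rw [hj]
    rw [hj'] at ih'
    -- Two vectors with the same zeroth component differ by some V z, so their images under V^j
    -- differ by V^(j+1) z, already known to lie in H. Modulo H the map b ↦ V^j [b] is therefore
    -- additive, and additive generators suffice.
    have step : ∀ x y : WittVector p B, x.coeff 0 = y.coeff 0 →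
        (WittVector.verschiebung)^[j] y ∈ H → (WittVector.verschiebung)^[j] x ∈ H := by
      intro x y hxy hy
      obtain ⟨z, rfl⟩ := exists_sub_eq_verschiebung hxy
      rw [iterate_verschiebung_add, ← Function.iterate_succ_apply]
      exact add_mem hy (ih' z)
    have coeff_add : ∀ x y : WittVector p B, (x + y).coeff 0 = x.coeff 0 + y.coeff 0 :=
      map_add (WittVector.constantCoeff (p := p) (R := B))
    have key : ∀ b : B, (WittVector.verschiebung)^[j] (WittVector.teichmuller p b) ∈ H := by
      intro b
      have hb : b ∈ AddSubgroup.closure G := hG ▸ AddSubgroup.mem_top b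
      induction hb using AddSubgroup.closure_induction with
      | mem g hg => exact hH j (by omega) g hg
      | zero => rw [WittVector.teichmuller_zero, iterate_verschiebung_zero]; exact zero_mem H
      | add a b _ _ ha hb =>
        refine step _ (WittVector.teichmuller p a + WittVector.teichmuller p b) ?_ ?_
        · simp [coeff_add]
        · rw [iterate_verschiebung_add]; exact add_mem ha hb
      | neg a _ ha =>
        have h0 : (WittVector.verschiebung)^[j] (WittVector.teichmuller p a +
            WittVector.teichmuller p (-a)) ∈ H := by
          refine step _ 0 ?_ ?_
          · simp [coeff_add]
          · rw [iterate_verschiebung_zero]; exact zero_mem H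
        rw [iterate_verschiebung_add] at h0
        exact (AddSubgroup.add_mem_cancel_left H ha).mp h0
    intro y
    exact step y (WittVector.teichmuller p (y.coeff 0)) (by simp) (key _)

theorem map_frobenius {B C : Type*} [CommRing B] [CommRing C] (g : B →+* C) (x : WittVector p B) :
    WittVector.map g (WittVector.frobenius x) = WittVector.frobenius (WittVector.map g x) := by
  ext i
  rw [WittVector.map_coeff, WittVector.coeff_frobenius, WittVector.coeff_frobenius,
    MvPolynomial.map_aeval, MvPolynomial.aeval_def]
  rw [MvPolynomial.coe_eval₂Hom, RingHom.ext_int (g.comp (algebraMap ℤ B)) (algebraMap ℤ C)]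
  rfl

/-- No characteristic is assumed. By functoriality the element may be taken to be the variable of an
integral polynomial ring, which embeds into its rational version, where ghost components determine a
Witt vector. -/
theorem frobenius_teichmuller {B : Type*} [CommRing B] (g : B) :
    WittVector.frobenius (WittVector.teichmuller p g) = WittVector.teichmuller p (g ^ p) := by
  suffices h : WittVector.frobenius (WittVector.teichmuller p (MvPolynomial.X () :
      MvPolynomial Unit ℤ)) = WittVector.teichmuller p (MvPolynomial.X () ^ p) by
    have := congrArg (WittVector.map (MvPolynomial.eval₂Hom (Int.castRingHom B)
      (fun _ : Unit => g))) h
    simpa [map_frobenius, WittVector.map_teichmuller] using this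
  apply WittVector.map_injective (MvPolynomial.map (Int.castRingHom ℚ))
    (MvPolynomial.map_injective _ Int.cast_injective)
  apply (WittVector.ghostMap.bijective_of_invertible p (MvPolynomial Unit ℚ)).1
  funext m
  rw [map_frobenius, WittVector.map_teichmuller, WittVector.map_teichmuller]
  change WittVector.ghostComponent m _ = WittVector.ghostComponent m _
  rw [WittVector.ghostComponent_frobenius, WittVector.ghostComponent_teichmuller,
    WittVector.ghostComponent_teichmuller, map_pow, ← pow_mul, pow_succ']

theorem iterate_frobenius_teichmuller {B : Type*} [CommRing B] (j : ℕ) (g : B) :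
    (WittVector.frobenius)^[j] (WittVector.teichmuller p g) =
      WittVector.teichmuller p (g ^ p ^ j) := by
  induction j generalizing g with
  | zero => simp
  | succ j ih => rw [Function.iterate_succ_apply, frobenius_teichmuller, ih, ← pow_mul, pow_succ']

/-- Induction on i with x = [x₀] + V z: the projection formula gives [g] V z = V ([g^p] z), and the
components of [a] + V y can be read off because the two summands have disjoint supports. -/
theorem teichmuller_mul_coeff {B : Type*} [CommRing B] (g : B) (x : WittVector p B) (i : ℕ) :
    (WittVector.teichmuller p g * x).coeff i = g ^ p ^ i * x.coeff i := by
  induction i generalizing g x with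
  | zero => simp [WittVector.mul_coeff_zero]
  | succ i ih =>
    obtain ⟨z, hz⟩ := exists_sub_eq_verschiebung (x := x)
      (y := WittVector.teichmuller p (x.coeff 0)) (by simp)
    have dis : ∀ (a : B) (y : WittVector p B),
        (WittVector.teichmuller p a + WittVector.verschiebung y).coeff (i + 1) = y.coeff i := by
      intro a y
      rw [WittVector.coeff_add_of_disjoint]
      · rw [WittVector.teichmuller_coeff_pos _ _ _ (Nat.succ_pos i),
          WittVector.verschiebung_coeff_succ, zero_add]
      · intro m
        rcases Nat.eq_zero_or_pos m with rfl | hm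
        · right; exact WittVector.verschiebung_coeff_zero y
        · left; exact WittVector.teichmuller_coeff_pos _ _ _ hm
    have hF := frobenius_teichmuller (p := p) g
    conv_lhs => rw [hz]
    rw [mul_add, ← map_mul, mul_comm _ (WittVector.verschiebung z),
      ← WittVector.verschiebung_mul_frobenius, hF, dis, mul_comm z, ih, ← pow_mul, ← pow_succ']
    conv_rhs => rw [hz, dis]

theorem versch_truncate {B : Type*} [CommRing B] (x : WittVector p B) :
    versch (WittVector.truncate (n + 1) x : W p n B) =
      WittVector.truncate (n + 1) (WittVector.verschiebung x) := by
  ext i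
  refine Fin.cases ?_ (fun j => ?_) i
  · simp [versch, WittVector.coeff_truncate]
  · simp [versch, WittVector.coeff_truncate]

theorem iterate_versch_truncate {B : Type*} [CommRing B] (j : ℕ) (x : WittVector p B) :
    versch^[j] (WittVector.truncate (n + 1) x : W p n B) =
      WittVector.truncate (n + 1) ((WittVector.verschiebung)^[j] x) := by
  induction j generalizing x with
  | zero => rfl
  | succ j ih => simp [Function.iterate_succ_apply, versch_truncate, ih]

theorem pow_char_add {B : Type*} [CommRing B] (hp : (p : B) = 0) (x y : B) :
    (x + y) ^ p = x ^ p + y ^ p := by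
  cases subsingleton_or_nontrivial B
  · exact Subsingleton.elim _ _
  · have : CharP B p := (CharP.charP_iff_prime_eq_zero Fact.out).mpr hp
    exact add_pow_char ..

theorem pow_char_sub {B : Type*} [CommRing B] (hp : (p : B) = 0) (x y : B) :
    (x - y) ^ p = x ^ p - y ^ p := by
  rw [eq_sub_iff_add_eq, ← pow_char_add hp, sub_add_cancel]

theorem frob_truncate {B : Type*} [CommRing B] (hp : (p : B) = 0) (x : WittVector p B) :
    frob (WittVector.truncate (n + 1) x : W p n B) =
      WittVector.truncate (n + 1) (WittVector.frobenius x) := by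
  ext i
  cases subsingleton_or_nontrivial B
  · exact Subsingleton.elim _ _
  · have : CharP B p := (CharP.charP_iff_prime_eq_zero Fact.out).mpr hp
    simp [frob, WittVector.coeff_truncate, WittVector.coeff_frobenius_charP]

theorem iterate_frob_truncate {B : Type*} [CommRing B] (hp : (p : B) = 0) (j : ℕ)
    (x : WittVector p B) :
    frob^[j] (WittVector.truncate (n + 1) x : W p n B) =
      WittVector.truncate (n + 1) ((WittVector.frobenius)^[j] x) := by
  induction j generalizing x with
  | zero => rfl
  | succ j ih => simp [Function.iterate_succ_apply, frob_truncate hp, ih]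

theorem teich_eq_truncate {B : Type*} [CommRing B] (c : B) :
    (teich c : W p n B) = WittVector.truncate (n + 1) (WittVector.teichmuller p c) := by
  ext i
  refine Fin.cases ?_ (fun j => ?_) i
  · simp [teich, WittVector.coeff_truncate]
  · simp [teich, WittVector.coeff_truncate, WittVector.teichmuller_coeff_pos]

theorem teich_mul {B : Type*} [CommRing B] (c d : B) :
    (teich (c * d) : W p n B) = teich c * teich d := by
  simp [teich_eq_truncate]

theorem teich_one {B : Type*} [CommRing B] : (teich (1 : B) : W p n B) = 1 := by
  simp [teich_eq_truncate]

theorem teich_pow {B : Type*} [CommRing B] (c : B) (m : ℕ) :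
    (teich (c ^ m) : W p n B) = teich c ^ m := by
  simp [teich_eq_truncate]

theorem coeff_teich_mul {B : Type*} [CommRing B] (g : B) (x : W p n B) (i : Fin (n + 1)) :
    (teich g * x).coeff i = g ^ p ^ (i : ℕ) * x.coeff i := by
  obtain ⟨x, rfl⟩ := WittVector.truncate_surjective p (n + 1) B x
  rw [teich_eq_truncate, ← map_mul, WittVector.coeff_truncate, WittVector.coeff_truncate,
    teichmuller_mul_coeff]

theorem wittMap_truncate {B C : Type*} [CommRing B] [CommRing C] (g : B →+* C)
    (x : WittVector p B) : wittMap g (WittVector.truncate (n + 1) x : W p n B) =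
      WittVector.truncate (n + 1) (WittVector.map g x) := by
  ext i; simp [WittVector.coeff_truncate, WittVector.map_coeff]

theorem wittMap_versch {B C : Type*} [CommRing B] [CommRing C] (g : B →+* C) (x : W p n B) :
    wittMap g (versch x) = versch (wittMap g x) := by
  ext i
  refine Fin.cases ?_ (fun j => ?_) i <;> simp [versch]

theorem wittMap_iterate_versch {B C : Type*} [CommRing B] [CommRing C] (g : B →+* C) (j : ℕ)
    (x : W p n B) : wittMap g (versch^[j] x) = versch^[j] (wittMap g x) := by
  induction j generalizing x with
  | zero => rfl
  | succ j ih => simp [Function.iterate_succ_apply, wittMap_versch, ih]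

theorem wittMap_iterate_frob {B C : Type*} [CommRing B] [CommRing C] (g : B →+* C) (j : ℕ)
    (x : W p n B) : wittMap g (frob^[j] x) = frob^[j] (wittMap g x) := by
  induction j generalizing x with
  | zero => rfl
  | succ j ih =>
    rw [Function.iterate_succ_apply, Function.iterate_succ_apply, ih]
    congr 1
    ext i; simp [frob]

theorem wittMap_teich {B C : Type*} [CommRing B] [CommRing C] (g : B →+* C) (c : B) :
    wittMap g (teich c : W p n B) = teich (g c) := by
  simp [teich_eq_truncate, wittMap_truncate, WittVector.map_teichmuller]

theorem truncate_iterate_verschiebung_eq_iff {B : Type*} [CommRing B] {j : ℕ} (hj : j ≤ n)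
    (x y : WittVector p B) :
    WittVector.truncate (n + 1) ((WittVector.verschiebung)^[j] x) =
      WittVector.truncate (n + 1) ((WittVector.verschiebung)^[j] y) ↔
    WittVector.truncate (n + 1 - j) x = WittVector.truncate (n + 1 - j) y := by
  constructor
  · intro h
    ext i
    have := congrArg (fun t => TruncatedWittVector.coeff ⟨i + j, by omega⟩ t) h
    simpa [WittVector.coeff_truncate, WittVector.iterate_verschiebung_coeff] using this
  · intro h
    ext i
    rw [WittVector.coeff_truncate, WittVector.coeff_truncate]
    rcases lt_or_ge (i : ℕ) j with hi | hi
    · rw [WittVector.iterate_verschiebung_coeff_eq_zero _ hi,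
        WittVector.iterate_verschiebung_coeff_eq_zero _ hi]
    · obtain ⟨l, hl⟩ := Nat.exists_eq_add_of_le' hi
      have := congrArg (fun t => TruncatedWittVector.coeff ⟨l, by omega⟩ t) h
      rw [hl, WittVector.iterate_verschiebung_coeff, WittVector.iterate_verschiebung_coeff]
      simpa [WittVector.coeff_truncate] using this

/-- On vectors of length n + 1, V^j forgets exactly the last j components, and truncation to length
n + 1 - j is a ring homomorphism. Hence a bullet operation does not depend on the chosen preimage
under V^j. -/
theorem iterate_versch_mul_congr {B : Type*} [CommRing B] {j : ℕ} (hj : j ≤ n) {y y' : W p n B}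
    (c : W p n B) (h : versch^[j] y = versch^[j] y') :
    versch^[j] (c * y) = versch^[j] (c * y') := by
  obtain ⟨y, rfl⟩ := WittVector.truncate_surjective p (n + 1) B y
  obtain ⟨y', rfl⟩ := WittVector.truncate_surjective p (n + 1) B y'
  obtain ⟨c, rfl⟩ := WittVector.truncate_surjective p (n + 1) B c
  rw [← map_mul, ← map_mul, iterate_versch_truncate, iterate_versch_truncate,
    truncate_iterate_verschiebung_eq_iff hj, map_mul, map_mul]
  rw [iterate_versch_truncate, iterate_versch_truncate,
    truncate_iterate_verschiebung_eq_iff hj] at h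
  rw [h]

/-- `W_{n+1}(B)` is additively generated by the `V^j [g]`, for `g` in a set of additive generators
of `B`. -/
theorem addSubgroup_eq_top_of_versch_teich {B : Type*} [CommRing B] {G : Set B}
    (hG : AddSubgroup.closure G = ⊤) (H : AddSubgroup (W p n B))
    (hH : ∀ j ≤ n, ∀ g ∈ G, versch^[j] (teich g) ∈ H) : H = ⊤ := by
  have := addSubgroup_eq_top_of_verschiebung_teichmuller hG (n + 1)
    (H.comap (WittVector.truncate (p := p) (R := B) (n + 1)).toAddMonoidHom) (fun y => by
      change WittVector.truncate (n + 1) _ ∈ H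
      convert zero_mem H
      ext i
      rw [WittVector.coeff_truncate, WittVector.iterate_verschiebung_coeff_eq_zero _ i.2,
        TruncatedWittVector.coeff_zero]) (fun j hj g hg => by
      change WittVector.truncate (n + 1) _ ∈ H
      rw [← iterate_versch_truncate, ← teich_eq_truncate]
      exact hH j (by omega) g hg)
  rw [eq_top_iff]
  intro x _
  obtain ⟨x, rfl⟩ := WittVector.truncate_surjective p (n + 1) B x
  have hx := AddSubgroup.mem_top x
  rw [← this] at hx
  exact hx

/-- `V^j [a c^(p^(j + M))] = V^j [a] * [c]^(p^M)`. -/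
theorem iterate_versch_teich_mul_pow {B : Type*} [CommRing B] (j M : ℕ) (a c : B) :
    (versch^[j] (teich (a * c ^ p ^ (M + j))) : W p n B) =
      versch^[j] (teich a) * teich c ^ p ^ M := by
  rw [teich_eq_truncate, iterate_versch_truncate, ← teich_pow, teich_eq_truncate,
    teich_eq_truncate, iterate_versch_truncate, ← map_mul, WittVector.iterate_verschiebung_mul_left,
    iterate_frobenius_teichmuller, ← map_mul, ← pow_mul, ← pow_add]

end WittBasics
end WittDiff
end

noncomputable section
namespace WittDiff

/-! ### Differential operators: commutators with powers and with coordinates -/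

section DiffOpsGeneral

variable {R C : Type*} [CommRing R] [CommRing C] [Algebra R C]

theorem comm_apply (a x : C) (θ : Module.End R C) : comm R C a θ x = a * θ x - θ (a * x) := rfl

theorem comm_eq_zero_iff (a : C) (θ : Module.End R C) :
    comm R C a θ = 0 ↔ ∀ x, θ (a * x) = a * θ x := by
  rw [LinearMap.ext_iff]
  exact forall_congr' fun x => by
    rw [comm_apply, LinearMap.zero_apply, sub_eq_zero, eq_comm]

theorem comm_zero (a : C) : comm R C a 0 = 0 := by simp [comm]

theorem comm_neg (a : C) (θ : Module.End R C) : comm R C a (-θ) = -comm R C a θ := by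
  rw [eq_neg_iff_add_eq_zero, ← comm_add, neg_add_cancel]
  simp [comm]

theorem comm_sub (a : C) (θ η : Module.End R C) :
    comm R C a (θ - η) = comm R C a θ - comm R C a η := by
  rw [sub_eq_add_neg, comm_add, comm_neg, sub_eq_add_neg]

theorem comm_sum {ι : Type*} (s : Finset ι) (a : C) (θ : ι → Module.End R C) :
    comm R C a (∑ i ∈ s, θ i) = ∑ i ∈ s, comm R C a (θ i) := by
  classical
  induction s using Finset.induction_on with
  | empty => simp [comm_zero]
  | insert i s hi ih => rw [Finset.sum_insert hi, comm_add, ih, Finset.sum_insert hi]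

theorem comm_comm (a b : C) (θ : Module.End R C) :
    comm R C a (comm R C b θ) = comm R C b (comm R C a θ) := by
  ext x
  simp only [comm_apply, mul_sub, mul_left_comm]
  ring

theorem comm_lmul_mul (a b : C) (θ : Module.End R C) :
    comm R C a (Algebra.lmul R C b * θ) = Algebra.lmul R C b * comm R C a θ := by
  rw [comm_mul, comm_lmul, zero_mul, zero_add]

theorem isDiffOp_lmul (b : C) : IsDiffOp R C 0 (Algebra.lmul R C b) := fun a => comm_lmul a b

theorem IsDiffOp.lmul_mul {m : ℕ} {θ : Module.End R C} (h : IsDiffOp R C m θ) (b : C) :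
    IsDiffOp R C m (Algebra.lmul R C b * θ) := by
  simpa using (isDiffOp_lmul b).mul h

theorem IsDiffOp.neg {m : ℕ} {θ : Module.End R C} (h : IsDiffOp R C m θ) :
    IsDiffOp R C m (-θ) := by
  convert h.lmul_mul (-1) using 1
  ext x; simp

theorem IsDiffOp.sub {m : ℕ} {θ η : Module.End R C} (h : IsDiffOp R C m θ)
    (h' : IsDiffOp R C m η) : IsDiffOp R C m (θ - η) := by
  rw [sub_eq_add_neg]; exact h.add h'.neg

theorem IsDiffOp.sum {ι : Type*} {m : ℕ} (s : Finset ι) {θ : ι → Module.End R C}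
    (h : ∀ i ∈ s, IsDiffOp R C m (θ i)) : IsDiffOp R C m (∑ i ∈ s, θ i) := by
  classical
  induction s using Finset.induction_on with
  | empty => simpa using isDiffOp_zero m
  | insert i s hi ih =>
    rw [Finset.sum_insert hi]
    exact (h i (by simp)).add (ih fun j hj => h j (by simp [hj]))

/-- Since [e, θ] commutes with e, taking commutators with θ obeys the usual power rule of a
derivation on powers of e. -/
theorem comm_pow_eq {e : C} {θ : Module.End R C} (h : comm R C e (comm R C e θ) = 0) (m : ℕ) :
    comm R C (e ^ (m + 1)) θ = Algebra.lmul R C ((m + 1 : ℕ) * e ^ m) * comm R C e θ := by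
  rw [comm_eq_zero_iff] at h
  induction m with
  | zero => ext; simp
  | succ m ih =>
    have hm : ∀ k x, comm R C e θ (e ^ k * x) = e ^ k * comm R C e θ x := by
      intro k x
      induction k with
      | zero => simp
      | succ k ihk => rw [pow_succ', mul_assoc, h, ihk, mul_assoc]
    ext x
    have h1 : comm R C (e ^ (m + 1 + 1)) θ x =
        e * comm R C (e ^ (m + 1)) θ x + comm R C e θ (e ^ (m + 1) * x) := by
      simp only [comm_apply]
      rw [pow_succ' e (m + 1)]
      simp only [mul_assoc]; ring
    rw [h1, ih, hm]
    simp only [Module.End.mul_apply, Algebra.coe_lmul_eq_mul, LinearMap.mul_apply_apply]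
    push_cast
    ring

/-- Over a ring in which `p ^ (n + 1) = 0`, a differential operator commutes with the
multiplication by sufficiently high `p`-power powers. -/
theorem IsDiffOp.comm_pow_eq_zero {p n : ℕ} (hp0 : 0 < p) (hp : (p : C) ^ (n + 1) = 0) {N : ℕ}
    {θ : Module.End R C} (h : IsDiffOp R C N θ) (a : C) {M : ℕ} (hM : (n + 1) * N ≤ M) :
    comm R C (a ^ p ^ M) θ = 0 := by
  suffices H : ∀ a, comm R C (a ^ p ^ ((n + 1) * N)) θ = 0 by
    obtain ⟨d, rfl⟩ := Nat.exists_eq_add_of_le hM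
    rw [pow_add, mul_comm, pow_mul]
    exact H _
  clear hM a M
  induction N generalizing θ with
  | zero => intro a; exact h _
  | succ N ih =>
    intro a
    -- Put e = a^(p^((n+1)N)). By induction e commutes with [e, θ], which has order at most N, so
    -- the power rule gives [e^(p^(n+1)), θ] as a multiple of p^(n+1) = 0.
    have h1 := ih (h (a ^ p ^ ((n + 1) * N))) a
    have h2 := comm_pow_eq h1 (p ^ (n + 1) - 1)
    rw [Nat.sub_add_cancel (Nat.one_le_pow _ _ hp0)] at h2
    rw [mul_add, mul_one, pow_add, pow_mul, h2]
    simp [hp]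

/-- A differential operator on an unramified algebra which is linear over the base is
a multiplication operator. -/
theorem IsDiffOp.comm_eq_zero_of_formallyUnramified {A : Type*} [CommRing A] [Algebra A C]
    [Algebra.FormallyUnramified A C] {N : ℕ} {θ : Module.End R C}
    (h : IsDiffOp R C N θ) (hA : ∀ a : A, comm R C (algebraMap A C a) θ = 0) (c : C) :
    comm R C c θ = 0 := by
  induction N generalizing θ c with
  | zero => exact h c
  | succ N ih =>
    have hlin : ∀ c b x, comm R C c θ (b * x) = b * comm R C c θ x := by
      intro c b
      rw [← comm_eq_zero_iff]
      exact ih (h c) (fun a => by rw [comm_comm, hA, comm_zero]) b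
    have hA' : ∀ a x, θ (algebraMap A C a * x) = algebraMap A C a * θ x := fun a =>
      (comm_eq_zero_iff _ _).mp (hA a)
    -- By induction every [c, θ] is C-linear, so c ↦ [c, θ](1) is an A-derivation of C. It vanishes
    -- since the Kähler differentials do, and then [c, θ](x) = x [c, θ](1) = 0.
    let d : Derivation A C C :=
      { toFun := fun c => comm R C c θ 1
        map_add' := fun a b => by simp only [comm_apply, add_mul, map_add]; ring
        map_smul' := fun a b => by
          simp only [comm_apply, Algebra.smul_def, mul_assoc, hA', RingHom.id_apply]; ring
        map_one_eq_zero' := by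
          change comm R C 1 θ 1 = 0
          simp [comm_apply]
        leibniz' := fun a b => by
          change comm R C (a * b) θ 1 = a * comm R C b θ 1 + b * comm R C a θ 1
          rw [← hlin a b]
          simp only [comm_apply, mul_one, mul_assoc]; ring }
    have hd : d = 0 := by
      have := Algebra.FormallyUnramified.subsingleton_kaehlerDifferential (R := A) (A := C)
      rw [← d.liftKaehlerDifferential_comp, Subsingleton.elim d.liftKaehlerDifferential 0]
      ext x; rfl
    ext x
    have h1 : d c = 0 := by rw [hd]; rfl
    have := hlin c x 1
    rw [mul_one] at this
    rw [this]
    change x * d c = 0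
    rw [h1, mul_zero]

/-- A differential operator which commutes with unramified coordinates is a multiplication
operator. -/
theorem IsDiffOp.comm_eq_zero_of_coord {m : ℕ} {z : Fin m → C}
    (hz : (MvPolynomial.aeval z : MvPolynomial (Fin m) R →ₐ[R] C).toRingHom.FormallyUnramified)
    {N : ℕ} {θ : Module.End R C} (h : IsDiffOp R C N θ) (hθ : ∀ i, comm R C (z i) θ = 0) (c : C) :
    comm R C c θ = 0 := by
  let _ : Algebra (MvPolynomial (Fin m) R) C :=
    (MvPolynomial.aeval z : MvPolynomial (Fin m) R →ₐ[R] C).toRingHom.toAlgebra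
  have : Algebra.FormallyUnramified (MvPolynomial (Fin m) R) C := hz
  refine h.comm_eq_zero_of_formallyUnramified (A := MvPolynomial (Fin m) R) (fun a => ?_) c
  change comm R C (MvPolynomial.aeval z a) θ = 0
  rw [comm_eq_zero_iff]
  have hθ' := fun i => (comm_eq_zero_iff _ _).mp (hθ i)
  induction a using MvPolynomial.induction_on with
  | C a => intro x; simp [← Algebra.smul_def]
  | add f g hf hg => intro x; simp [add_mul, hf, hg]
  | mul_X f i hf => intro x; simp [mul_assoc, hf, hθ']

end DiffOpsGeneral

/-! ### Hasse-Schmidt derivations attached to étale coordinates -/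

section HasseSchmidt

open PowerSeries

variable {R C : Type*} [CommRing R] [CommRing C] [Algebra R C]

/-- The coefficients of a Hasse-Schmidt derivation. -/
def hsCoeff (D : C →ₐ[R] C⟦X⟧) (r : ℕ) : Module.End R C :=
  ((coeff (R := C) r).restrictScalars R).comp D.toLinearMap

theorem hsCoeff_apply (D : C →ₐ[R] C⟦X⟧) (r : ℕ) (c : C) : hsCoeff D r c = coeff r (D c) := rfl

theorem hsCoeff_mul_apply (D : C →ₐ[R] C⟦X⟧) (r : ℕ) (a b : C) :
    hsCoeff D r (a * b) = ∑ x ∈ Finset.HasAntidiagonal.antidiagonal r, hsCoeff D x.1 a * hsCoeff D x.2 b := by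
  simp [hsCoeff_apply, coeff_mul]

theorem hsCoeff_zero {D : C →ₐ[R] C⟦X⟧} (hD : ∀ c, constantCoeff (D c) = c) : hsCoeff D 0 = 1 := by
  ext c; simpa [hsCoeff_apply] using hD c

theorem hsCoeff_succ_one (D : C →ₐ[R] C⟦X⟧) (r : ℕ) : hsCoeff D (r + 1) 1 = 0 := by
  rw [hsCoeff_apply, map_one, coeff_one, if_neg (Nat.succ_ne_zero r)]

/-- This is the Leibniz rule with the term c D_{r+1} moved to the other side. Only operators of
index at most r remain on the right, which drives the inductions on r. -/
theorem comm_hsCoeff {D : C →ₐ[R] C⟦X⟧} (hD : ∀ c, constantCoeff (D c) = c) (r : ℕ) (c : C) :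
    comm R C c (hsCoeff D (r + 1)) = -∑ x ∈ Finset.HasAntidiagonal.antidiagonal r,
      Algebra.lmul R C (hsCoeff D (x.1 + 1) c) * hsCoeff D x.2 := by
  ext y
  rw [comm_apply, hsCoeff_mul_apply, Finset.Nat.antidiagonal_succ]
  simp [hsCoeff_zero hD]

theorem isDiffOp_hsCoeff {D : C →ₐ[R] C⟦X⟧} (hD : ∀ c, constantCoeff (D c) = c) (r : ℕ) :
    IsDiffOp R C r (hsCoeff D r) := by
  induction r using Nat.strong_induction_on with
  | _ r ih =>
    cases r with
    | zero => rw [hsCoeff_zero hD, ← map_one (Algebra.lmul R C)]; exact isDiffOp_lmul 1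
    | succ r =>
      intro c
      rw [comm_hsCoeff hD]
      refine (IsDiffOp.sum _ fun x hx => ?_).neg
      have hx := Finset.HasAntidiagonal.mem_antidiagonal.mp hx
      exact ((ih x.2 (by omega)).mono (by omega)).lmul_mul _

variable {m : ℕ} {z : Fin m → C}

/-- `D i` are the Hasse-Schmidt derivations with `z_j ↦ z_j + δ_{ij} X`. -/
structure IsCoordHS (z : Fin m → C) (D : Fin m → C →ₐ[R] C⟦X⟧) : Prop where
  constantCoeff : ∀ i c, PowerSeries.constantCoeff (D i c) = c
  coord : ∀ i j, D i (z j) = PowerSeries.C (z j) + if i = j then X else 0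

/-- C⟦X⟧ becomes an algebra over the polynomial ring through t_j ↦ z_j + δ_ij X. The map C →
C⟦X⟧/(X) is then linear over that ring and lifts to C⟦X⟧ by formal smoothness and X-adic
completeness. -/
theorem exists_isCoordHS
    (hz : (MvPolynomial.aeval z : MvPolynomial (Fin m) R →ₐ[R] C).toRingHom.FormallySmooth) :
    ∃ D : Fin m → C →ₐ[R] C⟦X⟧, IsCoordHS z D := by
  have key : ∀ i, ∃ D : C →ₐ[R] C⟦X⟧, (∀ c, PowerSeries.constantCoeff (D c) = c) ∧
      ∀ j, D (z j) = PowerSeries.C (z j) + if i = j then X else 0 := by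
    intro i
    let _ : Algebra (MvPolynomial (Fin m) R) C :=
      (MvPolynomial.aeval z : MvPolynomial (Fin m) R →ₐ[R] C).toRingHom.toAlgebra
    have : Algebra.FormallySmooth (MvPolynomial (Fin m) R) C := hz
    let ev : MvPolynomial (Fin m) R →ₐ[R] C⟦X⟧ :=
      MvPolynomial.aeval fun j => PowerSeries.C (z j) + if i = j then X else 0
    let _ : Algebra (MvPolynomial (Fin m) R) C⟦X⟧ := ev.toRingHom.toAlgebra
    let I : Ideal C⟦X⟧ := Ideal.span {X}
    let f : C →ₐ[MvPolynomial (Fin m) R] C⟦X⟧ ⧸ I :=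
      { toRingHom := (Ideal.Quotient.mk I).comp PowerSeries.C
        commutes' := fun a => by
          change Ideal.Quotient.mk I (PowerSeries.C (MvPolynomial.aeval z a)) =
            Ideal.Quotient.mk I (ev a)
          rw [Ideal.Quotient.eq, Ideal.mem_span_singleton, X_dvd_iff, map_sub, sub_eq_zero,
            ← coeff_zero_eq_constantCoeff_apply, coeff_zero_C]
          have : (MvPolynomial.aeval z : MvPolynomial (Fin m) R →ₐ[R] C).toRingHom =
              (PowerSeries.constantCoeff (R := C)).comp ev.toRingHom := by
            apply MvPolynomial.ringHom_ext
            · intro r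
              simp [ev, PowerSeries.algebraMap_apply]
            · intro j
              simp only [AlgHom.toRingHom_eq_coe, RingHom.coe_coe, MvPolynomial.aeval_X,
                RingHom.coe_comp, Function.comp_apply, ev]
              split_ifs <;> simp
          exact DFunLike.congr_fun this a }
    obtain ⟨g, hg⟩ := Algebra.FormallySmooth.exists_mkₐ_comp_eq_of_isAdicComplete f
    have hgc : ∀ a : MvPolynomial (Fin m) R, g (MvPolynomial.aeval z a) = ev a := fun a =>
      g.commutes a
    refine ⟨{ toRingHom := g.toRingHom, commutes' := fun r => ?_ }, fun c => ?_, fun j => ?_⟩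
    · exact (congrArg g (MvPolynomial.aeval_C z r).symm).trans ((hgc (MvPolynomial.C r)).trans (by simp [ev]))
    · have := DFunLike.congr_fun hg c
      change Ideal.Quotient.mk I (g c) = Ideal.Quotient.mk I (PowerSeries.C c) at this
      rw [Ideal.Quotient.eq, Ideal.mem_span_singleton, X_dvd_iff, map_sub, sub_eq_zero] at this
      simpa using this
    · have := hgc (MvPolynomial.X j)
      simpa [ev] using this
  choose D h1 h2 using key
  exact ⟨D, h1, h2⟩

variable {D : Fin m → C →ₐ[R] C⟦X⟧}

theorem IsCoordHS.comm_succ (hD : IsCoordHS z D) (i j : Fin m) (r : ℕ) :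
    comm R C (z j) (hsCoeff (D i) (r + 1)) = if i = j then -hsCoeff (D i) r else 0 := by
  rw [comm_hsCoeff (hD.constantCoeff i)]
  have h : ∀ a, hsCoeff (D i) (a + 1) (z j) = if a = 0 ∧ i = j then 1 else 0 := by
    intro a
    rw [hsCoeff_apply, hD.coord, map_add, coeff_C, if_neg (Nat.succ_ne_zero a), zero_add]
    by_cases hij : i = j
    · simp [hij, coeff_X]
    · simp [hij]
  cases r with
  | zero => 
    simp only [Finset.Nat.antidiagonal_zero, Finset.sum_singleton, h]
    split_ifs with h1 h2 h2
    · rw [map_one, one_mul]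
    · exact absurd h1.2 h2
    · exact absurd ⟨trivial, h2⟩ h1
    · simp
  | succ r =>
    rw [Finset.Nat.antidiagonal_succ]
    simp only [Finset.sum_cons, Finset.sum_map, Function.Embedding.prodMap, h]
    by_cases hij : i = j <;> simp [hij, -Algebra.coe_lmul_eq_mul]

theorem IsCoordHS.comm_of_ne (hD : IsCoordHS z D) {i j : Fin m} (hij : i ≠ j) (r : ℕ) :
    comm R C (z j) (hsCoeff (D i) r) = 0 := by
  cases r with
  | zero =>
    rw [hsCoeff_zero (hD.constantCoeff i), ← map_one (Algebra.lmul R C)]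
    exact comm_lmul (z j) 1
  | succ r => rw [hD.comm_succ, if_neg hij]

/-- By induction on r + s the commutator of the two operators commutes with all coordinates. Being a
differential operator, it is then multiplication by its value at 1, and that value is 0. -/
theorem IsCoordHS.commute (hD : IsCoordHS z D)
    (hz : (MvPolynomial.aeval z : MvPolynomial (Fin m) R →ₐ[R] C).toRingHom.FormallyUnramified)
    (i j : Fin m) (r s : ℕ) : Commute (hsCoeff (D i) r) (hsCoeff (D j) s) := by
  induction hN : r + s using Nat.strong_induction_on generalizing r s with
  | _ N ih =>
    cases r with
    | zero => rw [hsCoeff_zero (hD.constantCoeff i)]; exact Commute.one_left _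
    | succ r =>
      cases s with
      | zero => rw [hsCoeff_zero (hD.constantCoeff j)]; exact Commute.one_right _
      | succ s =>
        rw [Commute, SemiconjBy, ← sub_eq_zero]
        have h1 := isDiffOp_hsCoeff (hD.constantCoeff i) (r + 1)
        have h2 := isDiffOp_hsCoeff (hD.constantCoeff j) (s + 1)
        have h3 := (h1.mul h2).sub (((h2.mul h1)).mono (by omega))
        have hc := h3.comm_eq_zero_of_coord hz (fun l => by
          have e1 := (ih (r + (s + 1)) (by omega) r (s + 1) rfl).eq
          have e2 := (ih (r + 1 + s) (by omega) (r + 1) s rfl).eq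
          rw [comm_sub, comm_mul, comm_mul, hD.comm_succ, hD.comm_succ]
          have e1' : ∀ x, _ = _ := LinearMap.congr_fun e1
          have e2' : ∀ x, _ = _ := LinearMap.congr_fun e2
          simp only [Module.End.mul_apply] at e1' e2'
          ext x
          split_ifs <;> simp [e1', e2', add_comm])
        ext x
        have := (comm_eq_zero_iff _ _).mp (hc x) 1
        rw [mul_one] at this
        rw [this]
        simp [hsCoeff_succ_one]

end HasseSchmidt
end WittDiff
end

noncomputable section
namespace WittDiff

/-! ### Taylor expansion, and generation of the ring of differential operators -/

section HasseSchmidt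

open PowerSeries

variable {R C : Type*} [CommRing R] [CommRing C] [Algebra R C] {m : ℕ} {z : Fin m → C}
  {D : Fin m → C →ₐ[R] C⟦X⟧}

/-- The composition of the operators `D_{i, s_i}`. -/
def hsMulti (hD : IsCoordHS z D)
    (hz : (MvPolynomial.aeval z : MvPolynomial (Fin m) R →ₐ[R] C).toRingHom.FormallyUnramified)
    (s : Fin m → ℕ) : Module.End R C :=
  Finset.univ.noncommProd (fun i => hsCoeff (D i) (s i)) fun i _ j _ _ => hD.commute hz i j _ _

variable (hD : IsCoordHS z D)
  (hz : (MvPolynomial.aeval z : MvPolynomial (Fin m) R →ₐ[R] C).toRingHom.FormallyUnramified)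

/-- The composition of the operators `D_{i, s_i}` for `i ≠ l`. -/
def hsMultiErase (l : Fin m) (s : Fin m → ℕ) : Module.End R C :=
  (Finset.univ.erase l).noncommProd (fun i => hsCoeff (D i) (s i))
    fun i _ j _ _ => hD.commute hz i j _ _

theorem hsMulti_eq_mul_erase (l : Fin m) (s : Fin m → ℕ) :
    hsMulti hD hz s = hsCoeff (D l) (s l) * hsMultiErase hD hz l s :=
  (Finset.mul_noncommProd_erase _ (Finset.mem_univ l) _ _ _).symm

theorem hsMulti_eq_erase_mul (l : Fin m) (s : Fin m → ℕ) :
    hsMulti hD hz s = hsMultiErase hD hz l s * hsCoeff (D l) (s l) :=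
  (Finset.noncommProd_erase_mul _ (Finset.mem_univ l) _ _ _).symm

theorem hsMultiErase_congr (l : Fin m) {s t : Fin m → ℕ} (h : ∀ i ≠ l, s i = t i) :
    hsMultiErase hD hz l s = hsMultiErase hD hz l t :=
  Finset.noncommProd_congr rfl (fun i hi => by rw [h i (Finset.ne_of_mem_erase hi)]) _

theorem comm_hsMultiErase (l : Fin m) (s : Fin m → ℕ) :
    comm R C (z l) (hsMultiErase hD hz l s) = 0 := by
  refine Finset.noncommProd_induction _ _ _ (fun θ => comm R C (z l) θ = 0) ?_ ?_ ?_
  · intro a b ha hb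
    rw [comm_mul, ha, hb]; simp
  · rw [← map_one (Algebra.lmul R C)]; exact comm_lmul _ _
  · intro i hi
    exact hD.comm_of_ne (Finset.ne_of_mem_erase hi) _

theorem hsMulti_mem {S : Subalgebra R (Module.End R C)} (hS : ∀ i r, hsCoeff (D i) r ∈ S)
    (s : Fin m → ℕ) : hsMulti hD hz s ∈ S :=
  Finset.noncommProd_induction _ _ _ (· ∈ S) (fun _ _ => mul_mem) (one_mem S) fun i _ => hS i _

theorem hsMultiErase_mem {S : Submonoid (Module.End R C)} (hS : ∀ i r, hsCoeff (D i) r ∈ S)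
    (l : Fin m) (s : Fin m → ℕ) : hsMultiErase hD hz l s ∈ S :=
  Finset.noncommProd_induction _ _ _ (· ∈ S) (fun _ _ => mul_mem) (one_mem S) fun i _ => hS i _

theorem hsMulti_zero : hsMulti hD hz 0 = 1 := by
  refine Finset.noncommProd_induction _ _ _ (fun θ => θ = 1) ?_ rfl ?_
  · rintro _ _ rfl rfl; rfl
  · intro i _; exact hsCoeff_zero (hD.constantCoeff i)

theorem hsMulti_one (s : Fin m → ℕ) : hsMulti hD hz s 1 = if s = 0 then 1 else 0 := by
  split_ifs with h
  · rw [h, hsMulti_zero]; rfl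
  · obtain ⟨i, hi⟩ := Function.ne_iff.mp h
    obtain ⟨r, hr⟩ := Nat.exists_eq_succ_of_ne_zero hi
    rw [hsMulti_eq_erase_mul hD hz i, Module.End.mul_apply, hr, hsCoeff_succ_one, map_zero]

theorem comm_hsMulti (l : Fin m) (s : Fin m → ℕ) :
    comm R C (z l) (hsMulti hD hz s) =
      if s l = 0 then 0 else -hsMulti hD hz (Function.update s l (s l - 1)) := by
  rw [hsMulti_eq_mul_erase hD hz l s, comm_mul, comm_hsMultiErase, mul_zero, add_zero]
  split_ifs with h
  · rw [h, hsCoeff_zero (hD.constantCoeff l), ← map_one (Algebra.lmul R C), comm_lmul, zero_mul]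
  · obtain ⟨r, hr⟩ := Nat.exists_eq_succ_of_ne_zero h
    rw [hsMulti_eq_mul_erase hD hz l, hr, hD.comm_succ, if_pos rfl, Function.update_self,
      hsMultiErase_congr hD hz l (s := Function.update s l (r.succ - 1)) (t := s)
        fun i hi => Function.update_of_ne hi _ _]
    ext x; simp

theorem X_pow_dvd_prod_pow {h : Fin m → C⟦X⟧} (hh : ∀ i, PowerSeries.X ∣ h i) (s : Fin m → ℕ)
    (l : Fin m) : PowerSeries.X ^ s l ∣ ∏ i, h i ^ s i :=
  (pow_dvd_pow_of_dvd (hh l) _).trans (Finset.dvd_prod_of_mem _ (Finset.mem_univ l))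

/-- The Taylor expansion of a Hasse-Schmidt derivation with respect to étale coordinates. -/
theorem hsCoeff_eq_sum_hsMulti {D' : C →ₐ[R] C⟦X⟧} (hD' : ∀ c, constantCoeff (D' c) = c) (N r : ℕ)
    (hr : r ≤ N) : hsCoeff D' r = ∑ s ∈ Fintype.piFinset fun _ : Fin m => Finset.range (N + 1),
      Algebra.lmul R C (coeff r (∏ i, (D' (z i) - PowerSeries.C (z i)) ^ s i)) *
        hsMulti hD hz s := by
  set h : Fin m → C⟦X⟧ := fun i => D' (z i) - PowerSeries.C (z i) with hh
  have hX : ∀ i, PowerSeries.X ∣ h i := fun i => by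
    rw [X_dvd_iff, hh, map_sub, hD']; simp
  have hcoeff : ∀ i a, coeff (a + 1) (h i) = hsCoeff D' (a + 1) (z i) := fun i a => by
    simp [hh, hsCoeff_apply]
  -- The box depends on N rather than on r, so that the induction on r uses one index set for all
  -- smaller indices.
  set box := Fintype.piFinset fun _ : Fin m => Finset.range (N + 1) with hbox
  induction r using Nat.strong_induction_on with
  | _ r ih =>
  have hmem : hsCoeff D' r - ∑ s ∈ box, Algebra.lmul R C (coeff r (∏ i, h i ^ s i)) *
        hsMulti hD hz s ∈ diffOps R C := by
    refine sub_mem ⟨_, isDiffOp_hsCoeff hD' r⟩ (sum_mem fun s _ => mul_mem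
      ⟨_, isDiffOp_lmul _⟩ ?_)
    exact hsMulti_mem hD hz (S := diffOps R C) (fun i r => ⟨_, isDiffOp_hsCoeff (hD.constantCoeff i) r⟩) s
  obtain ⟨N', hN'⟩ := hmem
  -- By the Leibniz rule and the induction hypothesis, bracketing D'_r with z_l inserts one more
  -- factor h_l into each coefficient, up to sign.
  have hcomm : ∀ l, comm R C (z l) (hsCoeff D' r) = -∑ s ∈ box,
      Algebra.lmul R C (coeff r (h l * ∏ i, h i ^ s i)) * hsMulti hD hz s := by
    intro l
    cases r with
    | zero =>
      rw [hsCoeff_zero hD', ← map_one (Algebra.lmul R C), comm_lmul, eq_comm, neg_eq_zero]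
      refine Finset.sum_eq_zero fun s _ => ?_
      rw [coeff_zero_eq_constantCoeff_apply, map_mul, X_dvd_iff.mp (hX l)]
      simp
    | succ r =>
      rw [comm_hsCoeff hD']
      congr 1
      have h1 : ∀ s : Fin m → ℕ, coeff (r + 1) (h l * ∏ i, h i ^ s i) =
          ∑ x ∈ Finset.HasAntidiagonal.antidiagonal r,
            hsCoeff D' (x.1 + 1) (z l) * coeff x.2 (∏ i, h i ^ s i) := by
        intro s
        rw [coeff_mul, Finset.Nat.antidiagonal_succ]
        simp [X_dvd_iff.mp (hX l), hcoeff]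
      simp only [h1, map_sum, Finset.sum_mul]
      rw [Finset.sum_comm]
      refine Finset.sum_congr rfl fun x hx => ?_
      have hx := Finset.HasAntidiagonal.mem_antidiagonal.mp hx
      rw [ih x.2 (by omega) (by omega), Finset.mul_sum]
      refine Finset.sum_congr rfl fun s _ => ?_
      rw [map_mul, mul_assoc]
  have hz0 := hN'.comm_eq_zero_of_coord hz (fun l => by
    rw [comm_sub, hcomm, comm_sum, sub_eq_zero, ← Finset.sum_neg_distrib]
    have h2 : ∀ s, comm R C (z l) (Algebra.lmul R C (coeff r (∏ i, h i ^ s i)) *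
        hsMulti hD hz s) = if s l = 0 then 0 else
          -(Algebra.lmul R C (coeff r (h l * ∏ i, h i ^ (Function.update s l (s l - 1)) i)) *
            hsMulti hD hz (Function.update s l (s l - 1))) := by
      intro s
      rw [comm_lmul_mul, comm_hsMulti]
      split_ifs with hs
      · rw [mul_zero]
      · have : h l * ∏ i, h i ^ (Function.update s l (s l - 1)) i = ∏ i, h i ^ s i := by
          rw [← Finset.mul_prod_erase _ _ (Finset.mem_univ l),
            ← Finset.mul_prod_erase Finset.univ (fun i => h i ^ s i) (Finset.mem_univ l),
            ← mul_assoc, Function.update_self, ← pow_succ', Nat.sub_add_cancel (by omega)]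
          congr 1
          refine Finset.prod_congr rfl fun i hi => ?_
          rw [Function.update_of_ne (Finset.ne_of_mem_erase hi)]
        rw [this]
        ext x; simp
    simp only [h2]
    -- Bracketing the expansion with z_l lowers s_l by one, so the two sums match under the shift of
    -- s in direction l. The unmatched face s_l = N contributes nothing, because there h_l ∏
    -- h_i^(s_i) is divisible by X^(N+1) and r ≤ N.
    rw [← Finset.sum_filter_of_ne (p := fun s : Fin m → ℕ => s l ≠ N), eq_comm,
      ← Finset.sum_filter_of_ne (p := fun s : Fin m → ℕ => s l ≠ 0)]
    · refine Finset.sum_nbij' (fun s => Function.update s l (s l - 1))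
        (fun s => Function.update s l (s l + 1)) ?_ ?_ ?_ ?_ ?_
      · intro s hs
        simp only [hbox, Finset.mem_filter, Fintype.mem_piFinset, Finset.mem_range] at hs ⊢
        refine ⟨fun i => ?_, ?_⟩
        · by_cases hi : i = l
          · subst hi; have := hs.1 i; simp; omega
          · rw [Function.update_of_ne hi]; exact hs.1 i
        · have := hs.1 l; have := hs.2; simp; omega
      · intro s hs
        simp only [hbox, Finset.mem_filter, Fintype.mem_piFinset, Finset.mem_range] at hs ⊢
        refine ⟨fun i => ?_, ?_⟩
        · by_cases hi : i = l
          · subst hi; have := hs.1 i; have := hs.2; simp; omega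
          · rw [Function.update_of_ne hi]; exact hs.1 i
        · simp
      · intro s hs
        have := (Finset.mem_filter.mp hs).2
        simp [Nat.sub_add_cancel (Nat.pos_of_ne_zero this)]
      · intro s hs; simp
      · intro s hs
        rw [if_neg (Finset.mem_filter.mp hs).2]
    · intro s _ h0 h1
      exact h0 (if_pos h1)
    · intro s _ h0 h1
      apply h0
      have : coeff r (h l * ∏ i, h i ^ s i) = 0 := by
        have hdvd : PowerSeries.X ^ (N + 1) ∣ h l * ∏ i, h i ^ s i := by
          rw [pow_succ']
          exact mul_dvd_mul (hX l) (h1 ▸ X_pow_dvd_prod_pow hX s l)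
        exact X_pow_dvd_iff.mp hdvd r (by omega)
      rw [this, map_zero, zero_mul, neg_zero])
  -- The difference of the two sides commutes with all multiplications, so it is multiplication by
  -- its value at 1. There only the term s = 0 of the sum survives, and it cancels D'_r(1).
  rw [← sub_eq_zero]
  ext x
  have := (comm_eq_zero_iff _ _).mp (hz0 x) 1
  rw [mul_one] at this
  rw [this, LinearMap.zero_apply]
  convert mul_zero x
  rw [LinearMap.sub_apply, hsCoeff_apply, map_one, LinearMap.sum_apply]
  simp only [Module.End.mul_apply, hsMulti_one]
  rw [Finset.sum_eq_single (0 : Fin m → ℕ)]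
  · have : ∀ a b : C, Algebra.lmul R C a b = a * b := fun _ _ => rfl
    rw [if_pos rfl, this, mul_one]
    simp
  · intro s _ hs; simp [hs]
  · intro hs; exact absurd (by simp [hbox]) hs

/-- The algebra of differential operators is generated by the multiplication operators and the
coefficients of the Hasse-Schmidt derivations attached to étale coordinates. -/
theorem IsDiffOp.mem_of_hsCoeff_mem (hD : IsCoordHS z D)
    (hz : (MvPolynomial.aeval z : MvPolynomial (Fin m) R →ₐ[R] C).toRingHom.FormallyUnramified)
    {S : Subalgebra R (Module.End R C)}
    (hl : ∀ c, Algebra.lmul R C c ∈ S) (hS : ∀ i r, hsCoeff (D i) r ∈ S) {N : ℕ}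
    {θ : Module.End R C} (hθ : IsDiffOp R C N θ) : θ ∈ S := by
  have lin : ∀ θ : Module.End R C, (∀ c, comm R C c θ = 0) → θ ∈ S := by
    intro θ h
    convert hl (θ 1)
    ext x
    have := (comm_eq_zero_iff _ _).mp (h x) 1
    rw [mul_one] at this
    rw [this]; simp [mul_comm]
  induction N generalizing θ with
  | zero => exact lin θ hθ
  | succ N ih =>
    -- An inner induction on j, in which θ is allowed not to commute only with the coordinates of
    -- index less than j.
    suffices Q : ∀ j ≤ m, ∀ θ : Module.End R C, IsDiffOp R C (N + 1) θ →
        (∀ i : Fin m, j ≤ i → comm R C (z i) θ = 0) → θ ∈ S from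
      Q m le_rfl θ hθ fun i hi => absurd i.2 (not_lt.mpr hi)
    intro j
    induction j with
    | zero => intro _ θ h1 h2; exact lin θ (h1.comm_eq_zero_of_coord hz fun i => h2 i (Nat.zero_le _))
    | succ j ihj =>
      intro hj θ h1 h2
      let l : Fin m := ⟨j, hj⟩
      let ad := comm R C (z l)
      have hord : ∀ a M (η : Module.End R C), IsDiffOp R C (M + a) η → IsDiffOp R C M (ad^[a] η) := by
        intro a
        induction a with
        | zero => intro M η h; exact h
        | succ a iha =>
          intro M η h
          rw [Function.iterate_succ_apply]
          exact iha M _ (h (z l))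
      have htop : ad^[N + 2] θ = 0 := by
        rw [Function.iterate_succ_apply']
        exact hord (N + 1) 0 θ (by simpa using h1) (z l)
      have hcomm : ∀ i : Fin m, j + 1 ≤ i → ∀ a, comm R C (z i) (ad^[a] θ) = 0 := by
        intro i hi a
        induction a with
        | zero => exact h2 i hi
        | succ a iha =>
          rw [Function.iterate_succ_apply', comm_comm, iha, comm_zero]
      -- The bracket of z_l with ad^a(θ) D_{l,a} is ad^(a+1)(θ) D_{l,a} - ad^a(θ) D_{l,a-1}. The sum
      -- telescopes, so θ₀ commutes with z_l, while θ₀ - θ involves only the brackets ad^(a+1)(θ),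
      -- which have lower order.
      let θ₀ := ∑ a ∈ Finset.range (N + 2), ad^[a] θ * hsCoeff (D l) a
      have h₀ : θ₀ ∈ S := by
        refine ihj (by omega) θ₀ (IsDiffOp.sum _ fun a ha => ?_) fun i hi => ?_
        · have ha := Finset.mem_range.mp ha
          have := (hord a (N + 1 - a) θ (by rwa [Nat.sub_add_cancel (by omega)])).mul
            (isDiffOp_hsCoeff (hD.constantCoeff l) a)
          rwa [Nat.sub_add_cancel (by omega)] at this
        · rcases Nat.eq_or_lt_of_le hi with hi | hi
          · obtain rfl : i = l := Fin.ext hi.symm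
            have hstep : ∀ a, comm R C (z l) (ad^[a] θ * hsCoeff (D l) a) =
                ad^[a + 1] θ * hsCoeff (D l) a -
                  (if a = 0 then 0 else ad^[a] θ * hsCoeff (D l) (a - 1)) := by
              intro a
              rw [comm_mul, Function.iterate_succ_apply']
              cases a with
              | zero =>
                rw [hsCoeff_zero (hD.constantCoeff l), ← map_one (Algebra.lmul R C), comm_lmul]
                simp [ad]
              | succ a =>
                rw [hD.comm_succ, if_pos rfl, if_neg (Nat.succ_ne_zero a)]
                ext x
                simp [ad, sub_eq_add_neg]
            rw [comm_sum]
            simp only [hstep]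
            rw [Finset.sum_sub_distrib, Finset.sum_range_succ' (fun a => if a = 0 then _ else _),
              Finset.sum_range_succ, htop]
            simp
          · rw [comm_sum]
            refine Finset.sum_eq_zero fun a _ => ?_
            rw [comm_mul, hcomm i hi, hD.comm_of_ne, zero_mul, mul_zero, add_zero]
            intro h
            rw [← h] at hi
            exact absurd hi (lt_irrefl _)
      have hθ₀ : θ = θ₀ - ∑ a ∈ Finset.range (N + 1), ad^[a] (ad θ) * hsCoeff (D l) (a + 1) := by
        rw [eq_sub_iff_add_eq]
        simp only [θ₀]
        rw [Finset.sum_range_succ' _ (N + 1), hsCoeff_zero (hD.constantCoeff l), add_comm θ, mul_one]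
        rfl
      rw [hθ₀]
      refine sub_mem h₀ (sum_mem fun a ha => mul_mem (ih ?_) (hS _ _))
      have ha := Finset.mem_range.mp ha
      refine (hord a (N - a) (ad θ) ?_).mono (Nat.sub_le N a)
      rw [Nat.sub_add_cancel (by omega)]
      exact h1 (z l)

end HasseSchmidt
end WittDiff
end

noncomputable section
namespace WittDiff

/-! ### Ghost components of Witt vectors over power series rings -/

section Ghost

variable {p : ℕ} [Fact p.Prime] {C : Type*} [CommRing C]

theorem ghostComponent_add_iterate_verschiebung (v j : ℕ) (y : WittVector p C) :
    WittVector.ghostComponent (v + j) ((WittVector.verschiebung)^[j] y) =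
      (p : C) ^ j * WittVector.ghostComponent v y := by
  induction j generalizing v with
  | zero => simp
  | succ j ih =>
    rw [Function.iterate_succ_apply', ← add_assoc, WittVector.ghostComponent_verschiebung, ih,
      pow_succ', mul_assoc]

theorem ghostComponent_iterate_verschiebung {v j : ℕ} (h : j ≤ v) (y : WittVector p C) :
    WittVector.ghostComponent v ((WittVector.verschiebung)^[j] y) =
      (p : C) ^ j * WittVector.ghostComponent (v - j) y := by
  rw [← ghostComponent_add_iterate_verschiebung, Nat.sub_add_cancel h]

theorem ghostComponent_iterate_verschiebung_of_lt {v j : ℕ} (h : v < j) (y : WittVector p C) :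
    WittVector.ghostComponent v ((WittVector.verschiebung)^[j] y) = 0 := by
  obtain ⟨i, rfl⟩ : ∃ i, j = v + (i + 1) := ⟨j - v - 1, by omega⟩
  rw [Function.iterate_add_apply, ghostComponent_iterate_verschiebung le_rfl, Nat.sub_self,
    Function.iterate_succ_apply', WittVector.ghostComponent_zero_verschiebung, mul_zero]

theorem ghostComponent_iterate_frobenius (v j : ℕ) (y : WittVector p C) :
    WittVector.ghostComponent v ((WittVector.frobenius)^[j] y) =
      WittVector.ghostComponent (v + j) y := by
  induction j generalizing v with
  | zero => simp
  | succ j ih =>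
    rw [Function.iterate_succ_apply', WittVector.ghostComponent_frobenius, ih,
      add_right_comm, add_assoc]

theorem ghostComponent_map {E : Type*} [CommRing E] (g : C →+* E) (v : ℕ) (y : WittVector p C) :
    WittVector.ghostComponent v (WittVector.map g y) = g (WittVector.ghostComponent v y) := by
  simp [WittVector.ghostComponent_apply, wittPolynomial_eq_sum_C_mul_X_pow]

theorem ghostComponent_eq_sum (v : ℕ) (y : WittVector p C) :
    WittVector.ghostComponent v y =
      ∑ i ∈ Finset.range (v + 1), (p : C) ^ i * y.coeff i ^ p ^ (v - i) := by
  simp [WittVector.ghostComponent_apply, wittPolynomial_eq_sum_C_mul_X_pow]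

/-- Multiplying by a ghost component is realised by `y ↦ V^(v-w) (F^(w-v) a * y)`. -/
theorem ghostComponent_bullet (v w : ℕ) (a y : WittVector p C) :
    WittVector.ghostComponent v ((WittVector.verschiebung)^[v - w]
      ((WittVector.frobenius)^[w - v] a * y)) = WittVector.ghostComponent w a *
        WittVector.ghostComponent v ((WittVector.verschiebung)^[v - w] y) := by
  rw [ghostComponent_iterate_verschiebung (Nat.sub_le _ _),
    ghostComponent_iterate_verschiebung (Nat.sub_le _ _), map_mul,
    ghostComponent_iterate_frobenius, show v - (v - w) + (w - v) = w by omega]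
  ring

variable (p C) in
/-- The additive generators `p^(v-u) b^(p^u)`, `p^u ∣ r`, of the group containing the `r`-th
coefficients of the `v`-th ghost components of Witt vectors of power series. -/
def ghostCoeffSet (v r : ℕ) : Set C :=
  {x | ∃ u ≤ v, p ^ u ∣ r ∧ ∃ b, x = (p : C) ^ (v - u) * b ^ p ^ u}

/-- By additivity it suffices to treat V^j [b X^q], as multiples of X^(r+1) do not affect the r-th
coefficient. The v-th ghost component is p^j b^(p^(v-j)) X^(q p^(v-j)), which meets degree r only if
p^(v-j) divides r; take u = v - j. -/
theorem coeff_ghostComponent_mem (v r : ℕ) (y : WittVector p (PowerSeries C)) :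
    PowerSeries.coeff r (WittVector.ghostComponent v y) ∈
      AddSubgroup.closure (ghostCoeffSet p C v r) := by
  set H : AddSubgroup (WittVector p (PowerSeries C)) :=
    (AddSubgroup.closure (ghostCoeffSet p C v r)).comap
      ((PowerSeries.coeff (R := C) r).toAddMonoidHom.comp
        (WittVector.ghostComponent v).toAddMonoidHom) with hH
  have hmem : ∀ y, y ∈ H ↔ PowerSeries.coeff r (WittVector.ghostComponent v y) ∈
      AddSubgroup.closure (ghostCoeffSet p C v r) := fun _ => Iff.rfl
  rw [← hmem]
  suffices H = ⊤ by rw [this]; exact AddSubgroup.mem_top y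
  refine addSubgroup_eq_top_of_verschiebung_teichmuller
    (G := {g | (∃ q b, g = PowerSeries.monomial q b) ∨ PowerSeries.X ^ (r + 1) ∣ g}) ?_ (v + 1)
    H ?_ ?_
  · rw [eq_top_iff]
    intro g _
    rw [← sub_add_cancel g (∑ q ∈ Finset.range (r + 1),
      PowerSeries.monomial q (PowerSeries.coeff q g))]
    refine add_mem (AddSubgroup.subset_closure (Or.inr ?_)) (sum_mem fun q _ =>
      AddSubgroup.subset_closure (Or.inl ⟨q, _, rfl⟩))
    rw [PowerSeries.X_pow_dvd_iff]
    intro q hq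
    simp [PowerSeries.coeff_monomial, Finset.mem_range.mpr hq]
  · intro y
    rw [hmem, ghostComponent_iterate_verschiebung_of_lt (Nat.lt_succ_self v), map_zero]
    exact zero_mem _
  · intro j hj g hg
    rw [hmem, ghostComponent_iterate_verschiebung (by omega),
      WittVector.ghostComponent_teichmuller, ← Nat.cast_pow, ← nsmul_eq_mul, map_nsmul]
    rcases hg with ⟨q, b, rfl⟩ | hg
    · rw [PowerSeries.monomial_pow, PowerSeries.coeff_monomial]
      split_ifs with h
      · refine AddSubgroup.subset_closure ⟨v - j, by omega, ⟨q, by rw [h]⟩, b, ?_⟩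
        rw [show v - (v - j) = j by omega, nsmul_eq_mul, Nat.cast_pow]
      · rw [smul_zero]; exact zero_mem _
    · have : PowerSeries.X ^ (r + 1) ∣ g ^ p ^ (v - j) :=
        hg.trans (dvd_pow_self _ (pow_ne_zero _ (Fact.out : p.Prime).ne_zero))
      rw [PowerSeries.X_pow_dvd_iff.mp this r (Nat.lt_succ_self r), smul_zero]
      exact zero_mem _

/-- Elements of the group `closure (ghostCoeffSet p C v r)` are ghost components of elements
divisible by `V^(v - v_p(r))`. -/
theorem exists_ghostComponent_verschiebung {v r : ℕ} (hr : r ≠ 0) {x : C}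
    (hx : x ∈ AddSubgroup.closure (ghostCoeffSet p C v r)) :
    ∃ y : WittVector p C, x = WittVector.ghostComponent v ((WittVector.verschiebung)^[v - padicValNat p r] y) := by
  induction hx using AddSubgroup.closure_induction with
  | mem x hx =>
    obtain ⟨u, hu, hur, b, rfl⟩ := hx
    have := (padicValNat_dvd_iff_le (p := p) hr).mp hur
    refine ⟨(WittVector.verschiebung)^[v - u - (v - padicValNat p r)]
      (WittVector.teichmuller p b), ?_⟩
    rw [← Function.iterate_add_apply, Nat.add_sub_cancel' (by omega),
      ghostComponent_iterate_verschiebung (Nat.sub_le _ _), WittVector.ghostComponent_teichmuller,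
      Nat.sub_sub_self hu]
  | zero => exact ⟨0, by rw [iterate_verschiebung_zero, map_zero]⟩
  | add x y _ _ hx hy =>
    obtain ⟨a, rfl⟩ := hx
    obtain ⟨b, rfl⟩ := hy
    exact ⟨a + b, by rw [iterate_verschiebung_add, map_add]⟩
  | neg x _ hx =>
    obtain ⟨a, rfl⟩ := hx
    refine ⟨-a, ?_⟩
    rw [neg_eq_iff_add_eq_zero, ← map_add, ← iterate_verschiebung_add, add_neg_cancel,
      iterate_verschiebung_zero, map_zero]

/-- Used for changes of coordinates: it turns a coefficient with factor of ghost index v_p(r) into a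
coefficient of ghost index v. The element x is the v-th ghost component of some V^(v-v_p(r)) y,
where such a factor can be absorbed. -/
theorem exists_ghostComponent_eq_mul {v r : ℕ} (hr : r ≠ 0) (c : WittVector p C) {x : C}
    (hx : x ∈ AddSubgroup.closure (ghostCoeffSet p C v r)) :
    ∃ c' : WittVector p C, WittVector.ghostComponent v c' = WittVector.ghostComponent (padicValNat p r) c * x := by
  obtain ⟨y, rfl⟩ := exists_ghostComponent_verschiebung hr hx
  exact ⟨_, ghostComponent_bullet _ _ c y⟩

/-- Over a ring where `p^(n+1) = 0`, the coefficients of positive degree of large `p`-powers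
vanish. -/
theorem coeff_pow_eq_zero {n r M : ℕ} (hp : (p : C) ^ (n + 1) = 0) (hr : r ≠ 0)
    (hM : padicValNat p r + n + 1 ≤ M) (g : PowerSeries C) :
    PowerSeries.coeff r (g ^ p ^ M) = 0 := by
  -- Since g^(p^M) is the M-th ghost component of [g], its r-th coefficient is divisible by
  -- p^(M-v_p(r)), hence by p^(n+1).
  have := coeff_ghostComponent_mem M r (WittVector.teichmuller p g)
  rw [WittVector.ghostComponent_teichmuller] at this
  obtain ⟨y, hy⟩ := exists_ghostComponent_verschiebung hr this
  rw [hy, ghostComponent_iterate_verschiebung (Nat.sub_le _ _),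
    pow_eq_zero_of_le (show n + 1 ≤ M - padicValNat p r by omega) hp, zero_mul]

end Ghost
end WittDiff
end

noncomputable section
namespace WittDiff

/-! ### Flat lifts and the embedding of W_{n+1}(B) by the ghost component -/

section FlatLift

variable {p n : ℕ} [Fact p.Prime]

/-- The reduction `W_{n+1}(B) → B`. -/
def wittConst {B : Type*} [CommRing B] : W p n B →+* B :=
  RingHom.liftOfSurjective (WittVector.truncate (n + 1))
    (WittVector.truncate_surjective p (n + 1) B) ⟨WittVector.constantCoeff, fun x hx => by
      rw [RingHom.mem_ker] at hx ⊢
      have := congrArg (TruncatedWittVector.coeff 0) hx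
      simpa [WittVector.coeff_truncate] using this⟩

theorem wittConst_apply {B : Type*} [CommRing B] (x : W p n B) : wittConst x = x.coeff 0 := by
  obtain ⟨x, rfl⟩ := WittVector.truncate_surjective p (n + 1) B x
  rw [wittConst, RingHom.liftOfSurjective_comp_apply, WittVector.coeff_truncate]
  rfl

variable (p n) in
/-- `π : C → B` exhibits the `W_{n+1}(k)`-algebra `C` as a lift of the `k`-algebra `B`, with the
torsion properties of a flat lift. -/
structure IsFlatLift (k : Type*) {B C : Type*} [CommRing k] [CommRing B] [CommRing C] [Algebra k B]
    [Algebra (W p n k) C] (π : C →+* B) : Prop where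
  surjective : Function.Surjective π
  dvd : ∀ x, π x = 0 → (p : C) ∣ x
  char : (p : B) = 0
  pow : (p : C) ^ (n + 1) = 0
  torsion : ∀ x, (p : C) * x = 0 → (p : C) ^ n ∣ x
  map_algebraMap : ∀ w : W p n k, π (algebraMap (W p n k) C w) = algebraMap k B (w.coeff 0)

variable {k B C : Type*} [CommRing k] [CommRing B] [CommRing C] [Algebra k B]
  [Algebra (W p n k) C] {π : C →+* B}

variable (p n) in
/-- Reduction of Witt vectors along `π : C → B`, followed by truncation. -/
def toW (π : C →+* B) : WittVector p C →+* W p n B :=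
  (WittVector.truncate (n + 1)).comp (WittVector.map π)

theorem toW_surjective (hπ : Function.Surjective π) : Function.Surjective (toW p n π) :=
  (WittVector.truncate_surjective p (n + 1) B).comp (WittVector.map_surjective π hπ)

theorem coeff_toW (π : C →+* B) (y : WittVector p C) (i : Fin (n + 1)) :
    (toW p n π y).coeff i = π (y.coeff i) := by
  simp [toW, WittVector.coeff_truncate, WittVector.map_coeff]

theorem toW_iterate_verschiebung (π : C →+* B) (j : ℕ) (y : WittVector p C) :
    toW p n π ((WittVector.verschiebung)^[j] y) = versch^[j] (toW p n π y) := by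
  have : ∀ y : WittVector p C, WittVector.map π ((WittVector.verschiebung)^[j] y) =
      (WittVector.verschiebung)^[j] (WittVector.map π y) := by
    induction j with
    | zero => intro y; rfl
    | succ j ih =>
      intro y
      rw [Function.iterate_succ_apply, Function.iterate_succ_apply, ih,
        WittVector.map_verschiebung]
  simp [toW, iterate_versch_truncate, this]

theorem toW_iterate_frobenius (hp : (p : B) = 0) (j : ℕ) (y : WittVector p C) :
    toW p n π ((WittVector.frobenius)^[j] y) = frob^[j] (toW p n π y) := by
  have : ∀ y : WittVector p C, WittVector.map π ((WittVector.frobenius)^[j] y) =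
      (WittVector.frobenius)^[j] (WittVector.map π y) := by
    induction j with
    | zero => intro y; rfl
    | succ j ih =>
      intro y
      rw [Function.iterate_succ_apply, Function.iterate_succ_apply, ih, map_frobenius]
  simp [toW, iterate_frob_truncate hp, this]

namespace IsFlatLift

variable (h : IsFlatLift p n k π)

/-- If the components of index at most n are divisible by p, each summand p^i y_i^(p^(n-i)) of the
ghost component is divisible by p^(n+1) = 0. -/
theorem ker_toW_le (h : IsFlatLift p n k π) : RingHom.ker (toW p n π) ≤
    RingHom.ker (WittVector.ghostComponent (p := p) (R := C) n) := by
  intro y hy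
  rw [RingHom.mem_ker] at hy ⊢
  have := WittVector.pow_dvd_ghostComponent_of_dvd_coeff (x := y) (n := n) (fun i hi =>
    h.dvd _ (by rw [← coeff_toW (n := n) π y ⟨i, by omega⟩, hy, TruncatedWittVector.coeff_zero]))
  rwa [h.pow, zero_dvd_iff] at this

/-- The ring homomorphism `W_{n+1}(B) → C` induced by the `n`-th ghost component. -/
def ghostHom : W p n B →+* C :=
  RingHom.liftOfSurjective (toW p n π) (toW_surjective h.surjective)
    ⟨WittVector.ghostComponent n, h.ker_toW_le⟩

theorem ghostHom_toW (y : WittVector p C) :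
    h.ghostHom (toW p n π y) = WittVector.ghostComponent n y :=
  RingHom.liftOfSurjective_comp_apply _ _ _ _

theorem pow_dvd_of_mul (h : IsFlatLift p n k π) {m : ℕ} (hm : m ≤ n) {x : C} (hx : (p : C) ^ (m + 1) ∣ (p : C) * x) :
    (p : C) ^ m ∣ x := by
  obtain ⟨e, he⟩ := hx
  have := h.torsion (x - p ^ m * e) (by rw [mul_sub, he]; ring)
  rw [← sub_add_cancel x (p ^ m * e)]
  exact dvd_add ((pow_dvd_pow _ hm).trans this) (dvd_mul_right _ _)

/-- Modulo p the m-th ghost component is y₀^(p^m), so reducedness of B gives p ∣ y₀. Then y₀^(p^m)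
is divisible by p^(m+1), as p^m ≥ m + 1. What remains is p times the ghost component of index m - 1
of the shifted vector; the torsion condition cancels this p, and induction applies. -/
theorem map_coeff_eq_zero (h : IsFlatLift p n k π) [IsReduced B] {m : ℕ} (hm : m ≤ n) {y : WittVector p C}
    (hy : (p : C) ^ (m + 1) ∣ WittVector.ghostComponent m y) : ∀ i ≤ m, π (y.coeff i) = 0 := by
  induction m generalizing y with
  | zero =>
    intro i hi
    obtain rfl : i = 0 := by omega
    rw [ghostComponent_eq_sum] at hy
    obtain ⟨e, he⟩ := hy
    have := congrArg π he
    simpa [h.char] using this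
  | succ m ih =>
    have h0 : π (y.coeff 0) = 0 := by
      rw [ghostComponent_eq_sum, Finset.sum_range_succ'] at hy
      obtain ⟨e, he⟩ := hy
      have := congrArg π he
      simp only [map_add, map_sum, map_mul, map_pow, map_natCast, h.char] at this
      exact pow_eq_zero_iff (pow_ne_zero _ (Fact.out : p.Prime).ne_zero) |>.mp (by simpa using this)
    obtain ⟨z, hz⟩ := exists_sub_eq_verschiebung (x := y)
      (y := WittVector.teichmuller p (y.coeff 0)) (by simp)
    have hcoeff : ∀ i, y.coeff (i + 1) = z.coeff i := by
      intro i
      rw [hz, WittVector.coeff_add_of_disjoint]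
      · rw [WittVector.teichmuller_coeff_pos _ _ _ (Nat.succ_pos i),
          WittVector.verschiebung_coeff_succ, zero_add]
      · intro m
        rcases Nat.eq_zero_or_pos m with rfl | hm
        · right; exact WittVector.verschiebung_coeff_zero z
        · left; exact WittVector.teichmuller_coeff_pos _ _ _ hm
    obtain ⟨e, he⟩ := h.dvd _ h0
    have hdvd : (p : C) ^ (m + 1 + 1) ∣ y.coeff 0 ^ p ^ (m + 1) := by
      rw [he, mul_pow]
      exact ((pow_dvd_pow _ ((Nat.lt_pow_self (Fact.out : p.Prime).one_lt).succ_le)).trans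
        (dvd_mul_right _ _))
    have hz' : (p : C) ^ (m + 1) ∣ WittVector.ghostComponent m z := by
      refine h.pow_dvd_of_mul hm ?_
      rw [hz, map_add, WittVector.ghostComponent_teichmuller,
        WittVector.ghostComponent_verschiebung] at hy
      exact (dvd_add_right hdvd).mp hy
    intro i hi
    cases i with
    | zero => exact h0
    | succ i => rw [hcoeff]; exact ih (by omega) hz' i (by omega)

theorem ghostHom_injective [IsReduced B] : Function.Injective h.ghostHom := by
  rw [injective_iff_map_eq_zero]
  intro x hx
  obtain ⟨y, rfl⟩ := toW_surjective h.surjective x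
  rw [ghostHom_toW] at hx
  ext i
  rw [coeff_toW, TruncatedWittVector.coeff_zero]
  exact h.map_coeff_eq_zero le_rfl (by rw [hx]; exact dvd_zero _) i (by omega)

/-- `ghostHom` is semilinear over the constants. -/
theorem ghostHom_algebraMap (c : W p n k) :
    ∃ c' : W p n k, h.ghostHom (algebraMap _ _ c) = algebraMap (W p n k) C c' := by
  have hs : Function.Surjective (wittConst : W p n k →+* k) := fun b =>
    ⟨teich b, by rw [wittConst_apply]; simp [teich]⟩
  obtain ⟨y, rfl⟩ := toW_surjective (p := p) (n := n) hs c
  -- The twist of scalars is the n-th ghost component computed in W_{n+1}(k), viewed as a lift of k.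
  refine ⟨WittVector.ghostComponent n y, ?_⟩
  rw [← ghostComponent_map, ← h.ghostHom_toW]
  congr 1
  ext i
  change (wittMap (algebraMap k B) _).coeff i = _
  rw [coeff_wittMap, coeff_toW, coeff_toW, WittVector.map_coeff, h.map_algebraMap, wittConst_apply]

/-- The operator `θ` on `W_{n+1}(B)` is induced by the operator `η` on `C`. -/
def Intertwines (θ : Module.End (W p n k) (W p n B)) (η : Module.End (W p n k) C) : Prop :=
  ∀ x, h.ghostHom (θ x) = η (h.ghostHom x)

variable {h}

/-- Injectivity of `ghostHom` makes the restricted map additive. Linearity survives because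
`ghostHom` carries scalars to scalars, although not to the same ones. -/
theorem exists_intertwines [IsReduced B] {η : Module.End (W p n k) C}
    (hη : ∀ x, ∃ y, η (h.ghostHom x) = h.ghostHom y) : ∃ θ, h.Intertwines θ η := by
  choose θ hθ using hη
  refine ⟨{ toFun := θ, map_add' := fun x y => ?_, map_smul' := fun c x => ?_ },
    fun x => (hθ x).symm⟩
  · apply h.ghostHom_injective
    rw [map_add, ← hθ, ← hθ, ← hθ, map_add, map_add]
  · apply h.ghostHom_injective
    obtain ⟨c', hc'⟩ := h.ghostHom_algebraMap c
    rw [RingHom.id_apply, Algebra.smul_def, Algebra.smul_def, map_mul, ← hθ, ← hθ, map_mul, hc',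
      ← Algebra.smul_def, ← Algebra.smul_def, map_smul]

namespace Intertwines

variable {θ θ' : Module.End (W p n k) (W p n B)} {η η' : Module.End (W p n k) C}

theorem unique [IsReduced B] (h₁ : h.Intertwines θ η) (h₂ : h.Intertwines θ' η) : θ = θ' :=
  LinearMap.ext fun x => h.ghostHom_injective ((h₁ x).trans (h₂ x).symm)

theorem mul (h₁ : h.Intertwines θ η) (h₂ : h.Intertwines θ' η') :
    h.Intertwines (θ * θ') (η * η') := fun x => by
  rw [Module.End.mul_apply, Module.End.mul_apply, h₁, h₂]

theorem sub (h₁ : h.Intertwines θ η) (h₂ : h.Intertwines θ' η') :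
    h.Intertwines (θ - θ') (η - η') := fun x => by
  rw [LinearMap.sub_apply, LinearMap.sub_apply, map_sub, h₁, h₂]

theorem sum {ι : Type*} (s : Finset ι) {θ : ι → Module.End (W p n k) (W p n B)}
    {η : ι → Module.End (W p n k) C} (hs : ∀ i ∈ s, h.Intertwines (θ i) (η i)) :
    h.Intertwines (∑ i ∈ s, θ i) (∑ i ∈ s, η i) := fun x => by
  rw [LinearMap.sum_apply, LinearMap.sum_apply, map_sum]
  exact Finset.sum_congr rfl fun i hi => hs i hi x

theorem one : h.Intertwines 1 1 := fun _ => rfl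

theorem lmul (b : W p n B) : h.Intertwines (Algebra.lmul _ _ b) (Algebra.lmul _ _ (h.ghostHom b)) :=
  fun x => by simp

theorem comm (h₁ : h.Intertwines θ η) (b : W p n B) :
    h.Intertwines (WittDiff.comm _ _ b θ) (WittDiff.comm _ _ (h.ghostHom b) η) :=
  ((lmul b).mul h₁).sub (h₁.mul (lmul b))

theorem isDiffOp [IsReduced B] (h₁ : h.Intertwines θ η) {N : ℕ} (hη : IsDiffOp _ _ N η) :
    IsDiffOp _ _ N θ := by
  induction N generalizing θ η with
  | zero =>
    intro b
    exact (h₁.comm b).unique (θ' := 0) (by rw [hη]; intro x; simp)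
  | succ N ih => intro b; exact ih (h₁.comm b) (hη _)

end Intertwines

end IsFlatLift

end FlatLift
end WittDiff
end

noncomputable section
namespace WittDiff

/-! ### The operators a • ∂ inside a flat lift -/

section Bullet

open PowerSeries

variable {p n : ℕ} [Fact p.Prime] {k B C : Type*} [CommRing k] [CommRing B] [CommRing C]
  [Algebra k B] [Algebra (W p n k) C] {π : C →+* B}

namespace IsFlatLift

variable (h : IsFlatLift p n k π)

/-- This explains the shape of the bullet action: in C it is honest multiplication by the ghost
component of index w of any lift of the coefficient, whether w ≤ n or w ≥ n. -/
theorem ghostHom_bullet (w : ℕ) (a : WittVector p C) (y : W p n B) :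
    h.ghostHom (versch^[n - w] (frob^[w - n] (toW p n π a) * y)) =
      WittVector.ghostComponent w a * h.ghostHom (versch^[n - w] y) := by
  obtain ⟨y, rfl⟩ := toW_surjective (p := p) (n := n) h.surjective y
  rw [← toW_iterate_frobenius h.char, ← map_mul, ← toW_iterate_verschiebung,
    ← toW_iterate_verschiebung, ghostHom_toW, ghostHom_toW, ghostComponent_bullet]

/-- Applying D to the components of a lift of x gives a Witt vector over C⟦X⟧; the r-th coefficient
of its n-th ghost component is D_r of the image of x. -/
theorem exists_versch_hsCoeff (D : C →ₐ[W p n k] C⟦X⟧) {r : ℕ} (hr : r ≠ 0) (x : W p n B) :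
    ∃ y, hsCoeff D r (h.ghostHom x) = h.ghostHom (versch^[n - padicValNat p r] y) := by
  obtain ⟨x, rfl⟩ := toW_surjective (p := p) (n := n) h.surjective x
  have := coeff_ghostComponent_mem n r (WittVector.map (D : C →+* C⟦X⟧) x)
  obtain ⟨y, hy⟩ := exists_ghostComponent_verschiebung hr this
  refine ⟨toW p n π y, ?_⟩
  rw [← toW_iterate_verschiebung, ghostHom_toW, ghostHom_toW, ← hy, ghostComponent_map]
  rfl

theorem exists_intertwines_hsCoeff [IsReduced B] {D : C →ₐ[W p n k] C⟦X⟧}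
    (hD : ∀ c, constantCoeff (D c) = c) (r : ℕ) : ∃ δ, h.Intertwines δ (hsCoeff D r) := by
  rcases eq_or_ne r 0 with rfl | hr
  · rw [hsCoeff_zero hD]; exact ⟨1, Intertwines.one⟩
  · exact exists_intertwines fun x => (h.exists_versch_hsCoeff D hr x).imp' _ fun _ => id

variable {h}

/-- Reduces all questions about bullet operators to left multiples of D_r on C, by injectivity of
`ghostHom`. -/
theorem isBullet_iff [IsReduced B] {D : C →ₐ[W p n k] C⟦X⟧} {r : ℕ} (hr : r ≠ 0)
    {δ θ : Module.End (W p n k) (W p n B)} (hδ : h.Intertwines δ (hsCoeff D r))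
    (a : WittVector p C) :
    IsBullet r (toW p n π a) δ θ ↔ h.Intertwines θ (Algebra.lmul _ _
      (WittVector.ghostComponent (padicValNat p r) a) * hsCoeff D r) := by
  rw [IsBullet, if_neg hr]
  refine forall_congr' fun x => ?_
  rw [Module.End.mul_apply, ← hδ]
  constructor
  · rintro ⟨y, hy, hθ⟩
    rw [hθ, ghostHom_bullet, hy]
    simp
  · intro hθ
    obtain ⟨y, hy⟩ := h.exists_versch_hsCoeff D hr x
    rw [← hδ] at hy
    refine ⟨y, h.ghostHom_injective hy, h.ghostHom_injective ?_⟩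
    rw [hθ, ghostHom_bullet, hy]
    simp

theorem exists_bullet [IsReduced B] {D : C →ₐ[W p n k] C⟦X⟧} {r : ℕ} (hr : r ≠ 0)
    (a : WittVector p C) : ∃ θ, h.Intertwines θ (Algebra.lmul _ _
      (WittVector.ghostComponent (padicValNat p r) a) * hsCoeff D r) :=
  exists_intertwines fun x => by
    obtain ⟨y, hy⟩ := h.exists_versch_hsCoeff D hr x
    refine ⟨versch^[n - padicValNat p r] (frob^[padicValNat p r - n] (toW p n π a) * y), ?_⟩
    rw [ghostHom_bullet, Module.End.mul_apply, hy]
    simp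

theorem existsUnique_isBullet [IsReduced B] {D : C →ₐ[W p n k] C⟦X⟧} (r : ℕ)
    {δ : Module.End (W p n k) (W p n B)} (hδ : h.Intertwines δ (hsCoeff D r)) (a : W p n B) :
    ∃! θ : Module.End (W p n k) (W p n B), IsBullet r a δ θ := by
  rcases eq_or_ne r 0 with rfl | hr
  · refine ⟨Algebra.lmul _ _ a * δ, ?_, fun θ hθ => ?_⟩
    · simp [IsBullet]
    · ext1 x
      have hθ : ∀ x, θ x = a * δ x := by simpa [IsBullet] using hθ
      rw [hθ, Module.End.mul_apply]; simp
  · obtain ⟨a, rfl⟩ := toW_surjective (p := p) (n := n) h.surjective a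
    simp only [isBullet_iff hr hδ]
    obtain ⟨θ, hθ⟩ := exists_bullet (h := h) (D := D) hr a
    exact ⟨θ, hθ, fun θ' hθ' => hθ'.unique hθ⟩

theorem isDiffOp_of_isBullet [IsReduced B] {D : C →ₐ[W p n k] C⟦X⟧}
    (hD : ∀ c, constantCoeff (D c) = c) {r : ℕ} {δ θ : Module.End (W p n k) (W p n B)}
    (hδ : h.Intertwines δ (hsCoeff D r)) {a : W p n B} (hθ : IsBullet r a δ θ) :
    IsDiffOp _ _ r θ := by
  rcases eq_or_ne r 0 with rfl | hr
  · have : θ = Algebra.lmul _ _ a * δ := by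
      ext1 x
      rw [IsBullet, if_pos rfl] at hθ
      rw [hθ, Module.End.mul_apply]; simp
    rw [this]
    exact (hδ.isDiffOp (isDiffOp_hsCoeff hD 0)).lmul_mul a
  · obtain ⟨a, rfl⟩ := toW_surjective (p := p) (n := n) h.surjective a
    exact ((isBullet_iff hr hδ a).mp hθ).isDiffOp ((isDiffOp_hsCoeff hD r).lmul_mul _)

theorem isBullet_one [IsReduced B] {D : C →ₐ[W p n k] C⟦X⟧} {r : ℕ}
    {δ : Module.End (W p n k) (W p n B)} (hδ : h.Intertwines δ (hsCoeff D r)) :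
    IsBullet r 1 δ δ := by
  rcases eq_or_ne r 0 with rfl | hr
  · simp [IsBullet]
  · rw [← map_one (toW p n π), isBullet_iff hr hδ, map_one, map_one, one_mul]
    exact hδ

/-- The bullet operators of any Hasse-Schmidt derivation lie in the algebra generated by those of
a system of étale coordinates. -/
theorem isBullet_mem [IsReduced B] {m : ℕ} {z : Fin m → C} {D : Fin m → C →ₐ[W p n k] C⟦X⟧}
    (hD : IsCoordHS z D)
    (hz : (MvPolynomial.aeval z : MvPolynomial (Fin m) (W p n k) →ₐ[W p n k] C).toRingHom.FormallyUnramified)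
    {δ : Fin m → ℕ → Module.End (W p n k) (W p n B)}
    (hδ : ∀ i r, h.Intertwines (δ i r) (hsCoeff (D i) r))
    {S : Subalgebra (W p n k) (Module.End (W p n k) (W p n B))}
    (hl : ∀ b, Algebra.lmul _ _ b ∈ S)
    (hS : ∀ i r a (θ : Module.End (W p n k) (W p n B)), IsBullet r a (δ i r) θ → θ ∈ S)
    {D' : C →ₐ[W p n k] C⟦X⟧} (hD' : ∀ c, constantCoeff (D' c) = c) {r : ℕ} {a : W p n B}
    {δ' θ : Module.End (W p n k) (W p n B)} (hδ' : h.Intertwines δ' (hsCoeff D' r))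
    (hθ : IsBullet r a δ' θ) : θ ∈ S := by
  rcases eq_or_ne r 0 with rfl | hr
  · have : θ = Algebra.lmul _ _ a := by
      rw [hsCoeff_zero hD'] at hδ'
      obtain rfl := hδ'.unique Intertwines.one
      ext1 x
      rw [IsBullet, if_pos rfl] at hθ
      rw [hθ]; simp
    rw [this]; exact hl a
  obtain ⟨a, rfl⟩ := toW_surjective (p := p) (n := n) h.surjective a
  -- After Taylor expansion in the coordinates z, each multi-index s can be treated separately.
  rw [isBullet_iff hr hδ', hsCoeff_eq_sum_hsMulti hD hz hD' r r le_rfl, Finset.mul_sum] at hθ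
  have hδS : ∀ i r, δ i r ∈ S := fun i r => hS i r 1 _ (isBullet_one (hδ i r))
  have key : ∀ s : Fin m → ℕ, ∃ θ ∈ S, h.Intertwines θ
      (Algebra.lmul _ _ (WittVector.ghostComponent (padicValNat p r) a) *
        (Algebra.lmul _ _ (coeff r (∏ i, (D' (z i) - PowerSeries.C (z i)) ^ s i)) *
        hsMulti hD hz s)) := by
    intro s
    by_cases hs : s = 0
    · refine ⟨0, zero_mem S, fun x => ?_⟩
      simp [hs, coeff_one, hr]
    -- Choose a nonzero entry of least p-adic valuation v. Then p^v divides every s_i, the product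
    -- of the h_i^(s_i) is a p^v-th power, and the bullet coefficient can be attached to the factor
    -- D_{i₀} of index s_{i₀}.
    obtain ⟨i₀, hi₀, hmin⟩ := Finset.exists_min_image (Finset.univ.filter fun i => s i ≠ 0)
      (fun i => padicValNat p (s i)) (by
        obtain ⟨i, hi⟩ := Function.ne_iff.mp hs
        exact ⟨i, by simpa using hi⟩)
    have hi₀ : s i₀ ≠ 0 := by simpa using hi₀
    set v := padicValNat p (s i₀)
    have hdvd : ∀ i, p ^ v ∣ s i := by
      intro i
      by_cases hi : s i = 0
      · rw [hi]; exact dvd_zero _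
      · exact (padicValNat_dvd_iff_le (p := p) hi).mpr (hmin i (by simpa using hi))
    choose t ht using hdvd
    have hprod : ∏ i, (D' (z i) - PowerSeries.C (z i)) ^ s i =
        WittVector.ghostComponent v (WittVector.teichmuller p
          (∏ i, (D' (z i) - PowerSeries.C (z i)) ^ t i)) := by
      rw [WittVector.ghostComponent_teichmuller, ← Finset.prod_pow]
      refine Finset.prod_congr rfl fun i _ => ?_
      rw [← pow_mul, mul_comm, ← ht]
    -- The total coefficient is the v-th ghost component of c, exactly the form required of a bullet
    -- operator of index s_{i₀}. The other factors of D^s are plain lifted derivations.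
    obtain ⟨c, hc⟩ := exists_ghostComponent_eq_mul hr a
      (coeff_ghostComponent_mem v r (WittVector.teichmuller p
          (∏ i, (D' (z i) - PowerSeries.C (z i)) ^ t i)))
    obtain ⟨θ₁, hθ₁⟩ := exists_bullet (h := h) (D := D i₀) hi₀ c
    let T : Submonoid (Module.End (W p n k) C) :=
      { carrier := {η | ∃ θ ∈ S, h.Intertwines θ η}
        mul_mem' := fun ⟨θ, h₁, h₂⟩ ⟨θ', h₁', h₂'⟩ => ⟨θ * θ', mul_mem h₁ h₁', h₂.mul h₂'⟩
        one_mem' := ⟨1, one_mem S, Intertwines.one⟩ }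
    obtain ⟨θ₂, hθ₂S, hθ₂⟩ : hsMultiErase hD hz i₀ s ∈ T :=
      hsMultiErase_mem hD hz (S := T) (fun i r => ⟨δ i r, hδS i r, hδ i r⟩) i₀ s
    refine ⟨θ₁ * θ₂, mul_mem (hS i₀ _ _ _ ((isBullet_iff hi₀ (hδ i₀ _) c).mpr hθ₁)) hθ₂S, ?_⟩
    rw [← mul_assoc, ← map_mul, hprod, ← hc, hsMulti_eq_mul_erase hD hz i₀, ← mul_assoc]
    exact hθ₁.mul hθ₂
  choose η hηS hη using key
  rw [hθ.unique (Intertwines.sum _ fun s _ => hη s)]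
  exact sum_mem fun s _ => hηS s

end IsFlatLift

end Bullet
end WittDiff
end

noncomputable section
namespace WittDiff

/-! ### Lifting étale algebras -/

section EtaleLift

/-- Étale algebras lift along surjections with nilpotent principal kernel. -/
theorem exists_etale_lift {A' A B : Type u} [CommRing A'] [CommRing A] [CommRing B] [Algebra A B]
    [Algebra.Etale A B] (red : A' →+* A) (hred : Function.Surjective red) {q : A'}
    (hker : ∀ x, red x = 0 → q ∣ x) (hq : IsNilpotent q) :
    ∃ (C : Type u) (_ : CommRing C) (_ : Algebra A' C) (_ : Algebra.Etale A' C) (π : C →+* B),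
      Function.Surjective π ∧ (∀ x, π x = 0 → algebraMap A' C q ∣ x) ∧
      ∀ a, π (algebraMap A' C a) = algebraMap A B (red a) := by
  -- Take a presentation with as many relations as variables and lift the relations arbitrarily. The
  -- lifted algebra is again étale because its Jacobian reduces to a unit modulo a nilpotent
  -- element.
  obtain ⟨ι, σ, _, _, P, hP⟩ :=
    (Algebra.Etale.iff_isStandardSmoothOfRelativeDimension_zero.mp ‹Algebra.Etale A B›).out
  have : Fintype σ := Fintype.ofFinite σ
  have hmap := MvPolynomial.map_surjective (σ := ι) red hred
  choose v hv using fun j => hmap (P.relation j)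
  let I : Ideal (MvPolynomial ι A') := Ideal.span (Set.range v)
  let ε : MvPolynomial ι A' →+* B := (MvPolynomial.aeval P.val).toRingHom.comp (MvPolynomial.map red)
  have hIker : I.map (MvPolynomial.map red) = P.ker := by
    rw [← P.span_range_relation_eq_ker, Ideal.map_span, ← Set.range_comp]
    congr 2
    exact funext hv
  have hmem : ∀ f, ε f = 0 ↔ MvPolynomial.map red f ∈ P.ker := by
    intro f
    rw [P.ker_eq_ker_aeval_val, RingHom.mem_ker]
    rfl
  let π : MvPolynomial ι A' ⧸ I →+* B := Ideal.Quotient.lift I ε fun a ha => by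
    rw [hmem, ← hIker]
    exact Ideal.mem_map_of_mem _ ha
  have hπ : ∀ f, π (Ideal.Quotient.mk I f) = ε f := fun f => rfl
  have hπs : Function.Surjective π := by
    intro b
    obtain ⟨f, hf⟩ := P.aeval_val_surjective b
    obtain ⟨f, rfl⟩ := hmap f
    exact ⟨Ideal.Quotient.mk I f, hf⟩
  have hπk : ∀ x, π x = 0 → algebraMap A' (MvPolynomial ι A' ⧸ I) q ∣ x := by
    intro x hx
    obtain ⟨f, rfl⟩ := Ideal.Quotient.mk_surjective x
    rw [hπ, hmem, ← hIker, Ideal.mem_map_iff_of_surjective _ hmap] at hx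
    obtain ⟨g, hg, hgf⟩ := hx
    have h1 : MvPolynomial.C q ∣ f - g := by
      rw [MvPolynomial.C_dvd_iff_dvd_coeff]
      intro s
      apply hker
      rw [← MvPolynomial.coeff_map, map_sub, hgf, sub_self, MvPolynomial.coeff_zero]
    have h2 := map_dvd (Ideal.Quotient.mk I) h1
    rw [map_sub, Ideal.Quotient.eq_zero_iff_mem.mpr hg, sub_zero] at h2
    exact h2
  have hunit : ∀ x, IsUnit (π x) → IsUnit x := by
    intro x hx
    obtain ⟨y, hy⟩ := hx.exists_right_inv
    obtain ⟨y, rfl⟩ := hπs y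
    obtain ⟨c, hc⟩ := hπk (x * y - 1) (by rw [map_sub, map_mul, hy, map_one, sub_self])
    refine isUnit_of_mul_isUnit_left (y := y) ?_
    rw [← sub_add_cancel (x * y) 1, hc]
    refine IsNilpotent.isUnit_add_one ?_
    exact Commute.isNilpotent_mul_right (Commute.all _ _) (hq.map _)
  classical
  let P' := Algebra.PreSubmersivePresentation.naive (v := v) P.map P.map_inj
  have hjac : π P'.jacobian = P.jacobian := by
    rw [P'.jacobian_eq_jacobiMatrix_det, P.jacobian_eq_jacobiMatrix_det]
    have hP' : algebraMap P'.Ring (MvPolynomial ι A' ⧸ I) P'.jacobiMatrix.det =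
        Ideal.Quotient.mkₐ A' I P'.jacobiMatrix.det := by
      rw [P'.algebraMap_apply]
      congr 1
      exact MvPolynomial.algHom_ext fun i => MvPolynomial.aeval_X _ _
    rw [P.algebraMap_apply]
    refine (congrArg π hP').trans ?_
    change MvPolynomial.aeval P.val (MvPolynomial.map red P'.jacobiMatrix.det) = _
    congr 1
    rw [RingHom.map_det]
    congr 1
    ext1 i j
    rw [RingHom.mapMatrix_apply, Matrix.map_apply, P.jacobiMatrix_apply]
    erw [Algebra.PreSubmersivePresentation.jacobiMatrix_naive]
    rw [← MvPolynomial.pderiv_map, hv]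
  let Q : Algebra.SubmersivePresentation A' (MvPolynomial ι A' ⧸ I) ι σ :=
    { P' with jacobian_isUnit := hunit _ (hjac ▸ P.jacobian_isUnit) }
  have hQ : Algebra.IsStandardSmoothOfRelativeDimension 0 A' (MvPolynomial ι A' ⧸ I) :=
    Q.isStandardSmoothOfRelativeDimension hP
  refine ⟨MvPolynomial ι A' ⧸ I, inferInstance, inferInstance,
    Algebra.Etale.iff_isStandardSmoothOfRelativeDimension_zero.mpr hQ, π, hπs, hπk, fun a => ?_⟩
  change ε (MvPolynomial.C a) = _
  simp [ε]

/-- Multiplication by `p` has the expected kernel on flat algebras. -/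
theorem torsion_of_flat {A C : Type*} [CommRing A] [CommRing C] [Algebra A C] [Module.Flat A C]
    {p n : ℕ} (hA : ∀ a : A, (p : A) * a = 0 → (p : A) ^ n ∣ a) (x : C) (hx : (p : C) * x = 0) :
    (p : C) ^ n ∣ x := by
  -- The equational criterion for flatness, applied to the single relation p x = 0, writes x as a
  -- combination of elements of A killed by p.
  obtain ⟨l, a, y, h1, h2⟩ := Module.Flat.isTrivialRelation_of_sum_smul_eq_zero (R := A) (M := C)
    (ι := Unit) (f := fun _ => (p : A)) (x := fun _ => x) (by simpa [Algebra.smul_def] using hx)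
  have h1 : x = _ := h1 ()
  rw [h1]
  refine Finset.dvd_sum fun j _ => ?_
  obtain ⟨c, hc⟩ := hA (a () j) (by simpa using h2 j)
  rw [hc, Algebra.smul_def, map_mul, map_pow, map_natCast, mul_assoc]
  exact dvd_mul_right _ _

end EtaleLift

/-! ### Torsion in W_{n+1}(k) for perfect k -/

section WittOfPerfect

variable {p n : ℕ} [Fact p.Prime] {k : Type*} [CommRing k] [CharP k p]

variable (p n k) in
theorem pow_succ_eq_zero : (p : W p n k) ^ (n + 1) = 0 := by
  rw [← map_natCast (WittVector.truncate (p := p) (R := k) (n + 1)), ← map_pow]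
  ext i
  rw [WittVector.coeff_truncate, WittVector.coeff_p_pow_eq_zero (p := p) (R := k) (by omega),
    TruncatedWittVector.coeff_zero]

variable [PerfectRing k p]

/-- Over a perfect ring of characteristic p the ideals p^j W(k) and V^j W(k) coincide. -/
theorem exists_pow_mul_of_coeff_eq_zero {j : ℕ} {x : W p n k}
    (hx : ∀ i : Fin (n + 1), (i : ℕ) < j → x.coeff i = 0) : (p : W p n k) ^ j ∣ x := by
  let y : WittVector p k := x.out
  have hy : WittVector.truncate (n + 1) y = x := TruncatedWittVector.truncateFun_out x
  rcases le_or_gt j (n + 1) with hj | hj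
  · have : y ∈ Ideal.span {(p : WittVector p k) ^ j} := by
      rw [WittVector.mem_span_p_pow_iff_le_coeff_eq_zero]
      intro m hm
      have := hx ⟨m, by omega⟩ hm
      rwa [← hy, WittVector.coeff_truncate] at this
    obtain ⟨c, hc⟩ := Ideal.mem_span_singleton.mp this
    rw [← hy, hc, map_mul, map_pow, map_natCast]
    exact dvd_mul_right _ _
  · have : x = 0 := by
      ext i
      rw [hx i (by omega), TruncatedWittVector.coeff_zero]
    rw [this]; exact dvd_zero _

theorem dvd_of_coeff_zero {x : W p n k} (hx : x.coeff 0 = 0) : (p : W p n k) ∣ x := by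
  have := exists_pow_mul_of_coeff_eq_zero (j := 1) (x := x) (fun i hi => by
    obtain rfl : i = 0 := Fin.ext (by simpa using hi)
    exact hx)
  rwa [pow_one] at this

/-- Component i + 1 of p x is x_i^p, so p x = 0 forces the components of index less than n to
vanish. -/
theorem pow_dvd_of_mul_eq_zero {x : W p n k} (hx : (p : W p n k) * x = 0) :
    (p : W p n k) ^ n ∣ x := by
  refine exists_pow_mul_of_coeff_eq_zero fun i hi => ?_
  let y : WittVector p k := x.out
  have hy : WittVector.truncate (n + 1) y = x := TruncatedWittVector.truncateFun_out x
  rw [← hy, ← map_natCast (WittVector.truncate (p := p) (R := k) (n + 1)), ← map_mul,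
    mul_comm] at hx
  have := congrArg (TruncatedWittVector.coeff ⟨i + 1, by omega⟩) hx
  rw [WittVector.coeff_truncate, WittVector.mul_charP_coeff_succ,
    TruncatedWittVector.coeff_zero] at this
  rw [← hy, WittVector.coeff_truncate]
  exact (PerfectRing.bijective_frobenius (R := k) (p := p)).1 (by simpa [frobenius_def, (Fact.out : p.Prime).ne_zero] using this)

variable (p n k) in
theorem isFlatLift_mvPolynomial (m : ℕ) : IsFlatLift p n k
    (MvPolynomial.map (wittConst : W p n k →+* k) : MvPolynomial (Fin m) (W p n k) →+* _) where
  surjective := MvPolynomial.map_surjective _ fun b =>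
    ⟨teich b, by rw [wittConst_apply]; simp [teich]⟩
  dvd f hf := by
    rw [← map_natCast MvPolynomial.C, MvPolynomial.C_dvd_iff_dvd_coeff]
    intro s
    apply dvd_of_coeff_zero
    rw [← wittConst_apply, ← MvPolynomial.coeff_map, hf, MvPolynomial.coeff_zero]
  char := by rw [← map_natCast MvPolynomial.C, CharP.cast_eq_zero, map_zero]
  pow := by rw [← map_natCast MvPolynomial.C, ← map_pow, pow_succ_eq_zero, map_zero]
  torsion f hf := by
    rw [← map_natCast MvPolynomial.C, ← map_pow, MvPolynomial.C_dvd_iff_dvd_coeff]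
    intro s
    apply pow_dvd_of_mul_eq_zero
    rw [← MvPolynomial.coeff_C_mul, map_natCast, hf, MvPolynomial.coeff_zero]
  map_algebraMap w := by
    rw [MvPolynomial.algebraMap_eq, MvPolynomial.map_C, wittConst_apply,
      MvPolynomial.algebraMap_eq]

end WittOfPerfect

/-! ### Existence of a flat lift with coordinates -/

section ExistsLift

variable {p n : ℕ} [Fact p.Prime] {k B : Type u} [CommRing k] [CharP k p] [PerfectRing k p]
  [CommRing B] [Algebra k B] {m : ℕ} {z : Fin m → B}

/-- An algebra with coordinates has a flat lift with coordinates. -/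
theorem exists_isFlatLift (n : ℕ) (hz : IsCoord k z) : ∃ (C : Type u) (_ : CommRing C)
    (_ : Algebra (W p n k) C) (π : C →+* B) (zc : Fin m → C), IsFlatLift p n k π ∧
      IsCoord (W p n k) zc ∧ ∀ i, π (zc i) = z i := by
  let A' := MvPolynomial (Fin m) (W p n k)
  let _ : Algebra (MvPolynomial (Fin m) k) B := (MvPolynomial.aeval z).toRingHom.toAlgebra
  have : Algebra.Etale (MvPolynomial (Fin m) k) B := hz
  have hL := isFlatLift_mvPolynomial p n k m
  obtain ⟨C, _, _, hC, π, hπ, hdvd, halg⟩ := exists_etale_lift (B := B)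
    (MvPolynomial.map (wittConst : W p n k →+* k) : MvPolynomial (Fin m) (W p n k) →+* _)
    hL.surjective (q := (p : A')) hL.dvd ⟨n + 1, hL.pow⟩
  let _ : Algebra (W p n k) C := ((algebraMap A' C).comp MvPolynomial.C).toAlgebra
  have hae : (MvPolynomial.aeval fun i => algebraMap A' C (MvPolynomial.X i) :
      MvPolynomial (Fin m) (W p n k) →ₐ[W p n k] C).toRingHom = algebraMap A' C := by
    ext x
    · simp; rfl
    · simp
  refine ⟨C, inferInstance, inferInstance, π, fun i => algebraMap A' C (MvPolynomial.X i),
    ⟨hπ, ?_, ?_, ?_, ?_, ?_⟩, ?_, ?_⟩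
  · intro x hx
    have := hdvd x hx
    rwa [map_natCast] at this
  · rw [← map_natCast (algebraMap k B), CharP.cast_eq_zero, map_zero]
  · have := congrArg (algebraMap A' C) hL.pow
    rwa [map_pow, map_natCast, map_zero] at this
  · exact torsion_of_flat (A := A') hL.torsion
  · intro w
    change π (algebraMap A' C (MvPolynomial.C w)) = _
    rw [halg]
    change MvPolynomial.aeval z _ = _
    rw [MvPolynomial.map_C, MvPolynomial.aeval_C, wittConst_apply]
  · rw [IsCoord, hae, RingHom.etale_algebraMap]
    exact hC
  · intro i
    rw [halg]
    change MvPolynomial.aeval z _ = _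
    simp

end ExistsLift
end WittDiff
end

noncomputable section
namespace WittDiff

/-! ### Comparison of flat lifts and lifting of coordinates -/

section CoordLift

variable {p n : ℕ} [Fact p.Prime]

namespace IsFlatLift

variable {k B C C' : Type*} [CommRing k] [CommRing B] [CommRing C] [CommRing C'] [Algebra k B]
  [Algebra (W p n k) C] [Algebra (W p n k) C'] {π : C →+* B} {π' : C' →+* B}

theorem dvd_of_pow_mul (h : IsFlatLift p n k π) {j : ℕ} (hj : j ≤ n) {x : C}
    (hx : (p : C) ^ j * x = 0) : (p : C) ^ (n + 1 - j) ∣ x := by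
  induction j generalizing x with
  | zero =>
    rw [pow_zero, one_mul] at hx
    rw [hx]; exact dvd_zero _
  | succ j ih =>
    have h1 := ih (by omega) (x := p * x) (by rw [← mul_assoc, ← pow_succ, hx])
    rw [show n + 1 - j = n - j + 1 by omega] at h1
    rw [show n + 1 - (j + 1) = n - j by omega]
    exact h.pow_dvd_of_mul (Nat.sub_le _ _) h1

/-- Morphisms of flat lifts are isomorphisms. -/
theorem bijective (h : IsFlatLift p n k π) (h' : IsFlatLift p n k π') {φ : C' →+* C}
    (hφ : ∀ x, π (φ x) = π' x) : Function.Bijective φ := by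
  constructor
  · rw [injective_iff_map_eq_zero]
    intro x hx
    -- If x = p^j y with φ(x) = 0, the torsion condition gives p ∣ φ(y). Then y reduces to 0 in B
    -- and is itself divisible by p. At j = n + 1 this yields x = 0.
    have key : ∀ j ≤ n + 1, (p : C') ^ j ∣ x := by
      intro j
      induction j with
      | zero => intro _; simp
      | succ j ih =>
        intro hj
        obtain ⟨y, rfl⟩ := ih (by omega)
        rw [map_mul, map_pow, map_natCast] at hx
        have h1 := h.dvd_of_pow_mul (by omega) hx
        obtain ⟨e, he⟩ := (dvd_pow_self (p : C) (show n + 1 - j ≠ 0 by omega)).trans h1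
        rw [pow_succ]
        refine mul_dvd_mul_left _ (h'.dvd _ ?_)
        rw [← hφ, he, map_mul, map_natCast, h.char, zero_mul]
    obtain ⟨y, hy⟩ := key (n + 1) le_rfl
    rw [hy, h'.pow, zero_mul]
  · intro x
    -- Successive approximation modulo powers of p, which stops since p^(n+1) = 0.
    have key : ∀ j, ∃ y e, x = φ y + (p : C) ^ j * e := by
      intro j
      induction j with
      | zero => exact ⟨0, x, by simp⟩
      | succ j ih =>
        obtain ⟨y, e, he⟩ := ih
        obtain ⟨y', hy'⟩ := h'.surjective (π e)
        obtain ⟨e', he'⟩ := h.dvd (e - φ y') (by rw [map_sub, hφ, hy', sub_self])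
        refine ⟨y + p ^ j * y', e', ?_⟩
        rw [he, sub_eq_iff_eq_add.mp he']
        simp only [map_add, map_mul, map_pow, map_natCast]
        ring
    obtain ⟨y, e, he⟩ := key (n + 1)
    exact ⟨y, by rw [he, h.pow, zero_mul, add_zero]⟩

theorem apply_aeval (h : IsFlatLift p n k π) {m : ℕ} {z : Fin m → B} {zc : Fin m → C}
    (hz : ∀ i, π (zc i) = z i) (f : MvPolynomial (Fin m) (W p n k)) :
    π (MvPolynomial.aeval zc f) = MvPolynomial.aeval z (MvPolynomial.map wittConst f) := by
  induction f using MvPolynomial.induction_on with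
  | C a => simp [h.map_algebraMap, wittConst_apply]
  | add f g hf hg => rw [map_add, map_add, map_add, map_add, hf, hg]
  | mul_X f i hf => simp [hf, hz]

theorem isNilpotent_ker (h : IsFlatLift p n k π) : IsNilpotent (RingHom.ker π) := by
  refine ⟨n + 1, ?_⟩
  have : RingHom.ker π ≤ Ideal.span {(p : C)} := fun x hx =>
    Ideal.mem_span_singleton.mpr (h.dvd x hx)
  refine le_bot_iff.mp ((Ideal.pow_right_mono this _).trans ?_)
  rw [Ideal.span_singleton_pow, h.pow]
  simp

end IsFlatLift

/-- Coordinates lift along flat lifts. -/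
theorem IsFlatLift.exists_isCoord {k B C : Type u} [CommRing k] [CommRing B] [CommRing C]
    [CharP k p] [PerfectRing k p] [Algebra k B] [Algebra (W p n k) C] {π : C →+* B}
    (h : IsFlatLift p n k π) {m : ℕ} {z : Fin m → B} (hz : IsCoord k z) :
    ∃ zc : Fin m → C, (∀ i, π (zc i) = z i) ∧ IsCoord (W p n k) zc := by
  choose w hw using fun i => h.surjective (z i)
  refine ⟨w, hw, ?_⟩
  -- Arbitrary lifts w of z are compared with a lift C' that has étale coordinates. Formal
  -- smoothness of C' yields a map C' → C over B sending these coordinates to w; a map of flat lifts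
  -- is bijective, so w is étale too.
  obtain ⟨C', _, _, π', zc, h', hzc, hπ'⟩ := exists_isFlatLift n hz
  let A := MvPolynomial (Fin m) (W p n k)
  let _ : Algebra A C := (MvPolynomial.aeval w).toRingHom.toAlgebra
  let _ : Algebra A C' := (MvPolynomial.aeval zc).toRingHom.toAlgebra
  let _ : Algebra A B := (π.comp (MvPolynomial.aeval w).toRingHom).toAlgebra
  have : Algebra.Etale A C' := hzc
  let πa : C →ₐ[A] B := { π with commutes' := fun _ => rfl }
  let πa' : C' →ₐ[A] B := { π' with
    commutes' := fun f => (h'.apply_aeval hπ' f).trans (h.apply_aeval hw f).symm }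
  let φ : C' →ₐ[A] C := Algebra.FormallySmooth.liftOfSurjective πa' πa h.surjective h.isNilpotent_ker
  have hφ : ∀ x, π (φ x) = π' x :=
    Algebra.FormallySmooth.liftOfSurjective_apply πa' πa h.surjective h.isNilpotent_ker
  have hb : Function.Bijective (φ : C' →+* C) := h.bijective h' hφ
  have heq : (MvPolynomial.aeval w : A →ₐ[W p n k] C).toRingHom =
      (φ : C' →+* C).comp (MvPolynomial.aeval zc : A →ₐ[W p n k] C').toRingHom :=
    RingHom.ext fun f => (φ.commutes f).symm
  rw [IsCoord, heq]
  exact RingHom.Etale.stableUnderComposition _ _ hzc (RingHom.Etale.of_bijective hb)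

/-- By flatness B embeds into its base change to the fraction field of the polynomial ring, and an
étale algebra over a field is reduced. -/
theorem isReduced_of_isCoord {k B : Type*} [Field k] [CommRing B] [Algebra k B] {m : ℕ}
    {z : Fin m → B} (hz : IsCoord k z) : IsReduced B := by
  let A := MvPolynomial (Fin m) k
  let _ : Algebra A B := (MvPolynomial.aeval z).toRingHom.toAlgebra
  have : Algebra.Etale A B := hz
  let K := FractionRing A
  have hinj : Function.Injective (Algebra.TensorProduct.includeRight : B →ₐ[A] TensorProduct A K B) :=
    Algebra.TensorProduct.includeRight_injective (IsFractionRing.injective A K)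
  have : IsReduced (TensorProduct A K B) := Algebra.FormallyUnramified.isReduced_of_field K _
  exact isReduced_of_injective _ hinj

end CoordLift

/-! ### Generation of étale algebras by p-power powers -/

section PowerGenerators

open TensorProduct

variable {p : ℕ} [Fact p.Prime] {A B : Type*} [CommRing A] [CommRing B] [Algebra A B]

/-- An unramified algebra in characteristic `p` is generated by the `p`-th powers. -/
theorem adjoin_pow_eq_top [Algebra.FiniteType A B] [Algebra.FormallyUnramified A B]
    (hp : (p : B) = 0) : Algebra.adjoin A (Set.range fun b : B => b ^ p) = ⊤ := by
  set S := Algebra.adjoin A (Set.range fun b : B => b ^ p) with hS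
  have hpow : ∀ b : B, ∃ s : S, algebraMap S B s = b ^ p :=
    fun b => ⟨⟨b ^ p, Algebra.subset_adjoin ⟨b, rfl⟩⟩, rfl⟩
  have : Algebra.FiniteType S B := Algebra.FiniteType.of_restrictScalars_finiteType A S B
  have : Algebra.FormallyUnramified S B := Algebra.FormallyUnramified.of_restrictScalars A S B
  have : Algebra.IsIntegral S B := ⟨fun b => by
    obtain ⟨s, hs⟩ := hpow b
    refine IsIntegral.of_pow (n := p) (Fact.out : p.Prime).pos ?_
    rw [← hs]; exact isIntegral_algebraMap⟩
  have : Module.Finite S B := Algebra.IsIntegral.finite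
  obtain ⟨t, ht, ht1⟩ := (Algebra.FormallyUnramified.iff_exists_tensorProduct (R := S) (S := B)).mp
    inferInstance
  -- In characteristic p the p-th power of b ⊗ 1 - 1 ⊗ b is zero over S, since b^p lies in S. So the
  -- kernel of multiplication is nil, and the element t, which multiplication sends to 1, is a unit.
  have hnil : KaehlerDifferential.ideal S B ≤ nilradical (B ⊗[S] B) := by
    rw [← KaehlerDifferential.span_range_eq_ideal, Ideal.span_le]
    rintro _ ⟨b, rfl⟩
    refine ⟨p, ?_⟩
    obtain ⟨s, hs⟩ := hpow b
    have hp' : (p : B ⊗[S] B) = 0 := by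
      rw [← map_natCast (algebraMap B (B ⊗[S] B)), hp, map_zero]
    rw [pow_char_sub hp']
    simp only [Algebra.TensorProduct.tmul_pow, one_pow, ← hs]
    rw [Algebra.algebraMap_eq_smul_one, TensorProduct.tmul_smul, TensorProduct.smul_tmul', sub_self]
    exact Ideal.zero_mem _
  have htu : IsUnit t := by
    have : t - 1 ∈ KaehlerDifferential.ideal S B := by
      rw [KaehlerDifferential.ideal, RingHom.mem_ker, map_sub, ht1, map_one, sub_self]
    rw [← sub_add_cancel t 1]
    exact IsNilpotent.isUnit_add_one (hnil this)
  -- The unit t kills each 1 ⊗ b - b ⊗ 1, so these vanish and S → B is an epimorphism. A finite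
  -- epimorphism of rings is surjective.
  have hepi : Algebra.IsEpi S B := by
    rw [Algebra.isEpi_iff_forall_one_tmul_eq]
    intro b
    exact sub_eq_zero.mp ((htu.mul_left_eq_zero).mp (ht b))
  have hsurj := Algebra.isEpi_iff_surjective_algebraMap_of_finite.mp hepi
  rw [eq_top_iff]
  intro b _
  obtain ⟨s, rfl⟩ := hsurj b
  exact s.2

/-- The p-th power map is additive, so it carries the generators for exponent p^M to elements of the
group for exponent p^(M+1). That group is closed under products and contains the image of A and all
p-th powers, so it is everything. -/
theorem closure_mul_pow_eq_top [Algebra.FiniteType A B] [Algebra.FormallyUnramified A B]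
    (hp : (p : B) = 0) (M : ℕ) :
    AddSubgroup.closure {b : B | ∃ a c, b = algebraMap A B a * c ^ p ^ M} = ⊤ := by
  have hmul : ∀ M, ∀ x ∈ AddSubgroup.closure {b : B | ∃ a c, b = algebraMap A B a * c ^ p ^ M},
      ∀ y ∈ AddSubgroup.closure {b : B | ∃ a c, b = algebraMap A B a * c ^ p ^ M},
      x * y ∈ AddSubgroup.closure {b : B | ∃ a c, b = algebraMap A B a * c ^ p ^ M} := by
    intro M x hx y hy
    induction hx, hy using AddSubgroup.closure_induction₂ with
    | mem x y hx hy =>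
      obtain ⟨a, c, rfl⟩ := hx
      obtain ⟨a', c', rfl⟩ := hy
      exact AddSubgroup.subset_closure ⟨a * a', c * c', by rw [map_mul]; ring⟩
    | zero_left => rw [zero_mul]; exact zero_mem _
    | zero_right => rw [mul_zero]; exact zero_mem _
    | add_left _ _ _ _ _ _ h₁ h₂ => rw [add_mul]; exact add_mem h₁ h₂
    | add_right _ _ _ _ _ _ h₁ h₂ => rw [mul_add]; exact add_mem h₁ h₂
    | neg_left _ _ _ _ h => rw [neg_mul]; exact neg_mem h
    | neg_right _ _ _ _ h => rw [mul_neg]; exact neg_mem h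
  induction M with
  | zero =>
    rw [eq_top_iff]
    intro b _
    exact AddSubgroup.subset_closure ⟨1, b, by simp⟩
  | succ M ih =>
    set H := AddSubgroup.closure {b : B | ∃ a c, b = algebraMap A B a * c ^ p ^ (M + 1)} with hH
    have hpow : ∀ b : B, b ^ p ∈ H := by
      intro b
      have hb : b ∈ AddSubgroup.closure {b : B | ∃ a c, b = algebraMap A B a * c ^ p ^ M} :=
        ih ▸ AddSubgroup.mem_top b
      induction hb using AddSubgroup.closure_induction with
      | mem b hb =>
        obtain ⟨a, c, rfl⟩ := hb
        exact AddSubgroup.subset_closure ⟨a ^ p, c, by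
          rw [map_pow, mul_pow, ← pow_mul, ← pow_succ]⟩
      | zero => rw [zero_pow (Fact.out : p.Prime).ne_zero]; exact zero_mem _
      | add x y _ _ hx hy => rw [pow_char_add hp]; exact add_mem hx hy
      | neg x _ hx =>
        rw [← zero_sub, pow_char_sub hp, zero_pow (Fact.out : p.Prime).ne_zero, zero_sub]
        exact neg_mem hx
    rw [eq_top_iff]
    intro b _
    have hb : b ∈ Algebra.adjoin A (Set.range fun b : B => b ^ p) :=
      adjoin_pow_eq_top (A := A) hp ▸ Algebra.mem_top
    induction hb using Algebra.adjoin_induction with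
    | mem b hb => obtain ⟨b, rfl⟩ := hb; exact hpow b
    | algebraMap a => exact AddSubgroup.subset_closure ⟨a, 1, by simp⟩
    | add x y _ _ hx hy => exact add_mem (hx trivial) (hy trivial)
    | mul x y _ _ hx hy => exact hmul _ _ (hx trivial) _ (hy trivial)

end PowerGenerators
end WittDiff
end

noncomputable section
namespace WittDiff

/-! ### The polynomial case: divided powers and the map w̃ₙ -/

section PolynomialLift

open PowerSeries

theorem coeff_C_add_X_pow {C : Type*} [CommRing C] (a : C) (s r : ℕ) :
    coeff r ((PowerSeries.C a + X : C⟦X⟧) ^ s) = a ^ (s - r) * s.choose r := by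
  have := Polynomial.coeff_X_add_C_pow a s r
  rw [← this, ← Polynomial.coeff_coe]
  simp [add_comm]

variable {R : Type*} [CommRing R] {m : ℕ}
  {D : Fin m → MvPolynomial (Fin m) R →ₐ[R] (MvPolynomial (Fin m) R)⟦X⟧}

theorem hsCoeff_monomial (hD : IsCoordHS (fun i => MvPolynomial.X i) D) (i : Fin m) (r : ℕ)
    (s : Fin m →₀ ℕ) (c : R) : hsCoeff (D i) r (MvPolynomial.monomial s c) =
      MvPolynomial.monomial (s - Finsupp.single i r) (((s i).choose r : R) * c) := by
  have hmon : ∀ (s : Fin m →₀ ℕ) (c : R), MvPolynomial.monomial s c = MvPolynomial.C c *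
      (MvPolynomial.X i ^ s i * ∏ j ∈ Finset.univ.erase i, MvPolynomial.X j ^ s j) := by
    intro s c
    rw [MvPolynomial.monomial_eq, Finsupp.prod_fintype _ _ fun _ => pow_zero _,
      Finset.mul_prod_erase _ (fun j => MvPolynomial.X j ^ s j) (Finset.mem_univ i)]
  rw [hsCoeff_apply, hmon, map_mul (D i), map_mul (D i), map_pow (D i), hD.coord, if_pos rfl]
  have hprod : D i (∏ j ∈ Finset.univ.erase i, MvPolynomial.X j ^ s j) =
      PowerSeries.C (∏ j ∈ Finset.univ.erase i, MvPolynomial.X j ^ s j) := by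
    rw [map_prod, map_prod]
    refine Finset.prod_congr rfl fun j hj => ?_
    rw [map_pow, hD.coord, if_neg (Finset.ne_of_mem_erase hj).symm, add_zero, map_pow]
  have hC : D i (MvPolynomial.C c) = PowerSeries.C (MvPolynomial.C c) := by
    refine ((D i).commutes c).trans ?_
    rw [PowerSeries.algebraMap_apply, MvPolynomial.algebraMap_eq]
  rw [hprod, hC, coeff_C_mul, coeff_mul_C, coeff_C_add_X_pow, hmon (s - Finsupp.single i r)]
  have : ∏ j ∈ Finset.univ.erase i, MvPolynomial.X (R := R) j ^ (s - Finsupp.single i r) j =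
      ∏ j ∈ Finset.univ.erase i, MvPolynomial.X j ^ s j :=
    Finset.prod_congr rfl fun j hj => by
      rw [Finsupp.tsub_apply, Finsupp.single_eq_of_ne (Finset.ne_of_mem_erase hj), Nat.sub_zero]
  rw [this, Finsupp.tsub_apply, Finsupp.single_eq_same, map_mul, map_natCast]
  ring

theorem hsCoeff_eq_divPow (hD : IsCoordHS (fun i => MvPolynomial.X i) D) (i : Fin m) (r : ℕ)
    (g : MvPolynomial (Fin m) R) : hsCoeff (D i) r g = divPow i r g := by
  conv_lhs => rw [g.as_sum]
  rw [map_sum, divPow]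
  exact Finset.sum_congr rfl fun s _ => hsCoeff_monomial hD i r s _

end PolynomialLift

/-! ### Operators on W_{n+1}(B) induced from a flat lift -/

section Lift

open PowerSeries

variable {p n : ℕ} [Fact p.Prime]

theorem map_polyLift {k : Type*} [CommRing k] {m : ℕ} (g : MvPolynomial (Fin m) k) :
    MvPolynomial.map (wittConst : W p n k →+* k) (polyLift g) = g := by
  rw [polyLift, map_sum]
  conv_rhs => rw [g.as_sum]
  refine Finset.sum_congr rfl fun s _ => ?_
  rw [MvPolynomial.map_monomial, wittConst_apply]
  simp [teich]

/-- Any componentwise lift computes `ghostHom`; lifting coefficients by Teichmüller elements gives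
the stated formula. -/
theorem ghostHom_eq_ghostLift {k : Type*} [CommRing k] [CharP k p] [PerfectRing k p] {m : ℕ}
    (x : W p n (MvPolynomial (Fin m) k)) :
    (isFlatLift_mvPolynomial p n k m).ghostHom x = ghostLift x := by
  let y : WittVector p (MvPolynomial (Fin m) (W p n k)) := WittVector.mk p fun i =>
    if h : i < n + 1 then polyLift (x.coeff ⟨i, h⟩) else 0
  have hy : toW p n (MvPolynomial.map wittConst) y = x := by
    ext1 i
    rw [coeff_toW, WittVector.coeff_mk, dif_pos i.2, map_polyLift]
  rw [← hy, IsFlatLift.ghostHom_toW, hy, ghostComponent_eq_sum, ghostLift, Finset.sum_range]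
  refine Finset.sum_congr rfl fun i _ => ?_
  rw [WittVector.coeff_mk, dif_pos i.2]

/-- Naturality of `ghostHom`. -/
theorem IsFlatLift.ghostHom_wittMap {k B B' C C' : Type*} [CommRing k] [CommRing B] [CommRing C]
    [CommRing B'] [CommRing C'] [Algebra k B] [Algebra k B'] [Algebra (W p n k) C]
    [Algebra (W p n k) C'] {π : C →+* B} {π' : C' →+* B'} (h : IsFlatLift p n k π)
    (h' : IsFlatLift p n k π') {φ : C →+* C'} {g : B →+* B'} (hφ : ∀ x, π' (φ x) = g (π x))
    (x : W p n B) : h'.ghostHom (wittMap g x) = φ (h.ghostHom x) := by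
  obtain ⟨y, rfl⟩ := toW_surjective (p := p) (n := n) h.surjective x
  rw [h.ghostHom_toW, ← ghostComponent_map, ← h'.ghostHom_toW]
  congr 1
  ext i
  rw [coeff_wittMap, coeff_toW, coeff_toW, WittVector.map_coeff, hφ]

theorem isCoord_X (R : Type*) [CommRing R] (m : ℕ) :
    IsCoord R (fun i : Fin m => (MvPolynomial.X i : MvPolynomial (Fin m) R)) := by
  refine RingHom.Etale.of_bijective ?_
  rw [MvPolynomial.aeval_X_left]
  exact Function.bijective_id

theorem IsCoord.formallyUnramified {k B : Type*} [CommRing k] [CommRing B] [Algebra k B] {m : ℕ}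
    {z : Fin m → B} (hz : IsCoord k z) : (MvPolynomial.aeval z :
      MvPolynomial (Fin m) k →ₐ[k] B).toRingHom.FormallyUnramified :=
  RingHom.Etale.formallyUnramified _ hz

theorem IsCoord.formallySmooth {k B : Type*} [CommRing k] [CommRing B] [Algebra k B] {m : ℕ}
    {z : Fin m → B} (hz : IsCoord k z) : (MvPolynomial.aeval z :
      MvPolynomial (Fin m) k →ₐ[k] B).toRingHom.FormallySmooth := by
  let _ : Algebra (MvPolynomial (Fin m) k) B := (MvPolynomial.aeval z).toRingHom.toAlgebra
  have : Algebra.Etale (MvPolynomial (Fin m) k) B := hz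
  exact (inferInstance : Algebra.FormallySmooth (MvPolynomial (Fin m) k) B)

/-- The operators induced by the coordinate Hasse-Schmidt derivations of a flat lift. -/
theorem IsFlatLift.isWittLift {k B C : Type*} [Field k] [CommRing B] [CommRing C]
    [CharP k p] [PerfectRing k p] [Algebra k B] [IsReduced B] [Algebra (W p n k) C] {π : C →+* B}
    (h : IsFlatLift p n k π) {m : ℕ} {z : Fin m → B} {zc : Fin m → C} (hzc : ∀ i, π (zc i) = z i)
    {D : Fin m → C →ₐ[W p n k] C⟦X⟧} (hD : IsCoordHS zc D)
    {δ : Fin m → ℕ → Module.End (W p n k) (W p n B)}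
    (hδ : ∀ i r, h.Intertwines (δ i r) (hsCoeff (D i) r)) : IsWittLift p n z δ := by
  have h₀ := isFlatLift_mvPolynomial p n k m
  obtain ⟨D₀, hD₀⟩ := exists_isCoordHS (isCoord_X (W p n k) m).formallySmooth
  choose δ₀ hδ₀ using fun i r => h₀.exists_intertwines_hsCoeff (hD₀.constantCoeff i) r
  refine ⟨fun i => ?_, fun i r x y => ?_, δ₀, fun i r x => ?_, fun i r x => ?_⟩
  · have := hδ i 0
    rw [hsCoeff_zero (hD.constantCoeff i)] at this
    exact this.unique IsFlatLift.Intertwines.one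
  · apply h.ghostHom_injective
    rw [hδ, map_mul, hsCoeff_mul_apply, map_sum]
    exact Finset.sum_congr rfl fun c _ => by rw [map_mul, hδ, hδ]
  · rw [← ghostHom_eq_ghostLift, ← ghostHom_eq_ghostLift, ← hsCoeff_eq_divPow hD₀, hδ₀]
  · have hnat := h₀.ghostHom_wittMap h (φ := (MvPolynomial.aeval zc :
      MvPolynomial (Fin m) (W p n k) →ₐ[W p n k] C).toRingHom) (g := (MvPolynomial.aeval z).toRingHom)
      (h.apply_aeval hzc)
    apply h.ghostHom_injective
    rw [hδ, hnat, hnat, hδ₀]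
    have hcomp : (D i).comp (MvPolynomial.aeval zc) =
        (PowerSeries.mapAlgHom (MvPolynomial.aeval zc)).comp (D₀ i) := by
      refine MvPolynomial.algHom_ext fun j => ?_
      rw [AlgHom.comp_apply, AlgHom.comp_apply, MvPolynomial.aeval_X, hD.coord, hD₀.coord,
        PowerSeries.mapAlgHom_apply, map_add]
      split_ifs <;> simp
    have := congrArg (coeff r) (DFunLike.congr_fun hcomp (h₀.ghostHom x))
    rw [AlgHom.comp_apply, AlgHom.comp_apply, PowerSeries.mapAlgHom_apply, PowerSeries.coeff_map] at this
    exact this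

end Lift

/-! ### Rigidity over the Witt vectors of the polynomial ring -/

section Unique

open PowerSeries

variable {p n : ℕ} [Fact p.Prime]

/-- Additive maps on `W_{n+1}(B)` which commute with the multiplication by all large `p`-powers
of Teichmüller elements are determined by their restriction to the image of the Witt vectors of
the polynomial ring of a system of coordinates. -/
theorem eq_zero_of_isCoord {k B E : Type*} [CommRing k] [CommRing B] [Algebra k B] [CommRing E]
    (hp : (p : B) = 0) {m : ℕ} {z : Fin m → B} (hz : IsCoord k z) {σ : W p n B →+* E}
    (M : ℕ) (θ : W p n B →+ E) (hθ : ∀ c x, θ (x * c ^ p ^ M) = θ x * σ c ^ p ^ M)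
    (h0 : ∀ x, θ (wittMap (MvPolynomial.aeval (R := k) z).toRingHom x) = 0) : θ = 0 := by
  let _ : Algebra (MvPolynomial (Fin m) k) B := (MvPolynomial.aeval z).toRingHom.toAlgebra
  have : Algebra.Etale (MvPolynomial (Fin m) k) B := hz
  suffices h : θ.ker = ⊤ by
    ext x
    exact (h ▸ AddSubgroup.mem_top x : x ∈ θ.ker)
  refine addSubgroup_eq_top_of_versch_teich
    (closure_mul_pow_eq_top (A := MvPolynomial (Fin m) k) hp (M + n)) _ ?_
  rintro j hj _ ⟨a, c, rfl⟩
  rw [AddMonoidHom.mem_ker]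
  -- Passing through V^j costs j of the p-powers in the exponent. Starting from M + n leaves at
  -- least M of them for every j ≤ n.
  rw [show M + n = M + (n - j) + j by omega, iterate_versch_teich_mul_pow, pow_add, pow_mul', hθ]
  have : versch^[j] (teich (algebraMap (MvPolynomial (Fin m) k) B a)) =
      wittMap (p := p) (n := n) (MvPolynomial.aeval (R := k) z).toRingHom
        (versch^[j] (teich a)) := by
    rw [wittMap_iterate_versch, wittMap_teich]; rfl
  rw [this, h0, zero_mul]

end Unique
end WittDiff
end

noncomputable section
namespace WittDiff

/-! ### Uniqueness and functoriality of the lifted derivations -/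

section Affine

open PowerSeries

theorem natCast_eq_zero_of_algebra {p : ℕ} {k : Type*} (B : Type*) [CommRing k] [CommRing B] [CharP k p]
    [Algebra k B] : (p : B) = 0 := by
  rw [← map_natCast (algebraMap k B), CharP.cast_eq_zero, map_zero]

variable {p n : ℕ} [Fact p.Prime]

theorem pow_succ_eq_zero_of_algebra {k : Type*} (B : Type*) [CommRing k] [CommRing B] [CharP k p]
    [Algebra k B] : (p : W p n B) ^ (n + 1) = 0 := by
  rw [← map_natCast (algebraMap (W p n k) (W p n B)), ← map_pow, pow_succ_eq_zero, map_zero]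

/-- The coefficients of g^(p^(r+n+1)) in degrees 1 to r vanish, because v_p(s) ≤ s for s ≥ 1. Thus
Hasse-Schmidt components of index r are linear over such powers. -/
theorem coeff_mul_pow_eq {C : Type*} [CommRing C] (hp : (p : C) ^ (n + 1) = 0) (r : ℕ)
    (f g : C⟦X⟧) : coeff r (f * g ^ p ^ (r + n + 1)) =
      coeff r f * constantCoeff g ^ p ^ (r + n + 1) := by
  rw [coeff_mul, Finset.sum_eq_single (r, 0)]
  · rw [coeff_zero_eq_constantCoeff_apply, map_pow]
  · intro c hc hc0
    have hc := Finset.HasAntidiagonal.mem_antidiagonal.mp hc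
    have h2 : c.2 ≠ 0 := fun h => hc0 (Prod.ext (by dsimp; omega) h)
    rw [coeff_pow_eq_zero hp h2, mul_zero]
    have : padicValNat p c.2 ≤ c.2 :=
      ((Nat.lt_pow_self (Fact.out : p.Prime).one_lt).le).trans
        (Nat.le_of_dvd (Nat.pos_of_ne_zero h2) pow_padicValNat_dvd)
    omega
  · intro h
    exact absurd (Finset.HasAntidiagonal.mem_antidiagonal.mpr (add_zero r)) h

/-- The Hasse-Schmidt derivation as a ring homomorphism to power series. -/
def hsRingHom {E : Type*} [CommRing E] {F : Type*} [CommRing F] (d : ℕ → E →+ F) (σ : E →+* F)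
    (h0 : ∀ x, d 0 x = σ x) (hmul : ∀ r x y, d r (x * y) =
      ∑ c ∈ Finset.HasAntidiagonal.antidiagonal r, d c.1 x * d c.2 y) (h1 : ∀ r, d (r + 1) 1 = 0) :
    E →+* F⟦X⟧ where
  toFun x := PowerSeries.mk fun r => d r x
  map_one' := by
    ext r
    rw [coeff_mk, coeff_one]
    cases r with
    | zero => simp [h0]
    | succ r => simp [h1]
  map_zero' := by ext r; simp
  map_add' x y := by ext r; simp
  map_mul' x y := by ext r; simp [hmul, coeff_mul]

theorem coeff_hsRingHom {E : Type*} [CommRing E] {F : Type*} [CommRing F] (d : ℕ → E →+ F)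
    (σ : E →+* F) (h0 : ∀ x, d 0 x = σ x) (hmul : ∀ r x y, d r (x * y) =
      ∑ c ∈ Finset.HasAntidiagonal.antidiagonal r, d c.1 x * d c.2 y) (h1 : ∀ r, d (r + 1) 1 = 0)
    (r : ℕ) (x : E) : coeff r (hsRingHom d σ h0 hmul h1 x) = d r x :=
  coeff_mk r fun r => d r x

/-- Expanding d_{r+1}(1 · 1), with lower terms zero by induction, gives d_{r+1}(1) = 2 d_{r+1}(1).
-/
theorem hs_succ_one {E F : Type*} [CommRing E] [CommRing F] {d : ℕ → E →+ F}
    (h0 : d 0 1 = 1) (hmul : ∀ r x y, d r (x * y) =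
      ∑ c ∈ Finset.HasAntidiagonal.antidiagonal r, d c.1 x * d c.2 y) (r : ℕ) : d (r + 1) 1 = 0 := by
  induction r using Nat.strong_induction_on with
  | _ r ih =>
  have h := hmul (r + 1) 1 1
  rw [mul_one, Finset.Nat.antidiagonal_succ, Finset.sum_cons, Finset.sum_map] at h
  rw [Finset.sum_eq_single (r, 0)] at h
  · simpa [h0] using h
  · intro c hc hc0
    have hc := Finset.HasAntidiagonal.mem_antidiagonal.mp hc
    have h1 : c.1 < r := by
      by_contra hlt
      exact hc0 (Prod.ext (by dsimp; omega) (by dsimp; omega))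
    simp [ih c.1 h1]
  · intro h
    exact absurd (Finset.HasAntidiagonal.mem_antidiagonal.mpr (add_zero r)) h

variable {k B B' : Type*} [Field k] [CharP k p] [CommRing B] [CommRing B']
  [Algebra k B] [Algebra k B'] {m : ℕ} {z : Fin m → B}

/-- Differential operators on `W_{n+1}(B)` are determined by their restriction to the Witt vectors
of the polynomial ring. -/
theorem eq_of_mem_diffOps (hz : IsCoord k z) {θ θ' : Module.End (W p n k) (W p n B)}
    (hθ : θ ∈ diffOps (W p n k) (W p n B)) (hθ' : θ' ∈ diffOps (W p n k) (W p n B))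
    (h : ∀ x, θ (wittMap (MvPolynomial.aeval (R := k) z).toRingHom x) =
      θ' (wittMap (MvPolynomial.aeval (R := k) z).toRingHom x)) : θ = θ' := by
  obtain ⟨N, hN⟩ := sub_mem hθ hθ'
  have hp : (p : W p n B) ^ (n + 1) = 0 := pow_succ_eq_zero_of_algebra (k := k) B
  have := eq_zero_of_isCoord (natCast_eq_zero_of_algebra (k := k) B) hz (σ := RingHom.id (W p n B))
    ((n + 1) * N) (θ - θ').toAddMonoidHom (fun c x => by
      have := (comm_eq_zero_iff _ _).mp (hN.comm_pow_eq_zero (Fact.out : p.Prime).pos hp c le_rfl) x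
      rw [mul_comm x, mul_comm _ (_ ^ _)]
      exact this) (fun x => by
      change (θ - θ') _ = 0
      rw [LinearMap.sub_apply, h, sub_self])
  refine sub_eq_zero.mp (LinearMap.ext fun x => ?_)
  exact DFunLike.congr_fun this x

variable [PerfectRing k p]

/-- Both sides, as r varies, are Hasse-Schmidt derivations along the map of Witt rings. They agree
on the Witt vectors of the polynomial ring and are linear over large p-power powers, so rigidity
applies. With g the identity this is uniqueness of the lift. -/
theorem IsWittLift.restrict (hz : IsCoord k z) (g : B →ₐ[k] B')
    {δ : Fin m → ℕ → Module.End (W p n k) (W p n B)} (hδ : IsWittLift p n z δ)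
    {δ' : Fin m → ℕ → Module.End (W p n k) (W p n B')} (hδ' : IsWittLift p n (fun i => g (z i)) δ')
    (i : Fin m) (r : ℕ) (x : W p n B) :
    δ' i r (wittMap g.toRingHom x) = wittMap g.toRingHom (δ i r x) := by
  let σ : W p n B →+* W p n B' := wittMap g.toRingHom
  have hp : (p : W p n B') ^ (n + 1) = 0 := pow_succ_eq_zero_of_algebra (k := k) B'
  let d : ℕ → W p n B →+ W p n B' := fun r => σ.toAddMonoidHom.comp (δ i r).toAddMonoidHom
  let d' : ℕ → W p n B →+ W p n B' := fun r => (δ' i r).toAddMonoidHom.comp σ.toAddMonoidHom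
  have hd0 : ∀ x, d 0 x = σ x := fun x => by
    change σ (δ i 0 x) = σ x
    rw [hδ.zero]; rfl
  have hd0' : ∀ x, d' 0 x = σ x := fun x => by
    change δ' i 0 (σ x) = σ x
    rw [hδ'.zero]; rfl
  have hdm : ∀ r x y, d r (x * y) =
      ∑ c ∈ Finset.HasAntidiagonal.antidiagonal r, d c.1 x * d c.2 y := fun r x y => by
    change σ (δ i r (x * y)) = _
    rw [hδ.leibniz, map_sum]
    exact Finset.sum_congr rfl fun c _ => map_mul _ _ _
  have hdm' : ∀ r x y, d' r (x * y) =
      ∑ c ∈ Finset.HasAntidiagonal.antidiagonal r, d' c.1 x * d' c.2 y := fun r x y => by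
    change δ' i r (σ (x * y)) = _
    rw [map_mul, hδ'.leibniz]
    rfl
  let Δ := hsRingHom d σ hd0 hdm (hs_succ_one ((hd0 1).trans (map_one _)) hdm)
  let Δ' := hsRingHom d' σ hd0' hdm' (hs_succ_one ((hd0' 1).trans (map_one _)) hdm')
  have hΔ : ∀ r x, coeff r (Δ x) = d r x := fun r x => coeff_hsRingHom _ _ _ _ _ r x
  have hΔ' : ∀ r x, coeff r (Δ' x) = d' r x := fun r x => coeff_hsRingHom _ _ _ _ _ r x
  have key : d' r - d r = 0 := by
    refine eq_zero_of_isCoord (natCast_eq_zero_of_algebra (k := k) B) hz (σ := σ) (r + n + 1) _ ?_ ?_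
    · intro c x
      rw [AddMonoidHom.sub_apply, AddMonoidHom.sub_apply, ← hΔ, ← hΔ', ← hΔ, ← hΔ', map_mul Δ,
        map_pow Δ, map_mul Δ', map_pow Δ', coeff_mul_pow_eq hp, coeff_mul_pow_eq hp,
        ← coeff_zero_eq_constantCoeff_apply, ← coeff_zero_eq_constantCoeff_apply, hΔ, hΔ', hΔ, hΔ', hd0,
        hd0', sub_mul]
    · intro x
      obtain ⟨δ₀, h₁, h₂⟩ := hδ.compat
      obtain ⟨δ₀', h₁', h₂'⟩ := hδ'.compat
      -- The restrictions to the Witt vectors of the polynomial ring are unique, since w̃ₙ is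
      -- injective there.
      have heq : δ₀ i r x = δ₀' i r x := by
        apply (isFlatLift_mvPolynomial p n k m).ghostHom_injective
        rw [ghostHom_eq_ghostLift, ghostHom_eq_ghostLift, h₁, h₁']
      have hcomp : ∀ y, σ (wittMap (MvPolynomial.aeval (R := k) z).toRingHom y) =
          wittMap (MvPolynomial.aeval (R := k) fun i => g (z i)).toRingHom y := fun y => by
        ext j
        change (wittMap g.toRingHom _).coeff j = _
        rw [coeff_wittMap, coeff_wittMap, coeff_wittMap]
        exact DFunLike.congr_fun (MvPolynomial.comp_aeval z g) _
      change δ' i r (σ _) - σ (δ i r _) = 0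
      rw [h₂, hcomp, hcomp, h₂', heq, sub_self]
  exact sub_eq_zero.mp (DFunLike.congr_fun key x)

theorem IsWittLift.unique (hz : IsCoord k z)
    {δ δ' : Fin m → ℕ → Module.End (W p n k) (W p n B)} (hδ : IsWittLift p n z δ)
    (hδ' : IsWittLift p n z δ') : δ = δ' := by
  funext i r
  ext1 x
  have hid : ∀ y : W p n B, wittMap (AlgHom.id k B).toRingHom y = y := fun y =>
    TruncatedWittVector.ext fun j => coeff_wittMap _ _ _
  have := hδ.restrict hz (AlgHom.id k B) (δ' := δ') hδ' i r x
  rw [hid, hid] at this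
  exact this.symm

end Affine

/-! ### The algebra of Witt differential operators of an étale chart -/

section AffineMain

open PowerSeries

variable {p n : ℕ} [Fact p.Prime] {k B B' : Type u} [Field k] [CharP k p] [PerfectRing k p]
  [CommRing B] [CommRing B'] [Algebra k B] [Algebra k B'] {m : ℕ} {z : Fin m → B}

/-- All lifts of the coordinate derivations are induced from flat lifts. -/
theorem IsFlatLift.exists_intertwines_isWittLift {C : Type u} [CommRing C] [Algebra (W p n k) C]
    [IsReduced B] {π : C →+* B} (h : IsFlatLift p n k π) (hz : IsCoord k z) :
    ∃ (zc : Fin m → C) (D : Fin m → C →ₐ[W p n k] C⟦X⟧)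
      (δ : Fin m → ℕ → Module.End (W p n k) (W p n B)), IsCoord (W p n k) zc ∧ IsCoordHS zc D ∧
      IsWittLift p n z δ ∧ ∀ i r, h.Intertwines (δ i r) (hsCoeff (D i) r) := by
  obtain ⟨zc, hzc, hzc'⟩ := h.exists_isCoord hz
  obtain ⟨D, hD⟩ := exists_isCoordHS hzc'.formallySmooth
  choose δ hδ using fun i r => h.exists_intertwines_hsCoeff (hD.constantCoeff i) r
  exact ⟨zc, D, δ, hzc', hD, h.isWittLift hzc hD hδ, hδ⟩

variable (p n) in
theorem IsCoord.existsUnique_isWittLift (hz : IsCoord k z) :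
    ∃! δ : Fin m → ℕ → Module.End (W p n k) (W p n B), IsWittLift p n z δ := by
  have := isReduced_of_isCoord hz
  obtain ⟨C, _, _, π, _, h, _, _⟩ := exists_isFlatLift (p := p) n hz
  obtain ⟨zc, D, δ, _, _, hδ, _⟩ := h.exists_intertwines_isWittLift hz
  exact ⟨δ, hδ, fun δ' hδ' => hδ'.unique hz hδ⟩

theorem IsWittLift.existsUnique_isBullet (hz : IsCoord k z)
    {δ : Fin m → ℕ → Module.End (W p n k) (W p n B)} (hδ : IsWittLift p n z δ) (i : Fin m) (r : ℕ)
    (a : W p n B) : ∃! θ : Module.End (W p n k) (W p n B), IsBullet r a (δ i r) θ := by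
  have := isReduced_of_isCoord hz
  obtain ⟨C, _, _, π, _, h, _, _⟩ := exists_isFlatLift (p := p) n hz
  obtain ⟨zc, D, δ', _, _, hδ', hi⟩ := h.exists_intertwines_isWittLift hz
  obtain rfl := hδ.unique hz hδ'
  exact IsFlatLift.existsUnique_isBullet r (hi i r) a

variable (p n) in
-- Both systems of coordinates lift to one and the same flat lift C, where the Taylor expansion
-- expresses the operators of one system through those of the other.
theorem wittDiffOfCoord_eq (hz : IsCoord k z) :
    wittDiffOfCoord (k := k) p n z = wittDiff p n k B := by
  have := isReduced_of_isCoord hz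
  apply le_antisymm
  · refine Algebra.adjoin_mono (Set.union_subset_union_right _ fun θ hθ => ⟨m, z, hz, hθ⟩)
  · refine Algebra.adjoin_le ?_
    rintro θ (⟨b, rfl⟩ | ⟨m', z', hz', δ', hδ', i, r, a, hθ⟩)
    · exact Algebra.subset_adjoin (Or.inl ⟨b, rfl⟩)
    · obtain ⟨C, _, _, π, _, h, _, _⟩ := exists_isFlatLift (p := p) n hz
      obtain ⟨zc, D, δ, hzc, hD, hδ, hi⟩ := h.exists_intertwines_isWittLift hz
      obtain ⟨zc', D', δ'', hzc', hD', hδ'', hi'⟩ := h.exists_intertwines_isWittLift hz'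
      obtain rfl := hδ'.unique hz' hδ''
      exact IsFlatLift.isBullet_mem hD hzc.formallyUnramified hi
        (fun b => Algebra.subset_adjoin (Or.inl ⟨b, rfl⟩))
        (fun i r a θ hθ => Algebra.subset_adjoin (Or.inr ⟨δ, hδ, i, r, a, hθ⟩))
        (hD'.constantCoeff i) (hi' i r) hθ

variable (p n) in
theorem wittDiff_le_diffOps (hz : IsCoord k z) :
    wittDiff p n k B ≤ diffOps (W p n k) (W p n B) := by
  have := isReduced_of_isCoord hz
  rw [← wittDiffOfCoord_eq p n hz]
  refine Algebra.adjoin_le ?_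
  rintro θ (⟨b, rfl⟩ | ⟨δ, hδ, i, r, a, hθ⟩)
  · exact ⟨0, isDiffOp_lmul b⟩
  · obtain ⟨C, _, _, π, _, h, _, _⟩ := exists_isFlatLift (p := p) n hz
    obtain ⟨zc, D, δ', _, hD, hδ', hi⟩ := h.exists_intertwines_isWittLift hz
    obtain rfl := hδ.unique hz hδ'
    exact ⟨r, IsFlatLift.isDiffOp_of_isBullet (hD.constantCoeff i) (hi i r) hθ⟩

/-- The image of a bullet operator under a map of algebras compatible with the coordinates. -/
theorem isBullet_wittMap (g : B →+* B') {r : ℕ} {a : W p n B} {δ θ : W p n B → W p n B}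
    {δ' θ' : W p n B' → W p n B'} (hδ : ∀ x, δ' (wittMap g x) = wittMap g (δ x))
    (hθ : IsBullet r a δ θ) (hθ' : IsBullet r (wittMap g a) δ' θ') (x : W p n B) :
    θ' (wittMap g x) = wittMap g (θ x) := by
  unfold IsBullet at hθ hθ'
  split_ifs at hθ hθ' with hr
  · rw [hθ', hθ, map_mul, hδ]
  · obtain ⟨y, hy, hy'⟩ := hθ x
    obtain ⟨w, hw, hw'⟩ := hθ' (wittMap g x)
    rw [hw', hy', wittMap_iterate_versch, map_mul, wittMap_iterate_frob]
    -- The two preimages under the power of V need not correspond to each other; only their images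
    -- under it agree.
    refine iterate_versch_mul_congr (Nat.sub_le _ _) _ ?_
    rw [← hw, hδ, hy, wittMap_iterate_versch]

/-- Witt differential operators extend along maps which preserve some system of coordinates. -/
theorem exists_mem_wittDiff_restrict (hz : IsCoord k z) (g : B →ₐ[k] B')
    (hz' : IsCoord k fun i => g (z i)) {θ : Module.End (W p n k) (W p n B)}
    (hθ : θ ∈ wittDiff p n k B) : ∃ θ' ∈ wittDiff p n k B',
      ∀ x, θ' (wittMap g.toRingHom x) = wittMap g.toRingHom (θ x) := by
  rw [← wittDiffOfCoord_eq p n hz] at hθ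
  induction hθ using Algebra.adjoin_induction with
  | mem θ hθ =>
    rcases hθ with ⟨b, rfl⟩ | ⟨δ, hδ, i, r, a, hθ⟩
    · exact ⟨_, lmul_mem_wittDiff p n k (wittMap g.toRingHom b), fun x => by simp⟩
    · obtain ⟨δ', hδ', _⟩ := hz'.existsUnique_isWittLift p n
      obtain ⟨θ', hθ', _⟩ := hδ'.existsUnique_isBullet hz' i r (wittMap g.toRingHom a)
      exact ⟨θ', Algebra.subset_adjoin (Or.inr ⟨m, _, hz', δ', hδ', i, r, _, hθ'⟩),
        isBullet_wittMap _ (hδ.restrict hz g hδ' i r) hθ hθ'⟩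
  | algebraMap c =>
    refine ⟨_, Subalgebra.algebraMap_mem _ c, fun x => ?_⟩
    have : wittMap g.toRingHom (algebraMap (W p n k) (W p n B) c) =
        algebraMap (W p n k) (W p n B') c := by
      ext j
      change (wittMap g.toRingHom (wittMap (algebraMap k B) c)).coeff j =
        (wittMap (algebraMap k B') c).coeff j
      simp
    simp [Algebra.smul_def, ← this]
  | add θ η _ _ h₁ h₂ =>
    obtain ⟨θ', hθ', h₁⟩ := h₁
    obtain ⟨η', hη', h₂⟩ := h₂
    exact ⟨θ' + η', add_mem hθ' hη', fun x => by
      rw [LinearMap.add_apply, LinearMap.add_apply, h₁, h₂, map_add]⟩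
  | mul θ η _ _ h₁ h₂ =>
    obtain ⟨θ', hθ', h₁⟩ := h₁
    obtain ⟨η', hη', h₂⟩ := h₂
    exact ⟨θ' * η', mul_mem hθ' hη', fun x => by
      rw [Module.End.mul_apply, Module.End.mul_apply, h₂, h₁]⟩

theorem eq_of_restrict_eq (g : B →ₐ[k] B') (hz' : IsCoord k fun i => g (z i))
    {θ θ' : Module.End (W p n k) (W p n B')} (hθ : θ ∈ wittDiff p n k B')
    (hθ' : θ' ∈ wittDiff p n k B')
    (h : ∀ x, θ (wittMap g.toRingHom x) = θ' (wittMap g.toRingHom x)) : θ = θ' := by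
  refine eq_of_mem_diffOps hz' (wittDiff_le_diffOps p n hz' hθ) (wittDiff_le_diffOps p n hz' hθ')
    fun x => ?_
  have : wittMap (MvPolynomial.aeval (R := k) fun i => g (z i)).toRingHom x =
      wittMap g.toRingHom (wittMap (MvPolynomial.aeval (R := k) z).toRingHom x) := by
    ext j
    rw [coeff_wittMap, coeff_wittMap, coeff_wittMap]
    exact (DFunLike.congr_fun (MvPolynomial.comp_aeval z g) _).symm
  rw [this, h]

end AffineMain
end WittDiff
end

noncomputable section
namespace WittDiff

/-! ### Localization of Witt vectors at a Teichmüller element -/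

section Away

/-- `γ : B → B'` is a localization away from `g`, in terms of elements. -/
structure IsAwayMap {B B' : Type*} [CommRing B] [CommRing B'] (γ : B →+* B') (g : B) : Prop where
  isUnit : IsUnit (γ g)
  surj : ∀ b', ∃ (N : ℕ) (b : B), b' * γ g ^ N = γ b
  ker : ∀ b, γ b = 0 → ∃ N : ℕ, g ^ N * b = 0

variable {p n : ℕ} [Fact p.Prime] {B B' : Type*} [CommRing B] [CommRing B'] {γ : B →+* B'} {g : B}

theorem mul_pow_eq_of_le {N N' : ℕ} (hN : N ≤ N') {b' : B'} {b : B}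
    (hb : b' * γ g ^ N = γ b) : b' * γ g ^ N' = γ (b * g ^ (N' - N)) := by
  rw [map_mul, ← hb, map_pow, mul_assoc, ← pow_add, Nat.add_sub_cancel' hN]

/-- Reducedness improves g^N b = 0 to g b = 0, since a power of g b vanishes. One factor g then
serves for all Witt components at once. -/
theorem IsAwayMap.mul_eq_zero [IsReduced B] (h : IsAwayMap γ g) {b : B} (hb : γ b = 0) :
    g * b = 0 := by
  obtain ⟨N, hN⟩ := h.ker b hb
  refine pow_eq_zero_iff (n := N + 1) (Nat.succ_ne_zero N) |>.mp ?_
  rw [mul_pow, pow_succ b, pow_succ g]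
  linear_combination (g * b ^ N) * hN

/-- Multiplication by [g]^K multiplies component i by g^(K p^i), so a single K clears the
denominators of all components. -/
theorem IsAwayMap.wittMap_surj (h : IsAwayMap γ g) (x' : W p n B') :
    ∃ (N : ℕ) (x : W p n B), x' * teich (γ g) ^ N = wittMap γ x := by
  choose N b hb using fun i : Fin (n + 1) => h.surj (x'.coeff i)
  let K := Finset.univ.sup N
  have hK : ∀ i : Fin (n + 1), N i ≤ K * p ^ (i : ℕ) := fun i =>
    (Finset.le_sup (Finset.mem_univ i)).trans (Nat.le_mul_of_pos_right _
      (pow_pos (Fact.out : p.Prime).pos _))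
  refine ⟨K, TruncatedWittVector.mk p fun i => b i * g ^ (K * p ^ (i : ℕ) - N i), ?_⟩
  ext i
  rw [mul_comm, ← teich_pow, coeff_teich_mul, coeff_wittMap, TruncatedWittVector.coeff_mk,
    ← mul_pow_eq_of_le (hK i) (hb i), mul_comm, pow_mul]

theorem IsAwayMap.teich_mul_eq_zero [IsReduced B] (h : IsAwayMap γ g) {x : W p n B}
    (hx : wittMap γ x = 0) : teich g * x = 0 := by
  ext i
  rw [coeff_teich_mul, TruncatedWittVector.coeff_zero]
  have := congrArg (TruncatedWittVector.coeff i) hx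
  rw [coeff_wittMap, TruncatedWittVector.coeff_zero] at this
  rw [← Nat.sub_add_cancel (Nat.one_le_pow (i : ℕ) p (Fact.out : p.Prime).pos), pow_succ,
    mul_assoc, h.mul_eq_zero this, mul_zero]

theorem isUnit_teich {b : B} (hb : IsUnit b) : IsUnit (teich b : W p n B) := by
  obtain ⟨c, hc⟩ := hb.exists_right_inv
  exact IsUnit.of_mul_eq_one (teich c) (by rw [← teich_mul, hc, teich_one])

theorem iterate_frob_mul (hp : (p : B) = 0) (j : ℕ) (a b : W p n B) :
    frob^[j] (a * b) = frob^[j] a * frob^[j] b := by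
  obtain ⟨a, rfl⟩ := WittVector.truncate_surjective p (n + 1) B a
  obtain ⟨b, rfl⟩ := WittVector.truncate_surjective p (n + 1) B b
  rw [← map_mul, iterate_frob_truncate hp, iterate_frob_truncate hp, iterate_frob_truncate hp,
    ← map_mul]
  congr 1
  induction j with
  | zero => rfl
  | succ j ih => rw [Function.iterate_succ_apply', Function.iterate_succ_apply',
      Function.iterate_succ_apply', ih, map_mul]

theorem iterate_frob_teich_pow (hp : (p : B) = 0) (j M : ℕ) (c : B) :
    frob^[j] (teich c ^ M : W p n B) = teich c ^ (M * p ^ j) := by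
  rw [← teich_pow, ← teich_pow, teich_eq_truncate, teich_eq_truncate, iterate_frob_truncate hp,
    iterate_frobenius_teichmuller, ← pow_mul]

theorem iterate_versch_mul (hp : (p : B) = 0) (j : ℕ) (y c : W p n B) :
    versch^[j] y * c = versch^[j] (y * frob^[j] c) := by
  obtain ⟨y, rfl⟩ := WittVector.truncate_surjective p (n + 1) B y
  obtain ⟨c, rfl⟩ := WittVector.truncate_surjective p (n + 1) B c
  rw [iterate_frob_truncate hp, ← map_mul, iterate_versch_truncate, iterate_versch_truncate,
    ← map_mul, WittVector.iterate_verschiebung_mul_left]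

/-- Multiplying bullet operators by powers of Teichmüller elements. -/
theorem IsBullet.teich_pow_mul (hp : (p : B) = 0) {r : ℕ} (hr : r ≠ 0) {a : W p n B}
    {δ θ : W p n B → W p n B} (hθ : IsBullet r a δ θ) (c : B) (K : ℕ) :
    IsBullet r (a * teich c ^ (K * p ^ (n - padicValNat p r))) δ
      (fun x => teich c ^ (K * p ^ (padicValNat p r - n)) * θ x) := by
  unfold IsBullet at hθ ⊢
  rw [if_neg hr] at hθ ⊢
  intro x
  obtain ⟨y, hy, hy'⟩ := hθ x
  refine ⟨y, hy, ?_⟩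
  change teich c ^ _ * θ x = _
  -- By V^j(y) c = V^j(y F^j c), the outer factor enters V as [c]^(K p^(v-n) p^(n-v)), with v =
  -- v_p(r). This is also what F^(v-n) makes of the new coefficient factor.
  rw [hy', mul_comm, iterate_versch_mul hp, iterate_frob_mul hp, iterate_frob_teich_pow hp,
    iterate_frob_teich_pow hp]
  congr 1
  rw [mul_right_comm, mul_assoc K, mul_assoc K, mul_comm (p ^ _)]

theorem verschiebung_mul_verschiebung (x y : WittVector p B) :
    WittVector.verschiebung x * WittVector.verschiebung y =
      p * WittVector.verschiebung (x * y) := by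
  rw [← WittVector.verschiebung_mul_frobenius, WittVector.frobenius_verschiebung, ← mul_assoc,
    ← nsmul_eq_mul, mul_comm (x * y), ← nsmul_eq_mul, map_nsmul]

theorem verschiebung_pow (x : WittVector p B) (m : ℕ) :
    WittVector.verschiebung x ^ (m + 1) = (p : WittVector p B) ^ m *
      WittVector.verschiebung (x ^ (m + 1)) := by
  induction m with
  | zero => simp
  | succ m ih =>
    rw [pow_succ, ih, mul_assoc, verschiebung_mul_verschiebung, ← pow_succ, ← mul_assoc, ← pow_succ]

/-- Here x = 1 + V w, and V w is nilpotent because (V w)^(m+1) = p^m V(w^(m+1)) while p^(n+1) = 0.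
-/
theorem isUnit_of_wittConst_eq_one (hp : (p : W p n B) ^ (n + 1) = 0) {x : W p n B}
    (hx : wittConst x = 1) : IsUnit x := by
  obtain ⟨y, rfl⟩ := WittVector.truncate_surjective p (n + 1) B x
  obtain ⟨w, hw⟩ := exists_sub_eq_verschiebung (x := y) (y := 1) (by
    rw [wittConst_apply, WittVector.coeff_truncate] at hx
    simpa using hx)
  have hnil : IsNilpotent (WittVector.truncate (n + 1) (WittVector.verschiebung w)) := by
    refine ⟨n + 1 + 1, ?_⟩
    rw [← map_pow, verschiebung_pow, map_mul, map_pow, map_natCast]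
    exact (congrArg (· * _) hp).trans (zero_mul _)
  rw [hw, map_add, map_one]
  exact hnil.isUnit_one_add

theorem wittConst_teich (b : B) : wittConst (teich b : W p n B) = b := by
  rw [wittConst_apply]; simp [teich]

/-- Ideals of `W_{n+1}(B)` containing Teichmüller elements which generate the unit ideal. -/
theorem ideal_eq_top_of_teich (hp : (p : W p n B) ^ (n + 1) = 0) {ι : Type*} (g : ι → B)
    (hg : Ideal.span (Set.range g) = ⊤) (I : Ideal (W p n B))
    (hI : ∀ i, ∃ N : ℕ, teich (g i) ^ N ∈ I) : I = ⊤ := by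
  choose N hN using hI
  have hspan : Ideal.span (Set.range fun i => g i ^ N i) = ⊤ := by
    refine top_unique ((Ideal.span_range_pow_eq_top _ hg fun x => N x.2.choose).ge.trans
      (Ideal.span_mono ?_))
    rintro _ ⟨x, rfl⟩
    exact ⟨x.2.choose, congrArg (· ^ N x.2.choose) x.2.choose_spec⟩
  have h1 : (1 : B) ∈ Ideal.span (Set.range fun i => g i ^ N i) := by
    rw [hspan]; exact Submodule.mem_top
  have key : ∀ b ∈ Ideal.span (Set.range fun i => g i ^ N i), ∃ x ∈ I, wittConst x = b := by
    intro b hb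
    induction hb using Submodule.span_induction with
    | mem b hb =>
      obtain ⟨i, rfl⟩ := hb
      exact ⟨teich (g i) ^ N i, hN i, by rw [← teich_pow, wittConst_teich]⟩
    | zero => exact ⟨0, zero_mem I, map_zero _⟩
    | add a b _ _ ha hb =>
      obtain ⟨x, hx, rfl⟩ := ha
      obtain ⟨y, hy, rfl⟩ := hb
      exact ⟨x + y, add_mem hx hy, map_add _ _ _⟩
    | smul c b _ hb =>
      obtain ⟨x, hx, rfl⟩ := hb
      exact ⟨teich c * x, I.mul_mem_left _ hx, by rw [map_mul, wittConst_teich, smul_eq_mul]⟩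
  obtain ⟨x, hx, hx1⟩ := key 1 h1
  exact Ideal.eq_top_of_isUnit_mem I hx (isUnit_of_wittConst_eq_one hp hx1)

end Away

/-! ### Clearing denominators of operators; local membership -/

section AwayWittDiff

variable {p n : ℕ} [Fact p.Prime] {k B B' : Type u} [Field k] [CharP k p] [PerfectRing k p]
  [CommRing B] [CommRing B'] [Algebra k B] [Algebra k B'] {m : ℕ} {z : Fin m → B}
  {γ : B →ₐ[k] B'} {g : B}

/-- Witt differential operators on a localization extend to the ring after multiplication with a
power of a Teichmüller element. -/
theorem exists_mem_wittDiff_of_away (hz : IsCoord k z) (hz' : IsCoord k fun i => γ (z i))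
    (h : IsAwayMap γ.toRingHom g) {θ' : Module.End (W p n k) (W p n B')}
    (hθ' : θ' ∈ wittDiff p n k B') : ∃ (N : ℕ), ∃ θ ∈ wittDiff p n k B,
      ∀ x, teich (γ g) ^ N * θ' (wittMap γ.toRingHom x) = wittMap γ.toRingHom (θ x) := by
  have hp := natCast_eq_zero_of_algebra (k := k) (p := p) B'
  have hmono : ∀ {θ' : Module.End (W p n k) (W p n B')} {N : ℕ}
      {θ : Module.End (W p n k) (W p n B)}, θ ∈ wittDiff p n k B →
      (∀ x, teich (γ g) ^ N * θ' (wittMap γ.toRingHom x) = wittMap γ.toRingHom (θ x)) →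
      ∀ L, ∃ θ₁ ∈ wittDiff p n k B, ∀ x, teich (γ g) ^ (L + N) * θ' (wittMap γ.toRingHom x) =
        wittMap γ.toRingHom (θ₁ x) := by
    intro θ' N θ hθ hx L
    refine ⟨_, mul_mem (lmul_mem_wittDiff p n k (teich g ^ L)) hθ, fun x => ?_⟩
    rw [pow_add, mul_assoc, hx]
    change _ = wittMap γ.toRingHom (teich g ^ L * θ x)
    rw [map_mul, map_pow, wittMap_teich]
    rfl
  have hle := wittDiff_le_diffOps p n hz'
  rw [← wittDiffOfCoord_eq p n hz'] at hθ' hle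
  induction hθ' using Algebra.adjoin_induction with
  | mem θ' hθ' =>
    rcases hθ' with ⟨b, rfl⟩ | ⟨δ', hδ', i, r, a', hθ'⟩
    · obtain ⟨N, a, ha⟩ := h.wittMap_surj b
      refine ⟨N, _, lmul_mem_wittDiff p n k a, fun x => ?_⟩
      change teich (γ.toRingHom g) ^ N * (b * _) = wittMap γ.toRingHom (a * x)
      rw [map_mul, ← ha]; ring
    · obtain ⟨δ, hδ, _⟩ := hz.existsUnique_isWittLift p n
      obtain ⟨K, a, ha⟩ := h.wittMap_surj a'
      rcases eq_or_ne r 0 with rfl | hr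
      · obtain ⟨θ, hθ, _⟩ := hδ.existsUnique_isBullet hz i 0 a
        refine ⟨K, θ, Algebra.subset_adjoin (Or.inr ⟨m, _, hz, δ, hδ, i, 0, _, hθ⟩), fun x => ?_⟩
        unfold IsBullet at hθ hθ'
        rw [if_pos rfl] at hθ hθ'
        rw [hθ', hθ, hδ.restrict hz γ hδ', map_mul, ← ha]
        change teich (γ.toRingHom g) ^ K * _ = _
        ring
      -- The coefficient is cleared by [g]^(K p^(n-v)) instead of [g]^K: only then does the change
      -- of coefficient amount to multiplying the operator on the left, by [g]^(K p^(v-n)).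
      · set v := padicValNat p r
        have ha₁ : a' * teich (γ.toRingHom g) ^ (K * p ^ (n - v)) =
            wittMap γ.toRingHom (a * teich g ^ (K * p ^ (n - v) - K)) := by
          rw [map_mul, ← ha, map_pow, wittMap_teich, mul_assoc, ← pow_add,
            Nat.add_sub_cancel' (Nat.le_mul_of_pos_right _ (pow_pos (Fact.out : p.Prime).pos _))]
        obtain ⟨θ, hθ, _⟩ := hδ.existsUnique_isBullet hz i r (a * teich g ^ (K * p ^ (n - v) - K))
        refine ⟨K * p ^ (v - n), θ,
          Algebra.subset_adjoin (Or.inr ⟨m, _, hz, δ, hδ, i, r, _, hθ⟩), fun x => ?_⟩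
        have := hθ'.teich_pow_mul hp hr (γ.toRingHom g) K
        rw [ha₁] at this
        exact isBullet_wittMap γ.toRingHom (hδ.restrict hz γ hδ' i r) hθ this x
  | algebraMap c =>
    obtain ⟨N, a, ha⟩ := h.wittMap_surj (algebraMap (W p n k) (W p n B') c)
    refine ⟨N, _, lmul_mem_wittDiff p n k a, fun x => ?_⟩
    rw [Module.algebraMap_end_apply, Algebra.smul_def]
    change teich (γ.toRingHom g) ^ N * _ = wittMap γ.toRingHom (a * x)
    rw [map_mul, ← ha]; ring
  | add θ₁ θ₂ _ _ h₁ h₂ =>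
    obtain ⟨N₁, η₁, hη₁, h₁⟩ := h₁
    obtain ⟨N₂, η₂, hη₂, h₂⟩ := h₂
    obtain ⟨ε₁, hε₁, h₁⟩ := hmono hη₁ h₁ N₂
    obtain ⟨ε₂, hε₂, h₂⟩ := hmono hη₂ h₂ N₁
    refine ⟨N₂ + N₁, ε₁ + ε₂, add_mem hε₁ hε₂, fun x => ?_⟩
    rw [LinearMap.add_apply, LinearMap.add_apply, mul_add, map_add, h₁, ← h₂, add_comm N₁]
  | mul θ₁ θ₂ hθ₁ _ h₁ h₂ =>
    obtain ⟨N₁, η₁, hη₁, h₁⟩ := h₁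
    obtain ⟨N₂, η₂, hη₂, h₂⟩ := h₂
    obtain ⟨N, hN⟩ := hle hθ₁
    -- To clear the denominator of θ₂ behind θ₁, the power of [g] must pass through θ₁. A p^M-th
    -- power does so once M is large compared with the order of θ₁, and p^M ≥ N₂ suffices for θ₂.
    let M := max ((n + 1) * N) N₂
    have hM : N₂ ≤ p ^ M := (le_max_right _ _).trans
      (Nat.lt_pow_self (Fact.out : p.Prime).one_lt).le
    obtain ⟨ε, hε, h₃⟩ := hmono hη₂ h₂ (p ^ M - N₂)
    rw [Nat.sub_add_cancel hM] at h₃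
    refine ⟨N₁ + p ^ M, η₁ * ε, mul_mem hη₁ hε, fun x => ?_⟩
    have hc := (comm_eq_zero_iff _ _).mp (hN.comm_pow_eq_zero (M := M) (Fact.out : p.Prime).pos
      (pow_succ_eq_zero_of_algebra (k := k) B') (teich (γ g)) (le_max_left _ _))
    rw [Module.End.mul_apply, Module.End.mul_apply, pow_add, mul_assoc, ← hc, h₃, h₁]

/-- Membership in `wittDiff` is local. -/
theorem mem_wittDiff_of_local (hz : IsCoord k z) {ι : Type*} (g : ι → B)
    (hg : Ideal.span (Set.range g) = ⊤) (L : ι → Type u) [∀ i, CommRing (L i)]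
    [∀ i, Algebra k (L i)] (γ : ∀ i, B →ₐ[k] L i) (hγ : ∀ i, IsAwayMap (γ i).toRingHom (g i))
    (hγz : ∀ i, IsCoord k fun j => γ i (z j)) {θ : Module.End (W p n k) (W p n B)}
    (hθ : ∀ i, ∃ θ' ∈ wittDiff p n k (L i),
      ∀ x, θ' (wittMap (γ i).toRingHom x) = wittMap (γ i).toRingHom (θ x)) :
    θ ∈ wittDiff p n k B := by
  have := isReduced_of_isCoord hz
  -- The multipliers b with b θ in the algebra form an ideal. It contains a power of each [g i], so
  -- it is the unit ideal.
  let I : Ideal (W p n B) :=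
    { carrier := {b | Algebra.lmul (W p n k) (W p n B) b * θ ∈ wittDiff p n k B}
      add_mem' := fun {a b} ha hb => by
        change Algebra.lmul (W p n k) (W p n B) (a + b) * θ ∈ wittDiff p n k B
        rw [map_add, add_mul]; exact add_mem ha hb
      zero_mem' := by
        change Algebra.lmul (W p n k) (W p n B) 0 * θ ∈ wittDiff p n k B
        rw [map_zero, zero_mul]; exact zero_mem _
      smul_mem' := fun c b hb => by
        change Algebra.lmul (W p n k) (W p n B) (c * b) * θ ∈ wittDiff p n k B
        rw [map_mul, mul_assoc]; exact mul_mem (lmul_mem_wittDiff p n k c) hb }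
  have hI : I = ⊤ := by
    refine ideal_eq_top_of_teich (pow_succ_eq_zero_of_algebra (k := k) B) g hg I fun i => ?_
    obtain ⟨θ', hθ', hx⟩ := hθ i
    obtain ⟨N, η, hη, hx'⟩ := exists_mem_wittDiff_of_away hz (hγz i) (hγ i) hθ'
    -- After [g]^N the operators agree only in the localization; the extra factor [g] kills the
    -- kernel of localization.
    refine ⟨1 + N, ?_⟩
    change Algebra.lmul (W p n k) (W p n B) _ * θ ∈ wittDiff p n k B
    have : Algebra.lmul (W p n k) (W p n B) (teich (g i) ^ (1 + N)) * θ =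
        Algebra.lmul (W p n k) (W p n B) (teich (g i)) * η := by
      ext1 x
      change teich (g i) ^ (1 + N) * θ x = teich (g i) * η x
      rw [← sub_eq_zero, pow_add, pow_one, mul_assoc, ← mul_sub]
      apply (hγ i).teich_mul_eq_zero
      rw [map_sub, ← hx', map_mul, hx, map_pow, wittMap_teich, sub_eq_zero]
      rfl
    rw [this]
    exact mul_mem (lmul_mem_wittDiff p n k _) hη
  have h1 : (1 : W p n B) ∈ I := hI ▸ Submodule.mem_top
  change Algebra.lmul (W p n k) (W p n B) 1 * θ ∈ wittDiff p n k B at h1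
  rwa [map_one, one_mul] at h1

end AwayWittDiff
end WittDiff
end

noncomputable section
namespace WittDiff

/-! ### Local charts of a smooth scheme -/

section Charts

open CategoryTheory Opposite TopologicalSpace AlgebraicGeometry

section

variable {k : Type u} [CommRing k] {X : Scheme.{u}} (f : X ⟶ Spec (.of k))

/-- Restriction of functions, as a homomorphism of algebras. -/
def resAlg {U V : X.Opens} (h : V ≤ U) : Sec f U →ₐ[k] Sec f V :=
  { res f h with commutes' := algebraMap_sec f h }

variable {f}

/-- Restriction between affine opens is the map on sections induced by the identity morphism of X,
which is étale. -/
theorem res_etale {U V : X.Opens} (hU : IsAffineOpen U) (hV : IsAffineOpen V) (h : V ≤ U) :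
    (res f h).Etale := by
  have := HasRingHomProperty.appLE @Etale (𝟙 X) inferInstance ⟨U, hU⟩ ⟨V, hV⟩ h
  have e : (𝟙 X : X ⟶ X).appLE U V h = X.presheaf.map (homOfLE h).op := by
    change (𝟙 X : X ⟶ X).app U ≫ X.presheaf.map (homOfLE h).op = _
    rw [Scheme.Hom.id_app]
    exact Category.id_comp _
  rw [e] at this
  exact this

theorem isCoord_res {U V : X.Opens} (hU : IsAffineOpen U) (hV : IsAffineOpen V) (h : V ≤ U) {m : ℕ}
    {z : Fin m → Sec f U} (hz : IsCoord k z) : IsCoord k fun i => resAlg f h (z i) := by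
  have : (MvPolynomial.aeval fun i => resAlg f h (z i) : MvPolynomial (Fin m) k →ₐ[k] _).toRingHom =
      (res f h).comp (MvPolynomial.aeval z : MvPolynomial (Fin m) k →ₐ[k] _).toRingHom := by
    rw [← MvPolynomial.comp_aeval]
    rfl
  rw [IsCoord, this]
  exact RingHom.Etale.stableUnderComposition _ _ hz (res_etale hU hV h)

theorem IsChart.of_le {U V : X.Opens} (hU : IsChart f U) (hV : IsAffineOpen V) (h : V ≤ U) :
    IsChart f V := by
  obtain ⟨hU, m, z, hz⟩ := hU
  exact ⟨hV, m, _, isCoord_res hU hV h hz⟩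

theorem isAwayMap_res {U : X.Opens} (hU : IsAffineOpen U) (g : Γ(X, U)) :
    IsAwayMap (B := Sec f U) (res f (X.basicOpen_le g)) g := by
  have := hU.isLocalization_basicOpen g
  refine ⟨?_, fun b => ?_, fun b hb => ?_⟩
  · exact IsLocalization.Away.algebraMap_isUnit (S := Γ(X, X.basicOpen g)) g
  · obtain ⟨⟨a, ⟨_, N, rfl⟩⟩, h⟩ := IsLocalization.surj (Submonoid.powers g) (S := Γ(X, X.basicOpen g)) b
    refine ⟨N, a, ?_⟩
    rw [map_pow] at h
    exact h
  · obtain ⟨⟨_, N, rfl⟩, h⟩ := (IsLocalization.map_eq_zero_iff (Submonoid.powers g)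
      Γ(X, X.basicOpen g) b).mp hb
    exact ⟨N, h⟩

theorem span_eq_top_of_basicOpen {U : X.Opens} (hU : IsAffineOpen U) {ι : Type*} (g : ι → Sec f U)
    (hg : ∀ x ∈ U, ∃ i, x ∈ X.basicOpen (show Γ(X, U) from g i)) :
    Ideal.span (Set.range g) = ⊤ := by
  refine (hU.iSup_basicOpen_eq_self_iff (s := Set.range g)).mp (le_antisymm ?_ ?_)
  · exact iSup_le fun i => X.basicOpen_le _
  · intro x hx
    obtain ⟨i, hi⟩ := hg x hx
    exact Opens.mem_iSup.mpr ⟨⟨g i, i, rfl⟩, hi⟩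

end

variable {k : Type u} [Field k] {X : Scheme.{u}} (f : X ⟶ Spec (.of k)) [Smooth f]

/-- A smooth morphism is locally standard smooth, hence étale over a polynomial ring over the
sections of the base. -/
theorem exists_isChart (x : X) : ∃ U : X.Opens, x ∈ U ∧ IsChart f U := by
  obtain ⟨U, hU, V, hV, hx, e, hs⟩ := Smooth.exists_isStandardSmooth f x
  -- Spec k has only one point, so the open of the base is everything.
  obtain rfl : U = ⊤ := by
    rw [eq_top_iff]
    intro y _
    rw [Subsingleton.elim y (f x)]
    exact e hx
  obtain ⟨m, g, hg, hge⟩ := hs.exists_etale_mvPolynomial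
  let ε : k →+* Γ(Spec (.of k), ⊤) := (Scheme.ΓSpecIso (.of k)).inv.hom
  have hε : Function.Bijective ε :=
    ConcreteCategory.bijective_of_isIso (Scheme.ΓSpecIso (.of k)).inv
  let g' : MvPolynomial (Fin m) Γ(Spec (.of k), ⊤) →+* Sec f V := g
  let z : Fin m → Sec f V := fun i => g' (MvPolynomial.X i)
  refine ⟨V, hx, hV, m, z, ?_⟩
  have heq : (MvPolynomial.aeval z : MvPolynomial (Fin m) k →ₐ[k] Sec f V).toRingHom =
      g'.comp (MvPolynomial.map ε) := by
    refine MvPolynomial.ringHom_ext (fun c => ?_) fun i => ?_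
    · have : g' (MvPolynomial.C (ε c)) = (f.appLE ⊤ V e).hom (ε c) := DFunLike.congr_fun hg (ε c)
      rw [RingHom.comp_apply, MvPolynomial.map_C, this]
      exact MvPolynomial.aeval_C z c
    · rw [RingHom.comp_apply, MvPolynomial.map_X]
      exact MvPolynomial.aeval_X z i
  rw [IsCoord, heq]
  exact RingHom.Etale.stableUnderComposition _ _ (RingHom.Etale.of_bijective
    ⟨MvPolynomial.map_injective _ hε.1, MvPolynomial.map_surjective _ hε.2⟩) hge

theorem exists_isChart_le {V : X.Opens} {x : X} (hx : x ∈ V) :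
    ∃ U : X.Opens, x ∈ U ∧ U ≤ V ∧ IsChart f U := by
  obtain ⟨U, hxU, hU⟩ := exists_isChart f x
  obtain ⟨g, hg, hxg⟩ := hU.1.exists_basicOpen_le ⟨x, hx⟩ hxU
  exact ⟨X.basicOpen g, hxg, hg, hU.of_le (hU.1.basicOpen g) (X.basicOpen_le g)⟩

theorem isBasis_isChart : Opens.IsBasis {U : X.Opens | IsChart f U} := by
  rw [Opens.isBasis_iff_nbhd]
  intro V x hx
  obtain ⟨U, hxU, hUV, hU⟩ := exists_isChart_le f hx
  exact ⟨U, hU, hxU, hUV⟩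

end Charts
end WittDiff
end

noncomputable section
namespace WittDiff

/-! ### Restriction from a chart to a basic open subset -/

section Localization

open CategoryTheory Opposite TopologicalSpace AlgebraicGeometry

variable {p n : ℕ} [Fact p.Prime] {k : Type u} [Field k]
  {X : Scheme.{u}} {f : X ⟶ Spec (.of k)} {U V : X.Opens}

theorem IsChart.isAffineOpen (hU : IsChart f U) : IsAffineOpen U := hU.1

variable (p n f) in
/-- The Teichmüller representative of a function on `U`. -/
def wteich (g : Γ(X, U)) : W p n (Sec f U) := teich (show Sec f U from g)

theorem wres_wteich (h : V ≤ U) (g : Γ(X, U)) :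
    wres p n f h (wteich p n f g) = teich (res f h g) :=
  wittMap_teich _ _

theorem IsChart.isReduced (hU : IsChart f U) : IsReduced (Sec f U) :=
  let ⟨_, _, _, hz⟩ := hU
  isReduced_of_isCoord hz

theorem isUnit_wres_teich (hU : IsAffineOpen U) (g : Γ(X, U)) :
    IsUnit (wres p n f (X.basicOpen_le g) (wteich p n f g)) := by
  rw [wres_wteich]
  exact isUnit_teich (isAwayMap_res (f := f) hU g).isUnit

variable [CharP k p] [PerfectRing k p]

theorem IsChart.exists_mem_restrict (hU : IsChart f U) (hV : IsAffineOpen V) (h : V ≤ U)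
    {θ : Module.End (W p n k) (W p n (Sec f U))} (hθ : θ ∈ wittDiff p n k (Sec f U)) :
    ∃ θ' ∈ wittDiff p n k (Sec f V), ∀ x, θ' (wres p n f h x) = wres p n f h (θ x) := by
  obtain ⟨hU, m, z, hz⟩ := hU
  exact exists_mem_wittDiff_restrict hz (resAlg f h) (isCoord_res hU hV h hz) hθ

theorem IsChart.eq_of_restrict_eq (hU : IsChart f U) (hV : IsAffineOpen V) (h : V ≤ U)
    {θ θ' : Module.End (W p n k) (W p n (Sec f V))} (hθ : θ ∈ wittDiff p n k (Sec f V))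
    (hθ' : θ' ∈ wittDiff p n k (Sec f V))
    (heq : ∀ x, θ (wres p n f h x) = θ' (wres p n f h x)) : θ = θ' := by
  obtain ⟨hU, m, z, hz⟩ := hU
  exact WittDiff.eq_of_restrict_eq (resAlg f h) (isCoord_res hU hV h hz) hθ hθ' heq

theorem IsChart.exists_mem_of_basicOpen (hU : IsChart f U) (g : Γ(X, U))
    {θ' : Module.End (W p n k) (W p n (Sec f (X.basicOpen g)))}
    (hθ' : θ' ∈ wittDiff p n k (Sec f (X.basicOpen g))) :
    ∃ N : ℕ, ∃ θ ∈ wittDiff p n k (Sec f U), ∀ x,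
      wres p n f (X.basicOpen_le g) (wteich p n f g) ^ N *
        θ' (wres p n f (X.basicOpen_le g) x) = wres p n f (X.basicOpen_le g) (θ x) := by
  obtain ⟨hU, m, z, hz⟩ := hU
  obtain ⟨N, θ, hθ, h⟩ := exists_mem_wittDiff_of_away (B := Sec f U) (g := g) hz
    (isCoord_res hU (hU.basicOpen g) (X.basicOpen_le g) hz)
    (isAwayMap_res hU g) hθ'
  refine ⟨N, θ, hθ, fun x => ?_⟩
  rw [wres_wteich]
  exact h x

/-- Local membership in `𝒟_{W_{n+1}}(U)`. -/
theorem IsChart.mem_of_local (hU : IsChart f U) {θ : Module.End (W p n k) (W p n (Sec f U))}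
    (hθ : ∀ x ∈ U, ∃ g : Γ(X, U), x ∈ X.basicOpen g ∧
      ∃ θ' ∈ wittDiff p n k (Sec f (X.basicOpen g)), ∀ y,
        θ' (wres p n f (X.basicOpen_le g) y) = wres p n f (X.basicOpen_le g) (θ y)) :
    θ ∈ wittDiff p n k (Sec f U) := by
  obtain ⟨hU, m, z, hz⟩ := hU
  choose g hg θ' hθ' h using fun x : U => hθ x x.2
  exact mem_wittDiff_of_local hz (fun x => (g x : Sec f U))
    (span_eq_top_of_basicOpen hU _ fun x hx => ⟨⟨x, hx⟩, hg ⟨x, hx⟩⟩)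
    (fun x => Sec f (X.basicOpen (g x))) (fun x => resAlg f (X.basicOpen_le (g x)))
    (fun x => isAwayMap_res hU (g x))
    (fun x => isCoord_res hU (hU.basicOpen (g x)) (X.basicOpen_le (g x)) hz)
    fun x => ⟨θ' x, hθ' x, h x⟩

variable (p n) in
/-- Restriction of Witt differential operators from a local chart. -/
def wittRestrict (hU : IsChart f U) (hV : IsAffineOpen V) (h : V ≤ U) :
    wittDiff p n k (Sec f U) →ₛₗ[wres p n f h] wittDiff p n k (Sec f V) :=
  have key : ∀ θ : wittDiff p n k (Sec f U), ∃ θ' : wittDiff p n k (Sec f V),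
      ∀ x, θ'.1 (wres p n f h x) = wres p n f h (θ.1 x) := fun θ =>
    let ⟨θ', hθ', h'⟩ := hU.exists_mem_restrict hV h θ.2
    ⟨⟨θ', hθ'⟩, h'⟩
  { toFun := fun θ => (key θ).choose
    map_add' := fun θ η => Subtype.ext <| hU.eq_of_restrict_eq hV h (Subtype.mem _)
      (Subtype.mem _) fun x => by
        rw [(key _).choose_spec]
        change wres p n f h (θ.1 x + η.1 x) = (key θ).choose.1 _ + (key η).choose.1 _
        rw [(key _).choose_spec, (key _).choose_spec, map_add]
    map_smul' := fun b θ => Subtype.ext <| hU.eq_of_restrict_eq hV h (Subtype.mem _)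
      (Subtype.mem _) fun x => by
        rw [(key _).choose_spec]
        change wres p n f h (b * θ.1 x) = wres p n f h b * (key θ).choose.1 _
        rw [(key _).choose_spec, map_mul] }

theorem wittRestrict_apply (hU : IsChart f U) (hV : IsAffineOpen V) (h : V ≤ U)
    (θ : wittDiff p n k (Sec f U)) (x : W p n (Sec f U)) :
    (wittRestrict p n hU hV h θ).1 (wres p n f h x) = wres p n f h (θ.1 x) :=
  have key : ∃ θ' : wittDiff p n k (Sec f V),
      ∀ x, θ'.1 (wres p n f h x) = wres p n f h (θ.1 x) :=
    let ⟨θ', hθ', h'⟩ := hU.exists_mem_restrict hV h θ.2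
    ⟨⟨θ', hθ'⟩, h'⟩
  key.choose_spec x

theorem wittRestrict_eq_iff (hU : IsChart f U) (hV : IsAffineOpen V) (h : V ≤ U)
    (θ : wittDiff p n k (Sec f U)) (θ' : wittDiff p n k (Sec f V)) :
    wittRestrict p n hU hV h θ = θ' ↔ ∀ x, θ'.1 (wres p n f h x) = wres p n f h (θ.1 x) :=
  ⟨fun e x => e ▸ wittRestrict_apply hU hV h θ x, fun e => Subtype.ext <|
    hU.eq_of_restrict_eq hV h (Subtype.mem _) (Subtype.mem _) fun x => by
      rw [wittRestrict_apply, e]⟩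

theorem wteich_smul_eq (hU : IsChart f U) (g : Γ(X, U)) {θ θ' : wittDiff p n k (Sec f U)}
    (hθ : wittRestrict p n hU (hU.isAffineOpen.basicOpen g) (X.basicOpen_le g) θ =
      wittRestrict p n hU (hU.isAffineOpen.basicOpen g) (X.basicOpen_le g) θ') :
    wteich p n f g • θ = wteich p n f g • θ' := by
  have := hU.isReduced
  refine Subtype.ext (LinearMap.ext fun x => ?_)
  have h := (wittRestrict_eq_iff hU _ _ θ _).mp hθ x
  rw [wittRestrict_apply] at h
  have := (isAwayMap_res hU.isAffineOpen g).teich_mul_eq_zero (x := θ.1 x - θ'.1 x) (by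
    change wres p n f _ _ = 0
    rw [map_sub, h, sub_self])
  rw [mul_sub, sub_eq_zero] at this
  exact this

theorem exists_wittRestrict_eq (hU : IsChart f U) (g : Γ(X, U))
    (θ' : wittDiff p n k (Sec f (X.basicOpen g))) :
    ∃ (N : ℕ) (θ : wittDiff p n k (Sec f U)),
      wittRestrict p n hU (hU.isAffineOpen.basicOpen g) (X.basicOpen_le g) θ =
        wres p n f (X.basicOpen_le g) (wteich p n f g) ^ N • θ' := by
  obtain ⟨N, θ, hθ, h⟩ := hU.exists_mem_of_basicOpen g θ'.2
  refine ⟨N, ⟨θ, hθ⟩, ?_⟩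
  rw [wittRestrict_eq_iff]
  exact h

/-- On Witt vectors and on operators alike, restriction is localization at the powers of [g]:
denominators are cleared by such powers, and a single [g] kills the kernel. -/
theorem isBaseChangeAlong_wittRestrict (hU : IsChart f U) (g : Γ(X, U)) :
    IsBaseChangeAlong (wittRestrict p n hU (hU.isAffineOpen.basicOpen g) (X.basicOpen_le g)) := by
  have := hU.isReduced
  let σ := wres p n f (X.basicOpen_le g)
  let G : W p n (Sec f U) := wteich p n f g
  let _ : Algebra (W p n (Sec f U)) (W p n (Sec f (X.basicOpen g))) := σ.toAlgebra
  let _ : Module (W p n (Sec f U)) (wittDiff p n k (Sec f (X.basicOpen g))) :=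
    Module.compHom _ σ
  have : IsScalarTower (W p n (Sec f U)) (W p n (Sec f (X.basicOpen g)))
      (wittDiff p n k (Sec f (X.basicOpen g))) := ⟨fun r s x => mul_smul (σ r) s x⟩
  have hG : IsUnit (σ G) := isUnit_wres_teich hU.isAffineOpen g
  have hloc : IsLocalization (Submonoid.powers G) (W p n (Sec f (X.basicOpen g))) := by
    refine ⟨⟨?_, ?_, ?_⟩⟩
    · rintro ⟨_, N, rfl⟩
      change IsUnit (σ (G ^ N))
      rw [map_pow]
      exact hG.pow N
    · intro x'
      obtain ⟨N, x, hx⟩ := (isAwayMap_res (f := f) hU.isAffineOpen g).wittMap_surj x'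
      refine ⟨⟨x, ⟨_, N, rfl⟩⟩, ?_⟩
      change x' * σ (G ^ N) = σ x
      rw [map_pow, show σ G = _ from wittMap_teich _ _]
      exact hx
    · intro x y hxy
      refine ⟨⟨_, 1, rfl⟩, ?_⟩
      have hxy : σ x = σ y := hxy
      have := (isAwayMap_res (f := f) hU.isAffineOpen g).teich_mul_eq_zero (x := x - y) (by
        change σ (x - y) = 0
        rw [map_sub, hxy, sub_self])
      rw [mul_sub, sub_eq_zero] at this
      change G ^ 1 * x = G ^ 1 * y
      rw [pow_one]
      exact this
  refine (isLocalizedModule_iff_isBaseChange (Submonoid.powers G) _ _).mp ⟨?_, ?_, ?_⟩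
  · rintro ⟨_, N, rfl⟩
    rw [Module.End.isUnit_iff]
    obtain ⟨v, hv⟩ := (hG.pow N)
    have hs : ∀ θ : wittDiff p n k (Sec f (X.basicOpen g)),
        algebraMap (W p n (Sec f U)) (Module.End (W p n (Sec f U))
          (wittDiff p n k (Sec f (X.basicOpen g)))) (G ^ N) θ = v • θ := by
      intro θ
      change σ (G ^ N) • θ = (v : W p n (Sec f (X.basicOpen g))) • θ
      rw [hv, map_pow]
    refine ⟨fun a b hab => ?_, fun b => ⟨v⁻¹ • b, ?_⟩⟩
    · simp only at hab
      rw [hs, hs] at hab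
      exact smul_left_cancel v hab
    · simp only
      rw [hs, smul_inv_smul]
  · intro θ'
    obtain ⟨N, θ, h⟩ := exists_wittRestrict_eq hU g θ'
    refine ⟨⟨θ, ⟨_, N, rfl⟩⟩, ?_⟩
    change σ (G ^ N) • θ' = _
    rw [map_pow]
    exact h.symm
  · intro θ θ' h
    refine ⟨⟨_, 1, rfl⟩, ?_⟩
    have h : wittRestrict p n hU (hU.isAffineOpen.basicOpen g) (X.basicOpen_le g) θ =
      wittRestrict p n hU (hU.isAffineOpen.basicOpen g) (X.basicOpen_le g) θ' := h
    change G ^ 1 • θ = G ^ 1 • θ'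
    rw [pow_one]
    exact wteich_smul_eq hU g h

end Localization
end WittDiff
end

noncomputable section
namespace WittDiff

/-! ### Gluing functions, Witt vectors and operators -/

section Gluing

open CategoryTheory Opposite TopologicalSpace AlgebraicGeometry

variable {p n : ℕ} [Fact p.Prime] {k : Type u} [Field k]
  {X : Scheme.{u}} {f : X ⟶ Spec (.of k)} {V : X.Opens}

theorem wres_smul {U : X.Opens} (h : U ≤ V) (c : W p n k) (x : W p n (Sec f V)) :
    wres p n f h (c • x) = c • wres p n f h x := by
  rw [Algebra.smul_def, Algebra.smul_def, map_mul, wres_algebraMap]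

/-- The opens satisfying `P` are affine, stable under passage to smaller affine opens, and
cover `V`. -/
structure IsAffineBasis (V : X.Opens) (P : X.Opens → Prop) : Prop where
  le : ∀ {U}, P U → U ≤ V
  affine : ∀ {U}, P U → IsAffineOpen U
  down : ∀ {U U'}, P U → IsAffineOpen U' → U' ≤ U → P U'
  cover : ∀ x ∈ V, ∃ U, P U ∧ x ∈ U

theorem IsAffineBasis.exists_le {P : X.Opens → Prop} (hP : IsAffineBasis V P) {x : X} (hx : x ∈ V)
    {O : X.Opens} (hO : x ∈ O) : ∃ U, P U ∧ x ∈ U ∧ U ≤ O := by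
  obtain ⟨U, hU, hxU⟩ := hP.cover x hx
  obtain ⟨g, hg, hxg⟩ := (hP.affine hU).exists_basicOpen_le ⟨x, hO⟩ hxU
  exact ⟨X.basicOpen g, hP.down hU ((hP.affine hU).basicOpen g) (X.basicOpen_le g), hxg, hg⟩

theorem IsAffineBasis.inf {P : X.Opens → Prop} (hP : IsAffineBasis V P) {T : X.Opens} (hT : T ≤ V) :
    IsAffineBasis T fun U => P U ∧ U ≤ T where
  le h := h.2
  affine h := hP.affine h.1
  down h h' hle := ⟨hP.down h.1 h' hle, hle.trans h.2⟩
  cover x hx := by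
    obtain ⟨U, hU, hxU, hle⟩ := hP.exists_le (hT hx) hx
    exact ⟨U, ⟨hU, hle⟩, hxU⟩

theorem IsAffineBasis.le_iSup {P : X.Opens → Prop} (hP : IsAffineBasis V P) :
    V ≤ ⨆ U : {U // P U}, U.1 := fun x hx => by
  obtain ⟨U, hU, hxU⟩ := hP.cover x hx
  exact Opens.mem_iSup.mpr ⟨⟨U, hU⟩, hxU⟩

theorem IsAffineBasis.ext {P : X.Opens → Prop} (hP : IsAffineBasis V P) {y y' : Sec f V}
    (h : ∀ U (hU : P U), res f (hP.le hU) y = res f (hP.le hU) y') : y = y' :=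
  X.sheaf.eq_of_locally_eq' (fun U : {U // P U} => U.1) V (fun U => homOfLE (hP.le U.2))
    hP.le_iSup y y' fun U => h U.1 U.2

theorem IsAffineBasis.exists_glue {P : X.Opens → Prop} (hP : IsAffineBasis V P)
    (s : ∀ U, P U → Sec f U)
    (hs : ∀ U U' (hU : P U) (hU' : P U') (h : U' ≤ U), res f h (s U hU) = s U' hU') :
    ∃ y : Sec f V, ∀ U (hU : P U), res f (hP.le hU) y = s U hU := by
  obtain ⟨y, hy, -⟩ := X.sheaf.existsUnique_gluing' (fun U : {U // P U} => U.1) V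
    (fun U => homOfLE (hP.le U.2)) hP.le_iSup (fun U => s U.1 U.2) (by
      intro U U'
      refine (hP.inf (T := U.1 ⊓ U'.1) (inf_le_left.trans (hP.le U.2))).ext (f := f) fun T hT => ?_
      exact (res_res f _ _ _).trans ((hs _ _ U.2 hT.1 (hT.2.trans inf_le_left)).trans
        ((hs _ _ U'.2 hT.1 (hT.2.trans inf_le_right)).symm.trans (res_res f _ _ _).symm)))
  exact ⟨y, fun U hU => hy ⟨U, hU⟩⟩

theorem IsAffineBasis.wext {P : X.Opens → Prop} (hP : IsAffineBasis V P) {y y' : W p n (Sec f V)}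
    (h : ∀ U (hU : P U), wres p n f (hP.le hU) y = wres p n f (hP.le hU) y') : y = y' :=
  TruncatedWittVector.ext fun i => hP.ext fun U hU => by
    have := congrArg (TruncatedWittVector.coeff i) (h U hU)
    rwa [wres, coeff_wittMap, coeff_wittMap] at this

theorem IsAffineBasis.exists_wglue {P : X.Opens → Prop} (hP : IsAffineBasis V P)
    (s : ∀ U, P U → W p n (Sec f U))
    (hs : ∀ U U' (hU : P U) (hU' : P U') (h : U' ≤ U), wres p n f h (s U hU) = s U' hU') :
    ∃ y : W p n (Sec f V), ∀ U (hU : P U), wres p n f (hP.le hU) y = s U hU := by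
  choose y hy using fun i : Fin (n + 1) => hP.exists_glue (f := f) (fun U hU => (s U hU).coeff i)
    fun U U' hU hU' h => by rw [← hs U U' hU hU' h, wres, coeff_wittMap]
  refine ⟨TruncatedWittVector.mk p y, fun U hU => TruncatedWittVector.ext fun i => ?_⟩
  rw [wres, coeff_wittMap, TruncatedWittVector.coeff_mk, hy]

theorem isAffineBasis_isChart (f : X ⟶ Spec (.of k)) [Smooth f] (V : X.Opens) :
    IsAffineBasis V fun U => IsChart f U ∧ U ≤ V where
  le h := h.2
  affine h := h.1.1
  down h h' hle := ⟨h.1.of_le h' hle, hle.trans h.2⟩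
  cover x hx := by
    obtain ⟨U, hxU, hle, hU⟩ := exists_isChart_le f hx
    exact ⟨U, ⟨hU, hle⟩, hxU⟩

theorem isAffineBasis_isChart_iSup (f : X ⟶ Spec (.of k)) [Smooth f] {ι : Type*}
    (𝒰 : ι → X.Opens) : IsAffineBasis (⨆ i, 𝒰 i) fun U => IsChart f U ∧ ∃ i, U ≤ 𝒰 i where
  le := fun ⟨_, i, hi⟩ => hi.trans (le_iSup 𝒰 i)
  affine h := h.1.1
  down := fun ⟨h, i, hi⟩ h' hle => ⟨h.of_le h' hle, i, hle.trans hi⟩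
  cover x hx := by
    obtain ⟨i, hi⟩ := Opens.mem_iSup.mp hx
    obtain ⟨U, hxU, hle, hU⟩ := exists_isChart_le f hi
    exact ⟨U, ⟨hU, i, hle⟩, hxU⟩

section

variable {P : X.Opens → Prop}

theorem wittDiffSections_ext_of_basis (hP : IsAffineBasis V P) (hc : ∀ {U}, P U → IsChart f U)
    {θ θ' : wittDiffSections p n f V}
    (h : ∀ U (hU : P U), θ.1 ⟨U, hc hU, hP.le hU⟩ = θ'.1 ⟨U, hc hU, hP.le hU⟩) : θ = θ' := by
  refine Subtype.ext (funext fun T => LinearMap.ext fun x => ?_)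
  refine (hP.inf T.2.2).wext fun U hU => ?_
  rw [← (wittDiffSections_prop f θ).compat T ⟨U, hc hU.1, hP.le hU.1⟩ hU.2,
    ← (wittDiffSections_prop f θ').compat T ⟨U, hc hU.1, hP.le hU.1⟩ hU.2, h U hU.1]

/-- The open T need not belong to the basis: η x is glued from the values of the given operators on
the restrictions of x. -/
theorem exists_end_glue (hP : IsAffineBasis V P)
    (θ : ∀ U, P U → Module.End (W p n k) (W p n (Sec f U)))
    (hθ : ∀ U U' (hU : P U) (hU' : P U') (h : U' ≤ U) x,
      θ U' hU' (wres p n f h x) = wres p n f h (θ U hU x)) {T : X.Opens} (hT : T ≤ V) :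
    ∃ η : Module.End (W p n k) (W p n (Sec f T)), ∀ U (hU : P U) (h : U ≤ T) x,
      θ U hU (wres p n f h x) = wres p n f h (η x) := by
  have hB := hP.inf hT
  choose η hη using fun x : W p n (Sec f T) => hB.exists_wglue
    (fun U hU => θ U hU.1 (wres p n f hU.2 x)) fun U U' hU hU' h => by
      rw [← hθ U U' hU.1 hU'.1 h, wres_wres]
  refine ⟨{ toFun := η, map_add' := fun x y => ?_, map_smul' := fun c x => ?_ },
    fun U hU h x => (hη x U ⟨hU, h⟩).symm⟩
  · refine hB.wext fun U hU => ?_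
    rw [hη _ U hU, map_add, map_add, map_add, hη _ U hU, hη _ U hU]
  · refine hB.wext fun U hU => ?_
    rw [hη _ U hU, RingHom.id_apply, wres_smul, wres_smul, hη _ U hU, map_smul]

variable [CharP k p] [PerfectRing k p]

/-- Compatible families of Witt differential operators on the charts of a basis glue. -/
theorem exists_wittDiffSections_glue (hP : IsAffineBasis V P) (hc : ∀ {U}, P U → IsChart f U)
    (θ : ∀ U, P U → wittDiff p n k (Sec f U))
    (hθ : ∀ U U' (hU : P U) (hU' : P U') (h : U' ≤ U) x,
      (θ U' hU').1 (wres p n f h x) = wres p n f h ((θ U hU).1 x)) :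
    ∃ η : wittDiffSections p n f V, ∀ U (hU : P U),
      η.1 ⟨U, hc hU, hP.le hU⟩ = (θ U hU).1 := by
  choose η hη using fun T : {T : X.Opens // IsChart f T ∧ T ≤ V} =>
    exists_end_glue hP (fun U hU => (θ U hU).1) hθ T.2.2
  have hηθ : ∀ U (hU : P U), η ⟨U, hc hU, hP.le hU⟩ = (θ U hU).1 := fun U hU =>
    LinearMap.ext fun x => by
      have := hη ⟨U, hc hU, hP.le hU⟩ U hU le_rfl x
      rw [wres_self, wres_self] at this
      exact this.symm
  refine ⟨⟨η, fun T => T.2.1.mem_of_local fun x hx => ?_, fun T T' h x => ?_⟩, hηθ⟩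
  -- Around each point some basic open of T lies inside a member of the basis, so local membership
  -- can be tested there.
  · obtain ⟨U, hU, hxU⟩ := hP.cover x (T.2.2 hx)
    obtain ⟨g, hg, hxg⟩ := T.2.1.isAffineOpen.exists_basicOpen_le ⟨x, hxU⟩ hx
    have hPg : P (X.basicOpen g) := hP.down hU (T.2.1.isAffineOpen.basicOpen g) hg
    exact ⟨g, hxg, _, (θ _ hPg).2, hη T _ hPg (X.basicOpen_le g)⟩
  · refine (hP.inf T'.2.2).wext fun U hU => ?_
    rw [← hη T' U hU.1 hU.2, wres_wres, wres_wres, hη T U hU.1]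

end

end Gluing
end WittDiff
end

noncomputable section
namespace WittDiff

/-! ### The sheaf of Witt differential operators -/

section Sheaf

open CategoryTheory Opposite TopologicalSpace AlgebraicGeometry

variable {p n : ℕ} [Fact p.Prime] {k : Type u} [Field k] [CharP k p] [PerfectRing k p]
  {X : Scheme.{u}} {f : X ⟶ Spec (.of k)}

/-- An operator on a smaller affine open is determined by its values on restrictions from U.
Conversely, by this same uniqueness, the restrictions of one operator on U form a compatible family.
-/
theorem evalChart_bijective {U : X.Opens} (hU : IsChart f U) :
    Function.Bijective (evalChart p n f hU) := by
  constructor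
  · intro θ θ' h
    have h : θ.1 ⟨U, hU, le_rfl⟩ = θ'.1 ⟨U, hU, le_rfl⟩ := congrArg Subtype.val h
    refine Subtype.ext (funext fun T => ?_)
    refine hU.eq_of_restrict_eq T.2.1.isAffineOpen T.2.2 ((wittDiffSections_prop f θ).mem T)
      ((wittDiffSections_prop f θ').mem T) fun x => ?_
    rw [(wittDiffSections_prop f θ).compat ⟨U, hU, le_rfl⟩ T T.2.2,
      (wittDiffSections_prop f θ').compat ⟨U, hU, le_rfl⟩ T T.2.2, h]
  · intro θ
    have hself : wittRestrict p n hU hU.isAffineOpen le_rfl θ = θ := by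
      rw [wittRestrict_eq_iff]
      intro x
      rw [wres_self, wres_self]
    refine ⟨⟨fun T => (wittRestrict p n hU T.2.1.isAffineOpen T.2.2 θ).1, fun T => Subtype.mem _,
      fun T T' h x => ?_⟩, hself⟩
    obtain ⟨θ', hθ', h'⟩ := T.2.1.exists_mem_restrict T'.2.1.isAffineOpen h
      (wittRestrict p n hU T.2.1.isAffineOpen T.2.2 θ).2
    have : wittRestrict p n hU T'.2.1.isAffineOpen T'.2.2 θ = ⟨θ', hθ'⟩ := by
      rw [wittRestrict_eq_iff]
      intro y
      rw [← wres_wres f T.2.2 h, ← wres_wres f T.2.2 h]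
      change θ' _ = _
      rw [h', wittRestrict_apply]
    rw [this]
    exact h' x

variable [Smooth f]

/-- The charts contained in some member of the cover form a basis of the union. On each one the
value is taken from a chosen member, and agreement on overlaps makes the choice immaterial. -/
theorem existsUnique_resSections_eq {ι : Type*} (U : ι → X.Opens)
    (s : ∀ i, wittDiffSections p n f (U i))
    (hs : ∀ i j, resSections p n f (inf_le_left : U i ⊓ U j ≤ U i) (s i) =
      resSections p n f (inf_le_right : U i ⊓ U j ≤ U j) (s j)) :
    ∃! η : wittDiffSections p n f (iSup U), ∀ i, resSections p n f (le_iSup U i) η = s i := by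
  have hs' : ∀ i j T (hT : IsChart f T) (hi : T ≤ U i) (hj : T ≤ U j),
      (s i).1 ⟨T, hT, hi⟩ = (s j).1 ⟨T, hT, hj⟩ := fun i j T hT hi hj =>
    congrFun (congrArg Subtype.val (hs i j)) ⟨T, hT, le_inf hi hj⟩
  have hB := isAffineBasis_isChart_iSup f U
  choose c hc using fun (T : {T : X.Opens // IsChart f T ∧ ∃ i, T ≤ U i}) => T.2.2
  obtain ⟨η, hη⟩ := exists_wittDiffSections_glue (p := p) (n := n) (f := f) hB (fun h => h.1)
    (fun T hT => ⟨(s (c ⟨T, hT⟩)).1 ⟨T, hT.1, hc ⟨T, hT⟩⟩,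
      (wittDiffSections_prop f (s (c ⟨T, hT⟩))).mem ⟨T, hT.1, hc ⟨T, hT⟩⟩⟩)
    fun T T' hT hT' h x => (DFunLike.congr_fun (hs' (c ⟨T', hT'⟩) (c ⟨T, hT⟩) T' hT'.1
      (hc ⟨T', hT'⟩) (h.trans (hc ⟨T, hT⟩))) (wres p n f h x)).trans
        ((wittDiffSections_prop f (s (c ⟨T, hT⟩))).compat ⟨T, hT.1, hc ⟨T, hT⟩⟩
          ⟨T', hT'.1, h.trans (hc ⟨T, hT⟩)⟩ h x)
  refine ⟨η, fun i => Subtype.ext (funext fun T => ?_), fun η' hη' => ?_⟩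
  · exact (hη T.1 ⟨T.2.1, i, T.2.2⟩).trans 
      (hs' _ i T.1 T.2.1 (hc ⟨T.1, T.2.1, i, T.2.2⟩) T.2.2)
  · refine wittDiffSections_ext_of_basis hB (fun h => h.1) fun T hT => ?_
    rw [hη T hT]
    exact congrFun (congrArg Subtype.val (hη' (c ⟨T, hT⟩))) ⟨T, hT.1, hc ⟨T, hT⟩⟩

variable (p n f) in
theorem wittDiffPresheaf_isSheaf :
    Presheaf.IsSheaf (Opens.grothendieckTopology X) (wittDiffPresheaf p n f).presheaf := by
  change TopCat.Presheaf.IsSheaf (X := X.carrier) (wittDiffPresheaf p n f).presheaf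
  rw [TopCat.Presheaf.isSheaf_iff_isSheafUniqueGluing]
  intro ι U sf hsf
  exact existsUnique_resSections_eq (p := p) (n := n) (f := f) U sf hsf

variable (p n f) in
/-- The sheaf `𝒟_{W_{n+1}(X)}` of `W_{n+1}𝒪_X`-modules. -/
def wittDiffSheaf : SheafOfModules.{u} (wittSheaf p n X) :=
  ⟨wittDiffPresheaf p n f, wittDiffPresheaf_isSheaf p n f⟩

/-! ### Uniqueness of the sheaf with prescribed sections on charts -/

section Uniqueness

variable {G : SheafOfModules.{u} (wittSheaf p n X)} {ι : Type u} {𝒰 : ι → X.Opens}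

/-- Restriction of the sections of a sheaf of modules. -/
def secRes (G : SheafOfModules.{u} (wittSheaf p n X)) {V V' : X.Opens} (h : V' ≤ V)
    (s : G.val.obj (op V)) : G.val.obj (op V') :=
  (G.val.map (homOfLE h).op).hom s

theorem secRes_secRes {V V' V'' : X.Opens} (h : V' ≤ V) (h' : V'' ≤ V')
    (s : G.val.obj (op V)) : secRes G h' (secRes G h s) = secRes G (h'.trans h) s :=
  (G.val.map_comp_apply (homOfLE h).op (homOfLE h').op s).symm

theorem secRes_self {V : X.Opens} (h : V ≤ V) (s : G.val.obj (op V)) : secRes G h s = s :=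
  DFunLike.congr_fun (congrArg ModuleCat.Hom.hom (G.val.map_id (op V))) s

theorem secRes_add {V V' : X.Opens} (h : V' ≤ V) (s t : G.val.obj (op V)) :
    secRes G h (s + t) = secRes G h s + secRes G h t :=
  map_add (G.val.map (homOfLE h).op).hom s t

theorem secRes_smul {V V' : X.Opens} (h : V' ≤ V) (b : (wittSheaf p n X).obj.obj (op V))
    (s : G.val.obj (op V)) :
    secRes G h (b • s) = ((wittSheaf p n X).obj.map (homOfLE h).op).hom b • secRes G h s :=
  G.val.map_smul (homOfLE h).op b s

theorem secRes_ext {V : X.Opens} {P : X.Opens → Prop} (hP : IsAffineBasis V P)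
    {s t : G.val.obj (op V)} (h : ∀ U (hU : P U), secRes G (hP.le hU) s = secRes G (hP.le hU) t) :
    s = t :=
  TopCat.Sheaf.eq_of_locally_eq' (X := X.carrier) ⟨G.val.presheaf, G.isSheaf⟩
    (fun U : {U // P U} => U.1) V (fun U => homOfLE (hP.le U.2))
    hP.le_iSup s t fun U => h U.1 U.2

theorem exists_secRes_glue {V : X.Opens} {P : X.Opens → Prop} (hP : IsAffineBasis V P)
    (s : ∀ U, P U → G.val.obj (op U))
    (hs : ∀ U U' (hU : P U) (hU' : P U') (h : U' ≤ U), secRes G h (s U hU) = s U' hU') :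
    ∃ t : G.val.obj (op V), ∀ U (hU : P U), secRes G (hP.le hU) t = s U hU := by
  obtain ⟨y, hy, -⟩ := TopCat.Sheaf.existsUnique_gluing' (X := X.carrier)
    ⟨G.val.presheaf, G.isSheaf⟩ (fun U : {U // P U} => U.1) V
    (fun U => homOfLE (hP.le U.2)) hP.le_iSup (fun U => s U.1 U.2) (by
      intro U U'
      refine secRes_ext (hP.inf (T := U.1 ⊓ U'.1) (inf_le_left.trans (hP.le U.2))) fun T hT => ?_
      exact (secRes_secRes _ _ _).trans ((hs _ _ U.2 hT.1 (hT.2.trans inf_le_left)).trans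
        ((hs _ _ U'.2 hT.1 (hT.2.trans inf_le_right)).symm.trans (secRes_secRes _ _ _).symm)))
  exact ⟨y, fun U hU => hy ⟨U, hU⟩⟩

theorem isAffineBasis_of_cover (f : X ⟶ Spec (.of k)) [Smooth f] (h𝒰 : ⨆ i, 𝒰 i = ⊤)
    (V : X.Opens) :
    IsAffineBasis V fun U => (IsChart f U ∧ ∃ i, U ≤ 𝒰 i) ∧ U ≤ V :=
  (isAffineBasis_isChart_iSup f 𝒰).inf (h𝒰 ▸ le_top)

theorem exists_chartIdent_glue (E : ChartIdent f G 𝒰) (h𝒰 : ⨆ i, 𝒰 i = ⊤) {V : X.Opens}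
    (s : G.val.obj (op V)) : ∃ η : wittDiffSections p n f V,
      ∀ U (hU : IsChart f U ∧ ∃ i, U ≤ 𝒰 i) (h : U ≤ V),
        η.1 ⟨U, hU.1, h⟩ = (E.iso ⟨U, hU⟩ (secRes G h s)).1 := by
  obtain ⟨η, hη⟩ := exists_wittDiffSections_glue (isAffineBasis_of_cover f h𝒰 V) (fun h => h.1.1)
    (fun U hU => E.iso ⟨U, hU.1⟩ (secRes G hU.2 s)) fun U U' hU hU' h x => by
      rw [← E.compat ⟨U, hU.1⟩ ⟨U', hU'.1⟩ h]
      exact congrArg (fun t => (E.iso ⟨U', hU'.1⟩ t).1 (wres p n f h x))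
        (secRes_secRes hU.2 h s).symm
  exact ⟨η, fun U hU h => hη U ⟨hU, h⟩⟩

/-- The map `G(V) → 𝒟(V)` glued from the given identifications on charts. -/
def chartIdentMap (E : ChartIdent f G 𝒰) (h𝒰 : ⨆ i, 𝒰 i = ⊤) (V : X.Opens)
    (s : G.val.obj (op V)) : wittDiffSections p n f V :=
  (exists_chartIdent_glue E h𝒰 s).choose

theorem chartIdentMap_apply (E : ChartIdent f G 𝒰) (h𝒰 : ⨆ i, 𝒰 i = ⊤) {V : X.Opens}
    (s : G.val.obj (op V)) {U : X.Opens} (hU : IsChart f U ∧ ∃ i, U ≤ 𝒰 i) (h : U ≤ V) :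
    (chartIdentMap E h𝒰 V s).1 ⟨U, hU.1, h⟩ = (E.iso ⟨U, hU⟩ (secRes G h s)).1 :=
  (exists_chartIdent_glue E h𝒰 s).choose_spec U hU h

theorem chartIdentMap_bijective (E : ChartIdent f G 𝒰) (h𝒰 : ⨆ i, 𝒰 i = ⊤) (V : X.Opens) :
    Function.Bijective (chartIdentMap E h𝒰 V) := by
  have hB := isAffineBasis_of_cover f h𝒰 V
  constructor
  · intro s t hst
    refine secRes_ext hB fun U hU => (E.iso ⟨U, hU.1⟩).injective (Subtype.ext ?_)
    rw [← chartIdentMap_apply E h𝒰, ← chartIdentMap_apply E h𝒰, hst]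
  · intro η
    let η' : ∀ U (_ : (IsChart f U ∧ ∃ i, U ≤ 𝒰 i) ∧ U ≤ V), wittDiff p n k (Sec f U) :=
      fun U hU => ⟨η.1 ⟨U, hU.1.1, hU.2⟩, (wittDiffSections_prop f η).mem ⟨U, hU.1.1, hU.2⟩⟩
    obtain ⟨t, ht⟩ := exists_secRes_glue (G := G) hB
      (fun U hU => (E.iso ⟨U, hU.1⟩).symm (η' U hU)) fun U U' hU hU' h => by
        refine (E.iso ⟨U', hU'.1⟩).injective (Subtype.ext ?_)
        rw [LinearEquiv.apply_symm_apply]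
        refine hU.1.1.eq_of_restrict_eq hU'.1.1.isAffineOpen h (Subtype.mem _) (Subtype.mem _)
          fun x => (E.compat ⟨U, hU.1⟩ ⟨U', hU'.1⟩ h _ x).trans ?_
        rw [LinearEquiv.apply_symm_apply]
        exact ((wittDiffSections_prop f η).compat ⟨U, hU.1.1, hU.2⟩ ⟨U', hU'.1.1, hU'.2⟩ h x).symm
    refine ⟨t, wittDiffSections_ext_of_basis hB (fun h => h.1.1) fun U hU => ?_⟩
    rw [chartIdentMap_apply E h𝒰 t hU.1 hU.2, ht U hU, LinearEquiv.apply_symm_apply]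

theorem chartIdentMap_add (E : ChartIdent f G 𝒰) (h𝒰 : ⨆ i, 𝒰 i = ⊤) {V : X.Opens}
    (s t : G.val.obj (op V)) : chartIdentMap E h𝒰 V (s + t) =
      chartIdentMap E h𝒰 V s + chartIdentMap E h𝒰 V t := by
  refine wittDiffSections_ext_of_basis (isAffineBasis_of_cover f h𝒰 V)
    (fun h => h.1.1) fun U hU => ?_
  change _ = (chartIdentMap E h𝒰 V s).1 _ + (chartIdentMap E h𝒰 V t).1 _
  rw [chartIdentMap_apply E h𝒰 _ hU.1 hU.2, chartIdentMap_apply E h𝒰 _ hU.1 hU.2,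
    chartIdentMap_apply E h𝒰 _ hU.1 hU.2, secRes_add, map_add]
  rfl

theorem chartIdentMap_smul (E : ChartIdent f G 𝒰) (h𝒰 : ⨆ i, 𝒰 i = ⊤) {V : X.Opens}
    (b : (wittSheaf p n X).obj.obj (op V)) (s : G.val.obj (op V)) :
    chartIdentMap E h𝒰 V (b • s) =
      (show W p n (Sec f V) from b) • chartIdentMap E h𝒰 V s := by
  refine wittDiffSections_ext_of_basis (isAffineBasis_of_cover f h𝒰 V)
    (fun h => h.1.1) fun U hU => ?_
  change _ = Algebra.lmul (W p n k) (W p n (Sec f U)) (wres p n f hU.2 b) *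
    (chartIdentMap E h𝒰 V s).1 ⟨U, hU.1.1, hU.2⟩
  rw [chartIdentMap_apply E h𝒰 _ hU.1 hU.2, chartIdentMap_apply E h𝒰 _ hU.1 hU.2,
    secRes_smul, map_smul]
  rfl

/-- `G(V) ≃ 𝒟(V)` as a linear equivalence. -/
def chartIdentEquiv (E : ChartIdent f G 𝒰) (h𝒰 : ⨆ i, 𝒰 i = ⊤) (V : X.Opensᵒᵖ) :
    G.val.obj V ≃ₗ[(wittSheaf p n X).obj.obj V] wittDiffSections p n f V.unop :=
  LinearEquiv.ofBijective
    { toFun := chartIdentMap E h𝒰 V.unop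
      map_add' := chartIdentMap_add E h𝒰
      map_smul' := chartIdentMap_smul E h𝒰 }
    (chartIdentMap_bijective E h𝒰 V.unop)

/-- The isomorphism `G ≅ 𝒟` glued from the given identifications on charts. -/
def chartIdentIso (E : ChartIdent f G 𝒰) (h𝒰 : ⨆ i, 𝒰 i = ⊤) : G ≅ wittDiffSheaf p n f :=
  (SheafOfModules.fullyFaithfulForget (wittSheaf p n X)).preimageIso
    (PresheafOfModules.isoMk (M₁ := G.val) (M₂ := wittDiffPresheaf p n f)
      (fun V => (chartIdentEquiv E h𝒰 V).toModuleIso) fun V V' g =>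
        ModuleCat.hom_ext (LinearMap.ext fun s => by
          refine (wittDiffSections_ext_of_basis (isAffineBasis_of_cover f h𝒰 V'.unop)
            (fun h => h.1.1) fun U hU => ?_ :
            chartIdentMap E h𝒰 V'.unop (secRes G g.unop.le s) =
              resSections p n f g.unop.le (chartIdentMap E h𝒰 V.unop s))
          change _ = (chartIdentMap E h𝒰 V.unop s).1 ⟨U, hU.1.1, hU.2.trans g.unop.le⟩
          rw [chartIdentMap_apply E h𝒰 _ hU.1 hU.2, chartIdentMap_apply E h𝒰 _ hU.1, secRes_secRes]))

/-- Sections of either sheaf over any open are compatible families over the charts inside it that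
lie in a member of the cover, and on these the identification is prescribed. -/
theorem existsUnique_iso (h𝒰 : ⨆ i, 𝒰 i = ⊤) (E : ChartIdent f G 𝒰) :
    ∃! φ : G ≅ wittDiffSheaf p n f,
      ∀ (U : X.Opens) (hU : IsChart f U) (hi : ∃ i, U ≤ 𝒰 i) (s : G.val.obj (op U)),
        evalChart p n f hU ((φ.hom.val.app (op U)).hom s) = E.iso ⟨U, hU, hi⟩ s := by
  refine ⟨chartIdentIso E h𝒰, fun U hU hi s => Subtype.ext ?_, fun φ hφ => ?_⟩
  · refine (chartIdentMap_apply E h𝒰 s ⟨hU, hi⟩ le_rfl).trans ?_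
    rw [secRes_self]
  · refine Iso.ext (SheafOfModules.hom_ext (PresheafOfModules.hom_ext fun V =>
      ModuleCat.hom_ext (LinearMap.ext fun s => ?_)))
    refine wittDiffSections_ext_of_basis (p := p) (n := n) (isAffineBasis_of_cover f h𝒰 V.unop)
      (fun h => h.1.1) fun U hU => ?_
    refine Eq.trans ?_ (chartIdentMap_apply E h𝒰 s hU.1 hU.2).symm
    have := hφ U hU.1.1 hU.1.2 (secRes G hU.2 s)
    rw [← this]
    have hn := PresheafOfModules.naturality_apply φ.hom.val (homOfLE hU.2).op s
    exact (congrArg (fun t : wittDiffSections p n f U => t.1 ⟨U, hU.1.1, le_rfl⟩) hn).symm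

end Uniqueness

end Sheaf
end WittDiff
end

noncomputable section
namespace WittDiff

/-! ### Sheaves of modules over an open subset -/

section Over

open CategoryTheory Opposite TopologicalSpace AlgebraicGeometry

variable {p n : ℕ} [Fact p.Prime] {k : Type u} [Field k] {X : Scheme.{u}}
  {f : X ⟶ Spec (.of k)} {U : X.Opens}

/-- The sections over `V ≤ U` of a sheaf of modules over the restriction of `W_{n+1}𝒪_X`
to `U`. -/
def OverSec (N : SheafOfModules.{u} ((wittSheaf p n X).over U)) {V : X.Opens} (hV : V ≤ U) :
    Type u :=
  N.val.obj (op (Over.mk (homOfLE hV)))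

variable {N : SheafOfModules.{u} ((wittSheaf p n X).over U)} {V : X.Opens} {hV : V ≤ U}

instance : AddCommGroup (OverSec N hV) :=
  inferInstanceAs (AddCommGroup (N.val.obj (op (Over.mk (homOfLE hV)))))

instance : Module (W p n (Sec f V)) (OverSec N hV) :=
  inferInstanceAs (Module (((wittSheaf p n X).over U).obj.obj (op (Over.mk (homOfLE hV))))
    (N.val.obj (op (Over.mk (homOfLE hV)))))

/-- Restriction of sections. -/
def overRes (N : SheafOfModules.{u} ((wittSheaf p n X).over U)) {V V' : X.Opens} (hV : V ≤ U)
    (h : V' ≤ V) (s : OverSec N hV) : OverSec N (h.trans hV) :=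
  N.val.map (Over.homMk (homOfLE h) :
    Over.mk (homOfLE (h.trans hV)) ⟶ Over.mk (homOfLE hV)).op s

theorem overRes_add {V' : X.Opens} (h : V' ≤ V) (s t : OverSec N hV) :
    overRes N hV h (s + t) = overRes N hV h s + overRes N hV h t :=
  map_add (N.val.map (Over.homMk (homOfLE h) :
    Over.mk (homOfLE (h.trans hV)) ⟶ Over.mk (homOfLE hV)).op).hom s t

theorem overRes_smul {V' : X.Opens} (h : V' ≤ V) (b : W p n (Sec f V)) (s : OverSec N hV) :
    overRes N hV h (b • s) = wres p n f h b • overRes N hV h s :=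
  N.val.map_smul (Over.homMk (homOfLE h) :
    Over.mk (homOfLE (h.trans hV)) ⟶ Over.mk (homOfLE hV)).op b s

theorem overRes_overRes {V' V'' : X.Opens} (h : V' ≤ V) (h' : V'' ≤ V') (s : OverSec N hV) :
    overRes N (h.trans hV) h' (overRes N hV h s) = overRes N hV (h'.trans h) s :=
  (N.val.map_comp_apply (Over.homMk (homOfLE h) :
    Over.mk (homOfLE (h.trans hV)) ⟶ Over.mk (homOfLE hV)).op (Over.homMk (homOfLE h') :
    Over.mk (homOfLE (h'.trans (h.trans hV))) ⟶ Over.mk (homOfLE (h.trans hV))).op s).symm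

theorem overRes_self (h : V ≤ V) (s : OverSec N hV) : overRes N hV h s = s :=
  DFunLike.congr_fun (congrArg ModuleCat.Hom.hom (N.val.map_id (op (Over.mk (homOfLE hV))))) s

/-- The sheaf condition on the slice site, for the sieve generated by the inclusions of the T i. -/
theorem existsUnique_overRes_eq {ι : Type*} (T : ι → X.Opens) (hT : ∀ i, T i ≤ V)
    (hcov : ∀ x ∈ V, ∃ i, x ∈ T i) (s : ∀ i, OverSec N ((hT i).trans hV))
    (hs : ∀ i j (Z : X.Opens) (hi : Z ≤ T i) (hj : Z ≤ T j),
      overRes N ((hT i).trans hV) hi (s i) = overRes N ((hT j).trans hV) hj (s j)) :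
    ∃! t : OverSec N hV, ∀ i, overRes N hV (hT i) t = s i := by
  have h1 := (isSheaf_iff_isSheaf_of_type _ _).mp
    ((Presheaf.isSheaf_iff_isSheaf_forget ((Opens.grothendieckTopology X).over U) N.val.presheaf
      (CategoryTheory.forget AddCommGrpCat.{u})).mp N.isSheaf)
  let π : ∀ i, Over.mk (homOfLE ((hT i).trans hV)) ⟶ Over.mk (homOfLE hV) :=
    fun i => Over.homMk (homOfLE (hT i))
  have h2 := h1 (Sieve.generate (Presieve.ofArrows _ π)) (by
    rw [GrothendieckTopology.mem_over_iff]
    intro x hx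
    obtain ⟨i, hi⟩ := hcov x hx
    exact ⟨T i, homOfLE (hT i), ((Sieve.overEquiv_iff _ _).mpr
      (Sieve.le_generate _ _ _ (Presieve.ofArrows.mk i))), hi⟩)
  rw [← Presieve.isSheafFor_iff_generate, Presieve.isSheafFor_arrows_iff] at h2
  refine h2 s fun i j Z gi gj _ => ?_
  exact hs i j Z.left gi.left.le gj.left.le

theorem overRes_ext {s t : OverSec N hV}
    (h : ∀ x ∈ V, ∃ (T : X.Opens) (hT : T ≤ V), x ∈ T ∧ overRes N hV hT s = overRes N hV hT t) :
    s = t := by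
  choose T hT hx hst using fun x : V => h x x.2
  have := existsUnique_overRes_eq (hV := hV) T hT (fun x hx' => ⟨⟨x, hx'⟩, hx ⟨x, hx'⟩⟩)
    (fun x => overRes N hV (hT x) t) fun x y Z hi hj => by
      rw [overRes_overRes, overRes_overRes]
  exact this.unique hst fun x => rfl

end Over
end WittDiff
end

noncomputable section
namespace WittDiff

/-! ### Extending linear maps from sections over a chart to smaller opens -/

section Extend

open CategoryTheory Opposite TopologicalSpace AlgebraicGeometry

variable {p n : ℕ} [Fact p.Prime] {k : Type u} [Field k] {X : Scheme.{u}}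
  {f : X ⟶ Spec (.of k)} {U V : X.Opens}

theorem resSections_resSections {V' V'' : X.Opens} (h : V' ≤ V) (h' : V'' ≤ V')
    (θ : wittDiffSections p n f V) :
    resSections p n f h' (resSections p n f h θ) = resSections p n f (h'.trans h) θ := rfl

theorem resSections_add {V' : X.Opens} (h : V' ≤ V) (θ θ' : wittDiffSections p n f V) :
    resSections p n f h (θ + θ') = resSections p n f h θ + resSections p n f h θ' := rfl

theorem mul_smul_add_eq {R M : Type*} [CommRing R] [AddCommMonoid M] [Module R M] {b b' : R}
    {m m' θ θ' : M} (h : b • m = θ) (h' : b' • m' = θ') :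
    (b * b') • (m + m') = b' • θ + b • θ' := by
  rw [← h, ← h', smul_add, mul_smul, mul_smul, smul_comm b b' m]

theorem mul_smul_smul_eq {R M : Type*} [CommRing R] [AddCommMonoid M] [Module R M] {a a' b c : R}
    {m θ : M} (h : b • m = θ) (h' : c * a = a') : (c * b) • a • m = a' • θ := by
  rw [← h, ← h', smul_smul, smul_smul]
  congr 1
  ring

/-- A coefficient over V is only locally a fraction of Witt vectors over U. This allows scalars
defined on V to be treated as numerators and denominators on U. -/
theorem exists_wres_mul_eq (hU : IsAffineOpen U) (hV : V ≤ U) (a : W p n (Sec f V)) {x : X}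
    (hx : x ∈ V) : ∃ (T : X.Opens) (hT : T ≤ V), x ∈ T ∧ ∃ b a' : W p n (Sec f U),
      IsUnit (wres p n f (hT.trans hV) b) ∧
        wres p n f (hT.trans hV) b * wres p n f hT a = wres p n f (hT.trans hV) a' := by
  obtain ⟨g, hg, hxg⟩ := hU.exists_basicOpen_le ⟨x, hx⟩ (hV hx)
  obtain ⟨N, a', ha'⟩ := (isAwayMap_res (f := f) hU g).wittMap_surj (wres p n f hg a)
  refine ⟨X.basicOpen g, hg, hxg, wteich p n f g ^ N, a', ?_, ?_⟩
  · rw [map_pow]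
    exact (isUnit_wres_teich hU g).pow N
  · rw [map_pow, wres_wteich, mul_comm]
    exact ha'

variable {N : SheafOfModules.{u} ((wittSheaf p n X).over U)}

/-- Locally `b • m = θ` and `b • t = l θ` for a unit `b`. -/
def IsOverValue (l : wittDiffSections p n f U →ₗ[W p n (Sec f U)] OverSec N le_rfl) (hV : V ≤ U)
    (m : wittDiffSections p n f V) (t : OverSec N hV) : Prop :=
  ∀ x ∈ V, ∃ (T : X.Opens) (hT : T ≤ V), x ∈ T ∧
    ∃ (b : W p n (Sec f U)) (θ : wittDiffSections p n f U),
      IsUnit (wres p n f (hT.trans hV) b) ∧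
      wres p n f (hT.trans hV) b • resSections p n f hT m = resSections p n f (hT.trans hV) θ ∧
      wres p n f (hT.trans hV) b • overRes N hV hT t = overRes N le_rfl (hT.trans hV) (l θ)

variable {l : wittDiffSections p n f U →ₗ[W p n (Sec f U)] OverSec N le_rfl} {hV : V ≤ U}

theorem IsOverValue.restrict {V' : X.Opens} (h : V' ≤ V) {m : wittDiffSections p n f V}
    {t : OverSec N hV} (H : IsOverValue l hV m t) :
    IsOverValue l (h.trans hV) (resSections p n f h m) (overRes N hV h t) := by
  intro x hx
  obtain ⟨T, hT, hxT, b, θ, hb, h1, h2⟩ := H x (h hx)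
  refine ⟨T ⊓ V', inf_le_right, ⟨hxT, hx⟩, b, θ, ?_, ?_, ?_⟩
  · rw [← wres_wres f (hT.trans hV) inf_le_left]
    exact hb.map _
  · have := congrArg (resSections p n f (inf_le_left : T ⊓ V' ≤ T)) h1
    rw [resSections_smul, wres_wres] at this
    exact this
  · have := congrArg (overRes N (hT.trans hV) (inf_le_left : T ⊓ V' ≤ T)) h2
    rw [overRes_smul, wres_wres, overRes_overRes, overRes_overRes] at this
    rw [overRes_overRes]
    exact this

theorem isOverValue_self (θ : wittDiffSections p n f U) : IsOverValue l le_rfl θ (l θ) := by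
  intro x hx
  refine ⟨U, le_rfl, hx, 1, θ, ?_, ?_, ?_⟩
  · rw [map_one]; exact isUnit_one
  · rw [map_one, one_smul]
  · rw [map_one, one_smul]

set_option synthInstance.maxHeartbeats 100000 in
theorem IsOverValue.add {m m' : wittDiffSections p n f V} {t t' : OverSec N hV}
    (H : IsOverValue l hV m t) (H' : IsOverValue l hV m' t') :
    IsOverValue l hV (m + m') (t + t') := by
  intro x hx
  obtain ⟨T, hT, hxT, b, θ, hb, h1, h2⟩ := H x hx
  obtain ⟨T', hT', hxT', b', θ', hb', h1', h2'⟩ := H'.restrict hT x hxT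
  refine ⟨T', hT'.trans hT, hxT', b * b', b' • θ + b • θ', ?_, ?_, ?_⟩
  · rw [map_mul]
    have hb := hb.map (wres p n f hT')
    rw [wres_wres] at hb
    exact hb.mul hb'
  · replace h1 := congrArg (resSections p n f hT') h1
    rw [resSections_smul, wres_wres, resSections_resSections, resSections_resSections] at h1
    rw [map_mul, resSections_add, resSections_add, resSections_smul, resSections_smul]
    rw [resSections_resSections] at h1'
    exact mul_smul_add_eq h1 h1'
  · replace h2 := congrArg (overRes N _ hT') h2
    rw [overRes_smul, wres_wres, overRes_overRes, overRes_overRes] at h2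
    rw [overRes_overRes] at h2'
    rw [map_mul, map_add, overRes_add, overRes_add, map_smul, map_smul, overRes_smul, overRes_smul]
    exact mul_smul_add_eq h2 h2'

theorem IsOverValue.smul (hU : IsAffineOpen U) (a : W p n (Sec f V))
    {m : wittDiffSections p n f V} {t : OverSec N hV}
    (H : IsOverValue l hV m t) : IsOverValue l hV (a • m) (a • t) := by
  intro x hx
  obtain ⟨T, hT, hxT, b, θ, hb, h1, h2⟩ := H x hx
  obtain ⟨T', hT', hxT', c, a', hc, hca⟩ :=
    exists_wres_mul_eq hU (hT.trans hV) (wres p n f hT a) hxT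
  rw [wres_wres] at hca
  refine ⟨T', hT'.trans hT, hxT', c * b, a' • θ, ?_, ?_, ?_⟩
  · rw [map_mul]
    have hb := hb.map (wres p n f hT')
    rw [wres_wres] at hb
    exact hc.mul hb
  · replace h1 := congrArg (resSections p n f hT') h1
    rw [resSections_smul, wres_wres, resSections_resSections, resSections_resSections] at h1
    rw [resSections_smul, resSections_smul, map_mul]
    exact mul_smul_smul_eq h1 hca
  · replace h2 := congrArg (overRes N _ hT') h2
    rw [overRes_smul, wres_wres, overRes_overRes, overRes_overRes] at h2
    rw [map_mul, map_smul, overRes_smul, overRes_smul]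
    exact mul_smul_smul_eq h2 hca

variable [CharP k p] [PerfectRing k p]

theorem wittRestrict_evalChart (hU : IsChart f U) (hV : IsChart f V) (h : V ≤ U)
    (θ : wittDiffSections p n f U) :
    wittRestrict p n hU hV.isAffineOpen h (evalChart p n f hU θ) =
      evalChart p n f hV (resSections p n f h θ) :=
  (wittRestrict_eq_iff hU hV.isAffineOpen h _ _).mpr fun x =>
    (wittDiffSections_prop f θ).compat ⟨U, hU, le_rfl⟩ ⟨V, hV, h⟩ h x

theorem exists_smul_resSections_eq (hU : IsChart f U) (hV : V ≤ U)
    (m : wittDiffSections p n f V) {x : X} (hx : x ∈ V) :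
    ∃ (T : X.Opens) (hT : T ≤ V), x ∈ T ∧ ∃ (b : W p n (Sec f U)) (θ : wittDiffSections p n f U),
      IsUnit (wres p n f (hT.trans hV) b) ∧
        wres p n f (hT.trans hV) b • resSections p n f hT m =
          resSections p n f (hT.trans hV) θ := by
  obtain ⟨g, hg, hxg⟩ := hU.isAffineOpen.exists_basicOpen_le ⟨x, hx⟩ (hV hx)
  have hUg : IsChart f (X.basicOpen g) :=
    hU.of_le (hU.isAffineOpen.basicOpen g) (X.basicOpen_le g)
  obtain ⟨N, θ, hθ⟩ := exists_wittRestrict_eq hU g (evalChart p n f hUg (resSections p n f hg m))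
  obtain ⟨θ, rfl⟩ := (evalChart_bijective hU).2 θ
  refine ⟨X.basicOpen g, hg, hxg, wteich p n f g ^ N, θ, ?_, ?_⟩
  · rw [map_pow]
    exact (isUnit_wres_teich hU.isAffineOpen g).pow N
  · refine (evalChart_bijective hUg).1 ?_
    rw [map_smul, ← wittRestrict_evalChart hU hUg, hθ, map_pow]

theorem exists_smul_eq_of_resSections_eq (hU : IsChart f U) (hV : V ≤ U)
    {θ θ' : wittDiffSections p n f U}
    (h : resSections p n f hV θ = resSections p n f hV θ') {x : X} (hx : x ∈ V) :
    ∃ (T : X.Opens) (hT : T ≤ V), x ∈ T ∧ ∃ b : W p n (Sec f U),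
      IsUnit (wres p n f (hT.trans hV) b) ∧ b • θ = b • θ' := by
  obtain ⟨g, hg, hxg⟩ := hU.isAffineOpen.exists_basicOpen_le ⟨x, hx⟩ (hV hx)
  have hUg : IsChart f (X.basicOpen g) :=
    hU.of_le (hU.isAffineOpen.basicOpen g) (X.basicOpen_le g)
  refine ⟨X.basicOpen g, hg, hxg, wteich p n f g, isUnit_wres_teich hU.isAffineOpen g, ?_⟩
  refine (evalChart_bijective hU).1 ?_
  rw [map_smul, map_smul]
  refine wteich_smul_eq hU g ?_
  rw [wittRestrict_evalChart hU hUg, wittRestrict_evalChart hU hUg,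
    ← resSections_resSections hV hg, h, resSections_resSections]

/-- Sections equal on V become equal on U after multiplication by some [g] that is a unit near the
given point; l is linear over W_{n+1}(𝒪(U)), so the unit can be cancelled. -/
theorem overRes_eq_of_resSections_eq (hU : IsChart f U)
    (l : wittDiffSections p n f U →ₗ[W p n (Sec f U)] OverSec N le_rfl) (hV : V ≤ U)
    {θ θ' : wittDiffSections p n f U} (h : resSections p n f hV θ = resSections p n f hV θ') :
    overRes N le_rfl hV (l θ) = overRes N le_rfl hV (l θ') := by
  refine overRes_ext (hV := hV) fun x hx => ?_
  obtain ⟨T, hT, hxT, b, hb, hbθ⟩ := exists_smul_eq_of_resSections_eq hU hV h hx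
  refine ⟨T, hT, hxT, ?_⟩
  rw [overRes_overRes, overRes_overRes]
  refine hb.smul_left_cancel.mp ?_
  rw [← overRes_smul, ← overRes_smul, ← map_smul, ← map_smul, hbθ]

/-- Well-definedness of a fraction: cross-multiply the two local expressions, apply l, and cancel
both denominators. -/
theorem IsOverValue.unique (hU : IsChart f U) {m : wittDiffSections p n f V}
    {t t' : OverSec N hV} (H : IsOverValue l hV m t) (H' : IsOverValue l hV m t') : t = t' := by
  refine overRes_ext fun x hx => ?_
  obtain ⟨T, hT, hxT, b, θ, hb, h1, h2⟩ := H x hx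
  obtain ⟨T', hT', hxT', b', θ', hb', h1', h2'⟩ := H'.restrict hT x hxT
  refine ⟨T', hT'.trans hT, hxT', ?_⟩
  have hb := hb.map (wres p n f hT')
  rw [wres_wres] at hb
  replace h1 := congrArg (resSections p n f hT') h1
  replace h2 := congrArg (overRes N _ hT') h2
  rw [resSections_smul, wres_wres] at h1
  rw [overRes_smul, wres_wres, overRes_overRes, overRes_overRes] at h2
  rw [overRes_overRes] at h2'
  have := overRes_eq_of_resSections_eq hU l (hT'.trans (hT.trans hV)) (θ := b' • θ) (θ' := b • θ')
    (by
      rw [resSections_smul, resSections_smul]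
      exact (congrArg _ h1.symm).trans ((smul_comm _ _ _).trans (congrArg _ h1')))
  rw [map_smul, map_smul, overRes_smul, overRes_smul] at this
  refine hb.smul_left_cancel.mp (hb'.smul_left_cancel.mp ?_)
  rw [h2, this, ← h2']
  exact smul_comm _ _ _

/-- Locally the value is b⁻¹ l(θ) for an expression b m = θ with b a unit. By uniqueness the local
values agree on overlaps and glue. -/
theorem exists_isOverValue (hU : IsChart f U)
    (l : wittDiffSections p n f U →ₗ[W p n (Sec f U)] OverSec N le_rfl) (hV : V ≤ U)
    (m : wittDiffSections p n f V) :
    ∃ t : OverSec N hV, IsOverValue l hV m t := by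
  choose T hT hxT b θ hb h1 using fun x : V => exists_smul_resSections_eq hU hV m x.2
  choose c hc using fun x => (hb x).exists_left_inv
  let s : ∀ x, OverSec N ((hT x).trans hV) := fun x =>
    c x • overRes N le_rfl ((hT x).trans hV) (l (θ x))
  have hs : ∀ x, IsOverValue l ((hT x).trans hV) (resSections p n f (hT x) m) (s x) := by
    intro x y hy
    refine ⟨T x, le_rfl, hy, b x, θ x, hb x, h1 x, ?_⟩
    rw [overRes_self]
    change _ • c x • _ = _
    rw [smul_smul, mul_comm, hc, one_smul]
  obtain ⟨t, ht, -⟩ := existsUnique_overRes_eq (hV := hV) T hT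
    (fun x hx => ⟨⟨x, hx⟩, hxT ⟨x, hx⟩⟩) s fun x y Z hi hj =>
      IsOverValue.unique hU ((hs x).restrict hi) ((hs y).restrict hj)
  refine ⟨t, fun x hx => ?_⟩
  obtain ⟨T', hT', hxT', b', θ', hb', h1', h2'⟩ := hs ⟨x, hx⟩ x (hxT ⟨x, hx⟩)
  refine ⟨T', hT'.trans (hT ⟨x, hx⟩), hxT', b', θ', hb', h1', ?_⟩
  rw [← ht, overRes_overRes] at h2'
  exact h2'

end Extend
end WittDiff
end

noncomputable section
namespace WittDiff

/-! ### Morphisms of sheaves out of the restriction of 𝒟 to a chart -/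

section Quasicoherent

open CategoryTheory Opposite TopologicalSpace AlgebraicGeometry

variable {p n : ℕ} [Fact p.Prime] {k : Type u} [Field k] [CharP k p] [PerfectRing k p]
  {X : Scheme.{u}} {f : X ⟶ Spec (.of k)} {U V : X.Opens}
  {N : SheafOfModules.{u} ((wittSheaf p n X).over U)}

/-- The extension of a linear map on the sections over a chart `U` to the sections over `V ≤ U`. -/
def overExt (hU : IsChart f U)
    (l : wittDiffSections p n f U →ₗ[W p n (Sec f U)] OverSec N le_rfl) (hV : V ≤ U)
    (m : wittDiffSections p n f V) : OverSec N hV :=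
  (exists_isOverValue hU l hV m).choose

theorem isOverValue_overExt (hU : IsChart f U)
    (l : wittDiffSections p n f U →ₗ[W p n (Sec f U)] OverSec N le_rfl) (hV : V ≤ U)
    (m : wittDiffSections p n f V) : IsOverValue l hV m (overExt hU l hV m) :=
  (exists_isOverValue hU l hV m).choose_spec

theorem overExt_self (hU : IsChart f U)
    (l : wittDiffSections p n f U →ₗ[W p n (Sec f U)] OverSec N le_rfl)
    (θ : wittDiffSections p n f U) : overExt hU l le_rfl θ = l θ :=
  (isOverValue_overExt hU l le_rfl θ).unique hU (isOverValue_self θ)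

theorem overExt_add (hU : IsChart f U)
    (l : wittDiffSections p n f U →ₗ[W p n (Sec f U)] OverSec N le_rfl) (hV : V ≤ U)
    (m m' : wittDiffSections p n f V) :
    overExt hU l hV (m + m') = overExt hU l hV m + overExt hU l hV m' :=
  (isOverValue_overExt hU l hV _).unique hU
    ((isOverValue_overExt hU l hV m).add (isOverValue_overExt hU l hV m'))

theorem overExt_smul (hU : IsChart f U)
    (l : wittDiffSections p n f U →ₗ[W p n (Sec f U)] OverSec N le_rfl) (hV : V ≤ U)
    (a : W p n (Sec f V)) (m : wittDiffSections p n f V) :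
    overExt hU l hV (a • m) = a • overExt hU l hV m :=
  (isOverValue_overExt hU l hV _).unique hU
    ((isOverValue_overExt hU l hV m).smul hU.isAffineOpen a)

theorem overExt_res (hU : IsChart f U)
    (l : wittDiffSections p n f U →ₗ[W p n (Sec f U)] OverSec N le_rfl) (hV : V ≤ U)
    {V' : X.Opens} (h : V' ≤ V) (m : wittDiffSections p n f V) :
    overExt hU l (h.trans hV) (resSections p n f h m) = overRes N hV h (overExt hU l hV m) :=
  (isOverValue_overExt hU l _ _).unique hU ((isOverValue_overExt hU l hV m).restrict h)

variable [Smooth f]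

/-- The extension of a linear map on the sections over a chart `U` to a morphism of sheaves. -/
def overExtHom (hU : IsChart f U)
    (l : wittDiffSections p n f U →ₗ[W p n (Sec f U)] OverSec N le_rfl) :
    (wittDiffSheaf p n f).over U ⟶ N :=
  ⟨{  app := fun V => ModuleCat.ofHom (X := ((wittDiffSheaf p n f).over U).val.obj V)
        (Y := N.val.obj V)
        { toFun := overExt hU l V.unop.hom.le
          map_add' := overExt_add hU l V.unop.hom.le
          map_smul' := overExt_smul hU l V.unop.hom.le }
      naturality := fun {V _} g => ModuleCat.hom_ext (LinearMap.ext fun m =>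
        overExt_res hU l V.unop.hom.le g.unop.left.le m) }⟩

/-- The value over `V` of a morphism out of `𝒟|_U`. -/
def overApp (ψ : (wittDiffSheaf p n f).over U ⟶ N) (hV : V ≤ U) (m : wittDiffSections p n f V) :
    OverSec N hV :=
  (ψ.val.app (op (Over.mk (homOfLE hV)))).hom m

theorem overApp_overExtHom (hU : IsChart f U)
    (l : wittDiffSections p n f U →ₗ[W p n (Sec f U)] OverSec N le_rfl)
    (θ : wittDiffSections p n f U) : overApp (overExtHom hU l) le_rfl θ = l θ :=
  overExt_self hU l θ

theorem overApp_smul (ψ : (wittDiffSheaf p n f).over U ⟶ N) (hV : V ≤ U) (a : W p n (Sec f V))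
    (m : wittDiffSections p n f V) : overApp ψ hV (a • m) = a • overApp ψ hV m :=
  (ψ.val.app (op (Over.mk (homOfLE hV)))).hom.map_smul a m

theorem overApp_res (ψ : (wittDiffSheaf p n f).over U ⟶ N) (hV : V ≤ U) {V' : X.Opens}
    (h : V' ≤ V) (m : wittDiffSections p n f V) :
    overApp ψ (h.trans hV) (resSections p n f h m) = overRes N hV h (overApp ψ hV m) :=
  PresheafOfModules.naturality_apply ψ.val (Over.homMk (homOfLE h) :
    Over.mk (homOfLE (h.trans hV)) ⟶ Over.mk (homOfLE hV)).op m

/-- Every section over V is locally a unit multiple of the restriction of a section over U. -/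
theorem overApp_ext (hU : IsChart f U) {ψ ψ' : (wittDiffSheaf p n f).over U ⟶ N}
    (h : ∀ θ, overApp ψ le_rfl θ = overApp ψ' le_rfl θ) (hV : V ≤ U)
    (m : wittDiffSections p n f V) : overApp ψ hV m = overApp ψ' hV m := by
  refine overRes_ext fun x hx => ?_
  obtain ⟨T, hT, hxT, b, θ, hb, h1⟩ := exists_smul_resSections_eq hU hV m hx
  refine ⟨T, hT, hxT, hb.smul_left_cancel.mp ?_⟩
  rw [← overApp_res, ← overApp_res, ← overApp_smul, ← overApp_smul, h1, overApp_res ψ le_rfl,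
    overApp_res ψ' le_rfl, h]

theorem over_hom_ext (hU : IsChart f U) {ψ ψ' : (wittDiffSheaf p n f).over U ⟶ N}
    (h : ∀ θ, overApp ψ le_rfl θ = overApp ψ' le_rfl θ) : ψ = ψ' :=
  SheafOfModules.hom_ext (PresheafOfModules.hom_ext fun V => ModuleCat.hom_ext
    (LinearMap.ext fun m => overApp_ext hU h V.unop.hom.le m))

end Quasicoherent
end WittDiff
end

noncomputable section
namespace WittDiff

/-! ### Presentation over a chart and quasi-coherence -/

section Presentation

open CategoryTheory Limits Opposite TopologicalSpace AlgebraicGeometry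

variable {p n : ℕ} [Fact p.Prime] {k : Type u} [Field k]
  {X : Scheme.{u}} {f : X ⟶ Spec (.of k)} {U : X.Opens}
  {N N' : SheafOfModules.{u} ((wittSheaf p n X).over U)}

/-- The section over `U` corresponding to a morphism from the unit. -/
def unitVal (r : SheafOfModules.unit ((wittSheaf p n X).over U) ⟶ N) : OverSec N le_rfl :=
  (N.unitHomEquiv r).val (op (Over.mk (homOfLE le_rfl)))

theorem unitVal_add (r r' : SheafOfModules.unit ((wittSheaf p n X).over U) ⟶ N) :
    unitVal (r + r') = unitVal r + unitVal r' := rfl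

theorem unitVal_ext {r r' : SheafOfModules.unit ((wittSheaf p n X).over U) ⟶ N}
    (h : unitVal r = unitVal r') : r = r' := by
  refine N.unitHomEquiv.injective (PresheafOfModules.sections_ext _ _ fun V => ?_)
  have key : ∀ r : SheafOfModules.unit ((wittSheaf p n X).over U) ⟶ N,
      (N.unitHomEquiv r).val V = overRes N le_rfl V.unop.hom.le (unitVal r) := fun r =>
    (PresheafOfModules.sections_property (N.unitHomEquiv r) (Over.homMk V.unop.hom :
      V.unop ⟶ Over.mk (homOfLE le_rfl)).op).symm
  rw [key, key, h]

/-- The morphism from the unit corresponding to a section over `U`. -/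
def unitHom (s : OverSec N le_rfl) : SheafOfModules.unit ((wittSheaf p n X).over U) ⟶ N :=
  N.unitHomEquiv.symm (PresheafOfModules.sectionsMk
    (fun V => overRes N le_rfl V.unop.hom.le s)
    fun V _ g => overRes_overRes V.unop.hom.le g.unop.left.le s)

theorem unitVal_unitHom (s : OverSec N le_rfl) : unitVal (unitHom s) = s := by
  rw [unitVal, unitHom, Equiv.apply_symm_apply]
  exact overRes_self le_rfl s

theorem unitVal_comp_eq (r : SheafOfModules.unit ((wittSheaf p n X).over U) ⟶ N) (ψ : N ⟶ N') :
    unitVal (r ≫ ψ) = (ψ.val.app (op (Over.mk (homOfLE le_rfl)))).hom (unitVal r) := rfl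

variable (f) in
/-- A function as a section of the unit. -/
def unitSec (c : W p n (Sec f U)) :
    OverSec (SheafOfModules.unit ((wittSheaf p n X).over U)) (le_refl U) := c

theorem unitVal_unitHom_comp (c : W p n (Sec f U))
    (r : SheafOfModules.unit ((wittSheaf p n X).over U) ⟶ N) :
    unitVal (unitHom (unitSec f c) ≫ r) =
      c • unitVal r := by
  rw [unitVal_comp_eq, unitVal_unitHom]
  have := (r.val.app (op (Over.mk (homOfLE (le_refl U))))).hom.map_smul c
    (1 : ((wittSheaf p n X).over U).obj.obj (op (Over.mk (homOfLE (le_refl U)))))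
  refine Eq.trans ?_ this
  congr 1
  exact (mul_one c).symm

section Free

variable {I : Type u}

/-- The morphism from a free module given by sections over `U`. -/
def freeDesc (r : I → (SheafOfModules.unit ((wittSheaf p n X).over U) ⟶ N)) :
    SheafOfModules.free I ⟶ N :=
  Cofan.IsColimit.desc (SheafOfModules.isColimitFreeCofan I) r

theorem ιFree_freeDesc (r : I → (SheafOfModules.unit ((wittSheaf p n X).over U) ⟶ N)) (i : I) :
    SheafOfModules.ιFree i ≫ freeDesc r = r i :=
  Cofan.IsColimit.fac (SheafOfModules.isColimitFreeCofan I) r i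

theorem free_hom_ext {h h' : SheafOfModules.free (R := (wittSheaf p n X).over U) I ⟶ N}
    (e : ∀ i, SheafOfModules.ιFree i ≫ h = SheafOfModules.ιFree i ≫ h') : h = h' :=
  Cofan.IsColimit.hom_ext (SheafOfModules.isColimitFreeCofan I) _ _ e

end Free

variable [CharP k p] [PerfectRing k p] [Smooth f]

/-- A section of `𝒟` over `U` as a section of `𝒟|_U`. -/
def overOfSections (θ : wittDiffSections p n f U) :
    OverSec ((wittDiffSheaf p n f).over U) (le_refl U) := θ

variable (p n f U) in
/-- The canonical epimorphism from the free module on all sections over `U`. -/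
def presGen : SheafOfModules.free (R := (wittSheaf p n X).over U) (wittDiffSections p n f U) ⟶
    (wittDiffSheaf p n f).over U :=
  freeDesc fun θ => unitHom (overOfSections θ)

theorem unitVal_presGen (θ : wittDiffSections p n f U) :
    unitVal (SheafOfModules.ιFree θ ≫ presGen p n f U) = overOfSections θ := by
  rw [presGen, ιFree_freeDesc, unitVal_unitHom]

variable (p n f U) in
/-- All relations between the sections over `U`. -/
def presRel : SheafOfModules.free
    {r : SheafOfModules.unit ((wittSheaf p n X).over U) ⟶
      SheafOfModules.free (wittDiffSections p n f U) // r ≫ presGen p n f U = 0} ⟶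
    SheafOfModules.free (R := (wittSheaf p n X).over U) (wittDiffSections p n f U) :=
  freeDesc Subtype.val

theorem presRel_presGen : presRel p n f U ≫ presGen p n f U = 0 :=
  free_hom_ext fun r => by
    rw [← Category.assoc, presRel, ιFree_freeDesc, comp_zero]
    exact r.2

theorem overApp_eq_unitVal (ψ : (wittDiffSheaf p n f).over U ⟶ N) (θ : wittDiffSections p n f U) :
    overApp ψ le_rfl θ = unitVal (SheafOfModules.ιFree θ ≫ presGen p n f U ≫ ψ) := by
  rw [← Category.assoc, unitVal_comp_eq, unitVal_presGen]
  rfl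

theorem presGen_epi (hU : IsChart f U) : Epi (presGen p n f U) := by
  refine ⟨fun ψ ψ' h => over_hom_ext hU fun θ => ?_⟩
  rw [overApp_eq_unitVal, overApp_eq_unitVal, h]

/-- The linear map on sections induced by a morphism killing all relations. -/
def presDescLinear (h : SheafOfModules.free (wittDiffSections p n f U) ⟶ N)
    (hh : presRel p n f U ≫ h = 0) :
    wittDiffSections p n f U →ₗ[W p n (Sec f U)] OverSec N le_rfl :=
  -- Two maps from the unit with the same image under `presGen` differ by an element of the
  -- tautological set of relations, on which h vanishes. Hence h on the generators is additive and
  -- linear in θ.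
  have key : ∀ r r' : SheafOfModules.unit ((wittSheaf p n X).over U) ⟶
      SheafOfModules.free (wittDiffSections p n f U),
      r ≫ presGen p n f U = r' ≫ presGen p n f U → r ≫ h = r' ≫ h := by
    intro r r' hr
    let q : {r : SheafOfModules.unit ((wittSheaf p n X).over U) ⟶
        SheafOfModules.free (wittDiffSections p n f U) // r ≫ presGen p n f U = 0} :=
      ⟨r - r', by rw [Preadditive.sub_comp, hr, sub_self]⟩
    have h1 : SheafOfModules.ιFree q ≫ presRel p n f U ≫ h = SheafOfModules.ιFree q ≫ 0 := by
      rw [hh]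
    rw [← Category.assoc, presRel, ιFree_freeDesc, comp_zero, Preadditive.sub_comp,
      sub_eq_zero] at h1
    exact h1
  { toFun := fun θ => unitVal (SheafOfModules.ιFree θ ≫ h)
    map_add' := fun θ θ' => by
      rw [← unitVal_add, ← Preadditive.add_comp]
      congr 1
      refine key _ _ (unitVal_ext ?_)
      rw [Preadditive.add_comp, unitVal_add, unitVal_presGen, unitVal_presGen, unitVal_presGen]
      rfl
    map_smul' := fun c θ => by
      rw [RingHom.id_apply, ← unitVal_unitHom_comp, ← Category.assoc]
      congr 1
      refine key _ _ (unitVal_ext ?_)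
      rw [Category.assoc, unitVal_unitHom_comp, unitVal_presGen, unitVal_presGen]
      rfl }

theorem presGen_overExtHom (hU : IsChart f U)
    (h : SheafOfModules.free (wittDiffSections p n f U) ⟶ N) (hh : presRel p n f U ≫ h = 0) :
    presGen p n f U ≫ overExtHom hU (presDescLinear h hh) = h :=
  free_hom_ext fun θ => unitVal_ext <| by
    rw [← overApp_eq_unitVal, overApp_overExtHom]
    rfl

/-- The presentation of `𝒟|_U` by all sections and all relations over a chart `U`. -/
def overPresentation (hU : IsChart f U) : ((wittDiffSheaf p n f).over U).Presentation :=
  haveI := presGen_epi (p := p) (n := n) hU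
  SheafOfModules.presentationOfIsCokernelFree (presRel p n f U) (presGen p n f U) presRel_presGen
    (CokernelCofork.IsColimit.ofπ' _ _ fun h hh => ⟨_, presGen_overExtHom hU h hh⟩)

theorem coversTop_isChart (f : X ⟶ Spec (.of k)) [Smooth f] :
    (Opens.grothendieckTopology X).CoversTop
      (Subtype.val : {U : X.Opens // IsChart f U} → X.Opens) := by
  rw [Opens.coversTop_iff]
  refine top_le_iff.mp fun x _ => ?_
  obtain ⟨U, hx, hU⟩ := exists_isChart f x
  exact Opens.mem_iSup.mpr ⟨⟨U, hU⟩, hx⟩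

variable (p n f) in
/-- The presentations of `𝒟` over the local charts. -/
def wittDiffQuasicoherentData : SheafOfModules.QuasicoherentData.{u, u, u, u} (wittDiffSheaf p n f) where
  I := {U : X.Opens // IsChart f U}
  X := Subtype.val
  coversTop := coversTop_isChart f
  presentation U := overPresentation U.2

end Presentation
end WittDiff
end

noncomputable section
namespace WittDiff

/-! ### Localization and étale rigidity of ordinary differential operators -/

section DiffOp

/-- Differential operators can be detected along jointly injective ring homomorphisms. -/
theorem isDiffOp_of_jointly_injective {R A : Type*} [CommRing R] [CommRing A] [Algebra R A]
    {ι : Type*} {R' A' : ι → Type*} [∀ i, CommRing (R' i)] [∀ i, CommRing (A' i)]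
    [∀ i, Algebra (R' i) (A' i)] (γ : ∀ i, A →+* A' i) (hγ : ∀ a, (∀ i, γ i a = 0) → a = 0)
    {N : ℕ} {θ : Module.End R A} {θ' : ∀ i, Module.End (R' i) (A' i)}
    (h : ∀ i x, θ' i (γ i x) = γ i (θ x)) (hθ' : ∀ i, IsDiffOp (R' i) (A' i) N (θ' i)) :
    IsDiffOp R A N θ := by
  have hc : ∀ {θ : Module.End R A} {θ' : ∀ i, Module.End (R' i) (A' i)},
      (∀ i x, θ' i (γ i x) = γ i (θ x)) → ∀ a i x,
      comm (R' i) (A' i) (γ i a) (θ' i) (γ i x) = γ i (comm R A a θ x) := by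
    intro θ θ' h a i x
    rw [comm_apply, comm_apply, map_sub, map_mul (γ i), ← map_mul (γ i) a x, h, h]
  induction N generalizing θ θ' with
  | zero =>
    refine fun a => LinearMap.ext fun x => hγ _ fun i => ?_
    rw [← hc h, hθ' i, LinearMap.zero_apply]
  | succ N ih => exact fun a => ih (hc h a) fun i => hθ' i (γ i a)

theorem isDiffOp_of_injective {R A R' A' : Type*} [CommRing R] [CommRing A] [Algebra R A]
    [CommRing R'] [CommRing A'] [Algebra R' A'] {γ : A →+* A'} (hγ : Function.Injective γ)
    {N : ℕ} {θ : Module.End R A} {θ' : Module.End R' A'} (h : ∀ x, θ' (γ x) = γ (θ x))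
    (hθ' : IsDiffOp R' A' N θ') : IsDiffOp R A N θ :=
  isDiffOp_of_jointly_injective (ι := Unit) (fun _ => γ)
    (fun _ ha => hγ ((ha ()).trans (map_zero γ).symm)) (fun _ => h) fun _ => hθ'

variable {k B B' : Type*} [CommRing k] [CommRing B] [CommRing B'] [Algebra k B] [Algebra k B']

theorem IsAwayMap.pow {γ : B →+* B'} {g : B} (h : IsAwayMap γ g) {M : ℕ} (hM : M ≠ 0) :
    IsAwayMap γ (g ^ M) where
  isUnit := by rw [map_pow]; exact h.isUnit.pow M
  surj b' := by
    obtain ⟨N, b, hb⟩ := h.surj b'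
    refine ⟨N, b * g ^ (M * N - N), ?_⟩
    rw [map_pow, ← pow_mul]
    exact mul_pow_eq_of_le (Nat.le_mul_of_pos_left N (Nat.pos_of_ne_zero hM)) hb
  ker b hb := by
    obtain ⟨N, hN⟩ := h.ker b hb
    refine ⟨N, ?_⟩
    rw [← pow_mul, ← Nat.sub_add_cancel (Nat.le_mul_of_pos_left N (Nat.pos_of_ne_zero hM)),
      pow_add, mul_assoc, hN, mul_zero]

/-- An endomorphism which commutes with `g` extends to the localization at `g`. -/
theorem IsAwayMap.exists_end {γ : B →ₐ[k] B'} {g : B} (h : IsAwayMap γ.toRingHom g)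
    {θ : Module.End k B} (hθ : ∀ x, θ (g * x) = g * θ x) :
    ∃ θ' : Module.End k B', (∀ x, θ' (γ x) = γ (θ x)) ∧
      ∀ x, θ' (γ g * x) = γ g * θ' x := by
  have hpow : ∀ K x, θ (g ^ K * x) = g ^ K * θ x := by
    intro K x
    induction K with
    | zero => simp
    | succ K ih => rw [pow_succ', mul_assoc, hθ, ih, mul_assoc]
  have hu : IsUnit (γ g) := h.isUnit
  -- The relation says that b' is the fraction b / g^K and y is θ(b) / g^K; commutation of θ with g
  -- makes it the graph of a function.
  let P : B' → B' → Prop := fun b' y => ∃ (K : ℕ) (b : B), b' * γ g ^ K = γ b ∧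
    y * γ g ^ K = γ (θ b)
  have hex : ∀ b', ∃ y, P b' y := by
    intro b'
    obtain ⟨K, b, hb⟩ := h.surj b'
    obtain ⟨v, hv⟩ := (hu.pow K).exists_left_inv
    exact ⟨γ (θ b) * v, K, b, hb, by rw [mul_assoc, hv, mul_one]⟩
  have huniq : ∀ {b' y y'}, P b' y → P b' y' → y = y' := by
    rintro b' y y' ⟨K, b, hb, hy⟩ ⟨L, c, hc, hy'⟩
    have h0 : γ.toRingHom (g ^ L * b - g ^ K * c) = 0 := by
      change γ (g ^ L * b - g ^ K * c) = 0
      rw [map_sub, map_mul, map_mul, ← hb, ← hc, map_pow, map_pow]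
      ring
    obtain ⟨J, hJ⟩ := h.ker _ h0
    have h1 := congrArg θ hJ
    rw [hpow, map_sub, hpow, hpow, map_zero] at h1
    have h2 := congrArg γ h1
    rw [map_mul, map_sub, map_mul, map_mul, map_pow, map_pow, map_pow, map_zero,
      (hu.pow J).mul_right_eq_zero, sub_eq_zero, ← hy, ← hy'] at h2
    refine (hu.pow (K + L)).mul_right_cancel ?_
    rw [pow_add]
    linear_combination h2
  have hP1 : ∀ {b' y c' w}, P b' y → P c' w → P (b' + c') (y + w) := by
    rintro b' y c' w ⟨K, b, hb, hy⟩ ⟨L, c, hc, hw⟩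
    refine ⟨K + L, g ^ L * b + g ^ K * c, ?_, ?_⟩
    · rw [map_add, map_mul, map_mul, ← hb, ← hc, map_pow, map_pow]; ring
    · rw [map_add, map_add, hpow, hpow, map_mul, map_mul, ← hy, ← hw, map_pow, map_pow]; ring
  have hP2 : ∀ {b' y} (r : k), P b' y → P (r • b') (r • y) := by
    rintro b' y r ⟨K, b, hb, hy⟩
    refine ⟨K, r • b, ?_, ?_⟩
    · rw [smul_mul_assoc, hb, map_smul]
    · rw [smul_mul_assoc, hy, map_smul, map_smul]
  choose F hF using hex
  refine ⟨{ toFun := F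
            map_add' := fun x y => huniq (hF _) (hP1 (hF x) (hF y))
            map_smul' := fun r x => huniq (hF _) (hP2 r (hF x)) }, fun x => ?_, fun x => ?_⟩
  · exact huniq (hF _) ⟨0, x, by simp, by simp⟩
  · obtain ⟨K, b, hb, hy⟩ := hF x
    refine huniq (hF _) ⟨K, g * b, ?_, ?_⟩
    · rw [map_mul, ← hb, mul_assoc]
    · rw [hθ, map_mul, ← hy, mul_assoc]
      rfl

theorem comm_mul_left {R A : Type*} [CommRing R] [CommRing A] [Algebra R A] {v : A}
    {θ : Module.End R A} (hv : ∀ x, θ (v * x) = v * θ x) (w : A) :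
    comm R A (v * w) θ = Algebra.lmul R A v * comm R A w θ := by
  ext x
  change _ = v * comm R A w θ x
  rw [comm_apply, comm_apply, mul_assoc, mul_assoc, hv]
  ring

/-- The extension of a differential operator to a localization is a differential operator. -/
theorem IsAwayMap.isDiffOp_of_end {γ : B →ₐ[k] B'} {g : B} (h : IsAwayMap γ.toRingHom g)
    {N : ℕ} {θ : Module.End k B} (hN : IsDiffOp k B N θ) {θ' : Module.End k B'}
    (h1 : ∀ x, θ' (γ x) = γ (θ x)) (h2 : ∀ x, θ' (γ g * x) = γ g * θ' x) :
    IsDiffOp k B' N θ' := by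
  have hu : IsUnit (γ g) := h.isUnit
  obtain ⟨v, hv⟩ := hu.exists_left_inv
  have hpow : ∀ {θ' : Module.End k B'}, (∀ x, θ' (γ g * x) = γ g * θ' x) →
      ∀ K x, θ' (v ^ K * x) = v ^ K * θ' x := by
    intro θ' h2 K
    induction K with
    | zero => simp
    | succ K ih =>
      intro x
      have : ∀ x, θ' (v * x) = v * θ' x := fun x => by
        refine hu.mul_left_cancel ?_
        rw [← h2, ← mul_assoc, ← mul_assoc, mul_comm (γ g), hv, one_mul, one_mul]
      rw [pow_succ', mul_assoc, this, ih, mul_assoc]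
  have hsurj : ∀ a' : B', ∃ (K : ℕ) (a : B), a' = v ^ K * γ a := fun a' => by
    obtain ⟨K, a, ha⟩ := h.surj a'
    refine ⟨K, a, ?_⟩
    have ha : a' * γ g ^ K = γ a := ha
    rw [← ha, mul_left_comm, ← mul_pow, hv, one_pow, mul_one]
  have hcomm : ∀ {θ : Module.End k B} {θ' : Module.End k B'}, (∀ x, θ' (γ x) = γ (θ x)) →
      ∀ a x, comm k B' (γ a) θ' (γ x) = γ (comm k B a θ x) := by
    intro θ θ' h1 a x
    rw [comm_apply, comm_apply, map_sub, map_mul γ, ← map_mul γ a x, h1, h1]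
  have hcomm2 : ∀ {θ' : Module.End k B'}, (∀ x, θ' (γ g * x) = γ g * θ' x) →
      ∀ a x, comm k B' a θ' (γ g * x) = γ g * comm k B' a θ' x := by
    intro θ' h2 a x
    rw [comm_apply, comm_apply, mul_left_comm, h2, h2]
    ring
  induction N generalizing θ θ' with
  | zero =>
    intro a'
    obtain ⟨K, a, rfl⟩ := hsurj a'
    rw [comm_mul_left (hpow h2 K)]
    refine LinearMap.ext fun x' => ?_
    obtain ⟨L, x, rfl⟩ := hsurj x'
    change v ^ K * comm k B' (γ a) θ' (v ^ L * γ x) = 0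
    rw [hpow (hcomm2 h2 _), hcomm h1, hN a, LinearMap.zero_apply, map_zero, mul_zero, mul_zero]
  | succ N ih =>
    intro a'
    obtain ⟨K, a, rfl⟩ := hsurj a'
    rw [comm_mul_left (hpow h2 K)]
    exact (ih (hN a) (hcomm h1 a) (hcomm2 h2 _)).lmul_mul _

/-- In characteristic p an operator of order N commutes with g^(p^N), and inverting g^(p^N) is the
same as inverting g. -/
theorem IsDiffOp.exists_of_away {p : ℕ} [Fact p.Prime] (hp : (p : B) = 0) {γ : B →ₐ[k] B'} {g : B}
    (h : IsAwayMap γ.toRingHom g) {N : ℕ} {θ : Module.End k B} (hN : IsDiffOp k B N θ) :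
    ∃ θ' : Module.End k B', IsDiffOp k B' N θ' ∧ ∀ x, θ' (γ x) = γ (θ x) := by
  have hG := h.pow (M := p ^ N) (pow_ne_zero _ (Fact.out : p.Prime).ne_zero)
  obtain ⟨θ', h1, h2⟩ := hG.exists_end ((comm_eq_zero_iff _ _).mp
    (hN.comm_pow_eq_zero (n := 0) (Fact.out : p.Prime).pos (by rw [zero_add, pow_one, hp]) g
      (M := N) (by omega)))
  exact ⟨θ', hG.isDiffOp_of_end hN h1 h2, h1⟩

/-- Differential operators in characteristic `p` are determined by their restriction along an
étale map. -/
theorem eq_of_etale {p : ℕ} [Fact p.Prime] (hp : (p : B') = 0) {γ : B →ₐ[k] B'}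
    (hγ : γ.toRingHom.Etale) {θ θ' : Module.End k B'} (hθ : θ ∈ diffOps k B')
    (hθ' : θ' ∈ diffOps k B') (h : ∀ x, θ (γ x) = θ' (γ x)) : θ = θ' := by
  let _ : Algebra B B' := γ.toRingHom.toAlgebra
  have : Algebra.Etale B B' := hγ
  obtain ⟨N, hN⟩ := sub_mem hθ hθ'
  refine sub_eq_zero.mp (LinearMap.ext fun x => ?_)
  -- The difference commutes with p^N-th powers and vanishes on the image of B, so it vanishes on
  -- these additive generators.
  have hx : x ∈ AddSubgroup.closure {b : B' | ∃ a c, b = algebraMap B B' a * c ^ p ^ N} :=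
    closure_mul_pow_eq_top (A := B) hp N ▸ AddSubgroup.mem_top x
  induction hx using AddSubgroup.closure_induction with
  | mem x hx =>
    obtain ⟨a, c, rfl⟩ := hx
    have h1 := (comm_eq_zero_iff _ _).mp (hN.comm_pow_eq_zero (n := 0) (Fact.out : p.Prime).pos
      (by rw [zero_add, pow_one, hp]) c (M := N) (by omega)) (γ a)
    change (θ - θ') (γ a * c ^ p ^ N) = 0
    rw [mul_comm, h1, LinearMap.sub_apply, h, sub_self, mul_zero]
  | zero => simp
  | add x y _ _ hx hy => rw [map_add, hx, hy]; simp
  | neg x _ hx => rw [map_neg, hx]; simp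

end DiffOp
end WittDiff
end

noncomputable section
namespace WittDiff

/-! ### The case n = 0 on a chart -/

section Zero

variable {p : ℕ} [Fact p.Prime]

theorem eq_of_coeff_zero {p : ℕ} {B : Type*} {x y : TruncatedWittVector p 1 B}
    (h : x.coeff 0 = y.coeff 0) : x = y :=
  TruncatedWittVector.ext fun i => by rwa [Fin.fin_one_eq_zero i]

variable (p) in
/-- The identification `W₁(B) = B`. -/
def wittZeroEquiv (B : Type*) [CommRing B] : W p 0 B ≃+* B :=
  RingEquiv.ofBijective wittConst
    ⟨fun x y h => eq_of_coeff_zero (by rwa [wittConst_apply, wittConst_apply] at h), fun b =>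
      ⟨TruncatedWittVector.mk p fun _ => b, by
        rw [wittConst_apply, TruncatedWittVector.coeff_mk]⟩⟩

theorem wittZeroEquiv_apply {B : Type*} [CommRing B] (x : W p 0 B) :
    wittZeroEquiv p B x = x.coeff 0 := wittConst_apply x

theorem wittZeroEquiv_wittMap {B B' : Type*} [CommRing B] [CommRing B'] (g : B →+* B')
    (x : W p 0 B) : wittZeroEquiv p B' (wittMap g x) = g (wittZeroEquiv p B x) := by
  rw [wittZeroEquiv_apply, wittZeroEquiv_apply, coeff_wittMap]

section

variable {k B : Type*} [CommRing k] [CommRing B] [Algebra k B]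

theorem wittZeroEquiv_smul (c : W p 0 k) (x : W p 0 B) :
    wittZeroEquiv p B (c • x) = wittZeroEquiv p k c • wittZeroEquiv p B x := by
  rw [Algebra.smul_def, Algebra.smul_def, map_mul, ← wittZeroEquiv_wittMap]
  rfl

theorem wittZeroEquiv_symm_smul (c : k) (b : B) :
    (wittZeroEquiv p B).symm (c • b) =
      (wittZeroEquiv p k).symm c • (wittZeroEquiv p B).symm b := by
  rw [RingEquiv.symm_apply_eq, wittZeroEquiv_smul, RingEquiv.apply_symm_apply,
    RingEquiv.apply_symm_apply]

variable (p k B) in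
/-- The identification of the `k`-linear endomorphisms of `B` with the `W₁(k)`-linear endomorphisms
of `W₁(B)`. -/
def endZeroEquiv : Module.End k B ≃+* Module.End (W p 0 k) (W p 0 B) where
  toFun η :=
    { toFun := fun x => (wittZeroEquiv p B).symm (η (wittZeroEquiv p B x))
      map_add' := fun x y => by rw [map_add, map_add, map_add]
      map_smul' := fun c x => by
        rw [wittZeroEquiv_smul, map_smul, wittZeroEquiv_symm_smul, RingEquiv.symm_apply_apply]
        rfl }
  invFun θ :=
    { toFun := fun b => wittZeroEquiv p B (θ ((wittZeroEquiv p B).symm b))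
      map_add' := fun x y => by rw [map_add, map_add, map_add]
      map_smul' := fun c b => by
        rw [wittZeroEquiv_symm_smul, map_smul, wittZeroEquiv_smul, RingEquiv.apply_symm_apply]
        rfl }
  left_inv η := LinearMap.ext fun b => by
    change wittZeroEquiv p B ((wittZeroEquiv p B).symm
      (η (wittZeroEquiv p B ((wittZeroEquiv p B).symm b)))) = η b
    rw [RingEquiv.apply_symm_apply, RingEquiv.apply_symm_apply]
  right_inv θ := LinearMap.ext fun x => by
    change (wittZeroEquiv p B).symm (wittZeroEquiv p B
      (θ ((wittZeroEquiv p B).symm (wittZeroEquiv p B x)))) = θ x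
    rw [RingEquiv.symm_apply_apply, RingEquiv.symm_apply_apply]
  map_mul' η η' := LinearMap.ext fun x => by
    change (wittZeroEquiv p B).symm (η (η' (wittZeroEquiv p B x))) = (wittZeroEquiv p B).symm
      (η (wittZeroEquiv p B ((wittZeroEquiv p B).symm (η' (wittZeroEquiv p B x)))))
    rw [RingEquiv.apply_symm_apply]
  map_add' η η' := LinearMap.ext fun x => map_add (wittZeroEquiv p B).symm _ _

theorem wittZeroEquiv_endZeroEquiv (η : Module.End k B) (x : W p 0 B) :
    wittZeroEquiv p B (endZeroEquiv p k B η x) = η (wittZeroEquiv p B x) :=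
  RingEquiv.apply_symm_apply _ _

theorem coeff_zero_endZeroEquiv (η : Module.End k B) (x : W p 0 B) :
    (endZeroEquiv p k B η x).coeff 0 = η (x.coeff 0) := by
  rw [← wittZeroEquiv_apply, ← wittZeroEquiv_apply, wittZeroEquiv_endZeroEquiv]

theorem endZeroEquiv_mem_diffOps {η : Module.End k B} :
    endZeroEquiv p k B η ∈ diffOps (W p 0 k) (W p 0 B) ↔ η ∈ diffOps k B := by
  refine exists_congr fun N => ⟨fun h => ?_, fun h => ?_⟩
  · refine isDiffOp_of_injective (γ := (wittZeroEquiv p B).symm.toRingHom)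
      (wittZeroEquiv p B).symm.injective (fun b => ?_) h
    exact congrArg (fun y => (wittZeroEquiv p B).symm (η y)) (RingEquiv.apply_symm_apply _ b)
  · exact isDiffOp_of_injective (γ := (wittZeroEquiv p B).toRingHom)
      (wittZeroEquiv p B).injective (fun x => (wittZeroEquiv_endZeroEquiv η x).symm) h

theorem endZeroEquiv_wittMap_iff {B' : Type*} [CommRing B'] [Algebra k B'] (g : B →+* B')
    {η : Module.End k B} {η' : Module.End k B'} :
    (∀ x, endZeroEquiv p k B' η' (wittMap g x) = wittMap g (endZeroEquiv p k B η x)) ↔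
      ∀ b, η' (g b) = g (η b) := by
  constructor
  · intro h b
    obtain ⟨x, rfl⟩ := (wittZeroEquiv p B).surjective b
    rw [← wittZeroEquiv_wittMap, ← wittZeroEquiv_endZeroEquiv, h, wittZeroEquiv_wittMap,
      wittZeroEquiv_endZeroEquiv]
  · intro h x
    apply (wittZeroEquiv p B').injective
    rw [wittZeroEquiv_endZeroEquiv, wittZeroEquiv_wittMap, wittZeroEquiv_wittMap,
      wittZeroEquiv_endZeroEquiv, h]

/-- For n = 0 nothing has to be lifted: W_1(B) is its own flat lift, and `ghostHom` is the identity.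
-/
theorem isFlatLift_wittConst (hp : (p : B) = 0) :
    IsFlatLift p 0 k (wittConst : W p 0 B →+* B) where
  surjective := (wittZeroEquiv p B).surjective
  dvd x hx := by
    rw [(wittZeroEquiv p B).injective (hx.trans (map_zero (wittZeroEquiv p B)).symm)]
    exact dvd_zero _
  char := hp
  pow := by
    refine (pow_one _).trans ((wittZeroEquiv p B).injective ?_)
    rw [map_natCast, map_zero, hp]
  torsion x _ := by rw [pow_zero]; exact one_dvd x
  map_algebraMap w := (wittZeroEquiv_wittMap _ w).trans (by rw [wittZeroEquiv_apply])

theorem ghostHom_isFlatLift_wittConst (hp : (p : B) = 0) (x : W p 0 B) :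
    (isFlatLift_wittConst (k := k) hp).ghostHom x = x := by
  obtain ⟨y, rfl⟩ := toW_surjective (p := p) (n := 0)
    (isFlatLift_wittConst (k := k) hp).surjective x
  rw [IsFlatLift.ghostHom_toW, ghostComponent_eq_sum]
  apply eq_of_coeff_zero
  rw [coeff_toW, wittConst_apply]
  simp

end

/-- For `n = 0`, the Witt differential operators are all differential operators. -/
theorem wittDiff_zero {k B : Type u} [Field k] [CharP k p] [PerfectRing k p] [CommRing B]
    [Algebra k B] {m : ℕ} {z : Fin m → B} (hz : IsCoord k z) :
    wittDiff p 0 k B = diffOps (W p 0 k) (W p 0 B) := by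
  refine le_antisymm (wittDiff_le_diffOps p 0 hz) ?_
  rintro θ ⟨N, hN⟩
  have := isReduced_of_isCoord hz
  have hp : (p : B) = 0 := natCast_eq_zero_of_algebra (k := k) B
  obtain ⟨zc, D, δ, hzc, hD, hδ, hi⟩ :=
    (isFlatLift_wittConst (k := k) hp).exists_intertwines_isWittLift hz
  refine IsDiffOp.mem_of_hsCoeff_mem hD hzc.formallyUnramified (lmul_mem_wittDiff p 0 k)
    (fun i r => ?_) hN
  -- As `ghostHom` is the identity, the Hasse-Schmidt coefficients are themselves the lifted
  -- derivations, which are bullet operators with coefficient 1.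
  have : hsCoeff (D i) r = δ i r := LinearMap.ext fun x => by
    have := hi i r x
    rwa [ghostHom_isFlatLift_wittConst hp, ghostHom_isFlatLift_wittConst hp, eq_comm] at this
  rw [this]
  exact Algebra.subset_adjoin (Or.inr ⟨m, z, hz, δ, hδ, i, r, 1, IsFlatLift.isBullet_one (hi i r)⟩)

theorem endZeroEquiv_mem_wittDiff {k B : Type u} [Field k] [CharP k p] [PerfectRing k p]
    [CommRing B] [Algebra k B] {m : ℕ} {z : Fin m → B} (hz : IsCoord k z) {η : Module.End k B} :
    endZeroEquiv p k B η ∈ wittDiff p 0 k B ↔ η ∈ diffOps k B := by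
  rw [wittDiff_zero hz, endZeroEquiv_mem_diffOps]

end Zero
end WittDiff
end

noncomputable section
namespace WittDiff

/-! ### Comparison with Grothendieck's sheaf of differential operators -/

section Grothendieck

open CategoryTheory Opposite TopologicalSpace AlgebraicGeometry

variable {p : ℕ} [Fact p.Prime] {k : Type u} [Field k]
  {X : Scheme.{u}} {f : X ⟶ Spec (.of k)} {U V : X.Opens} {P : X.Opens → Prop}

theorem res_smul (h : U ≤ V) (c : k) (x : Sec f V) : res f h (c • x) = c • res f h x :=
  map_smul (resAlg f h) c x

theorem diffSections_ext_of_basis (hP : IsAffineBasis V P) {θ θ' : diffSections f V}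
    (h : ∀ U (hU : P U), θ.1 ⟨U, hP.affine hU, hP.le hU⟩ = θ'.1 ⟨U, hP.affine hU, hP.le hU⟩) :
    θ = θ' := by
  refine Subtype.ext (funext fun T => LinearMap.ext fun x => ?_)
  refine (hP.inf T.2.2).ext fun U hU => ?_
  rw [← (diffSections_prop f θ).compat T ⟨U, hP.affine hU.1, hP.le hU.1⟩ hU.2,
    ← (diffSections_prop f θ').compat T ⟨U, hP.affine hU.1, hP.le hU.1⟩ hU.2, h U hU.1]

theorem exists_end_sec_glue (hP : IsAffineBasis V P)
    (θ : ∀ U, P U → Module.End k (Sec f U))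
    (hθ : ∀ U U' (hU : P U) (hU' : P U') (h : U' ≤ U) x,
      θ U' hU' (res f h x) = res f h (θ U hU x)) {T : X.Opens} (hT : T ≤ V) :
    ∃ η : Module.End k (Sec f T), ∀ U (hU : P U) (h : U ≤ T) x,
      θ U hU (res f h x) = res f h (η x) := by
  have hB := hP.inf hT
  choose η hη using fun x : Sec f T => hB.exists_glue
    (fun U hU => θ U hU.1 (res f hU.2 x)) fun U U' hU hU' h => by
      rw [← hθ U U' hU.1 hU'.1 h, res_res]
  refine ⟨{ toFun := η, map_add' := fun x y => ?_, map_smul' := fun c x => ?_ },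
    fun U hU h x => (hη x U ⟨hU, h⟩).symm⟩
  · refine hB.ext (f := f) fun U hU => ?_
    rw [hη _ U hU, map_add, map_add, map_add, hη _ U hU, hη _ U hU]
  · refine hB.ext (f := f) fun U hU => ?_
    rw [hη _ U hU, RingHom.id_apply, res_smul, res_smul, hη _ U hU, map_smul]

theorem IsAffineBasis.exists_finset (hP : IsAffineBasis V P) (hV : IsAffineOpen V) :
    ∃ s : Finset {U // P U}, ∀ x ∈ V, ∃ U ∈ s, x ∈ U.1 := by
  obtain ⟨s, hs⟩ := hV.isCompact.elim_finite_subcover (fun U : {U // P U} => (U.1 : Set X))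
    (fun U => U.1.isOpen) fun x hx => by
      obtain ⟨U, hU, hxU⟩ := hP.cover x hx
      exact Set.mem_iUnion.mpr ⟨⟨U, hU⟩, hxU⟩
  refine ⟨s, fun x hx => ?_⟩
  obtain ⟨U, hU, hxU⟩ := Set.mem_iUnion₂.mp (hs hx)
  exact ⟨U, hU, hxU⟩

/-- An operator on an affine open is a differential operator if it is one locally. -/
theorem mem_diffOps_of_local (hP : IsAffineBasis V P) (hV : IsAffineOpen V)
    {η : Module.End k (Sec f V)} (θ : ∀ U, P U → diffOps k (Sec f U))
    (h : ∀ U (hU : P U) x, (θ U hU).1 (res f (hP.le hU) x) = res f (hP.le hU) (η x)) :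
    η ∈ diffOps k (Sec f V) := by
  -- Quasi-compactness of V provides a common bound for the local orders.
  obtain ⟨s, hs⟩ := hP.exists_finset hV
  choose N hN using fun U : {U // P U} => (θ U.1 U.2).2
  refine ⟨s.sup N, isDiffOp_of_jointly_injective (ι := s) (R' := fun _ => k)
    (A' := fun U => Sec f U.1.1) (fun U => res f (hP.le U.1.2)) (fun a ha => ?_)
    (θ' := fun U => (θ U.1.1 U.1.2).1) (fun U x => h _ U.1.2 x)
    fun U => (hN U.1).mono (Finset.le_sup U.2)⟩
  refine X.sheaf.eq_of_locally_eq' (fun U : s => U.1.1) V (fun U => homOfLE (hP.le U.1.2))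
    (fun x hx => ?_) a 0 fun U => (ha U).trans (map_zero (res f (hP.le U.1.2))).symm
  obtain ⟨U, hU, hxU⟩ := hs x hx
  exact Opens.mem_iSup.mpr ⟨⟨U, hU⟩, hxU⟩

/-- Compatible families of differential operators on the affine opens of a basis glue. -/
theorem exists_diffSections_glue (hP : IsAffineBasis V P)
    (θ : ∀ U, P U → diffOps k (Sec f U))
    (hθ : ∀ U U' (hU : P U) (hU' : P U') (h : U' ≤ U) x,
      (θ U' hU').1 (res f h x) = res f h ((θ U hU).1 x)) :
    ∃ η : diffSections f V, ∀ U (hU : P U),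
      η.1 ⟨U, hP.affine hU, hP.le hU⟩ = (θ U hU).1 := by
  choose η hη using fun T : {T : X.Opens // IsAffineOpen T ∧ T ≤ V} =>
    exists_end_sec_glue hP (fun U hU => (θ U hU).1) hθ T.2.2
  refine ⟨⟨η, fun T => ?_, fun T T' h x => ?_⟩, fun U hU => LinearMap.ext fun x => ?_⟩
  · exact mem_diffOps_of_local (hP.inf T.2.2) T.2.1 (fun U hU => θ U hU.1)
      fun U hU => hη T U hU.1 hU.2
  · refine (hP.inf T'.2.2).ext (f := f) fun U hU => ?_
    rw [← hη T' U hU.1 hU.2, res_res, res_res, hη T U hU.1]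
  · have := hη ⟨U, hP.affine hU, hP.le hU⟩ U hU le_rfl x
    rw [res_self, res_self] at this
    exact this.symm

variable [CharP k p] [PerfectRing k p]

theorem eq_of_res_eq (p : ℕ) [Fact p.Prime] [CharP k p] (hU : IsAffineOpen U) (hV : IsAffineOpen V) (h : V ≤ U)
    {θ θ' : Module.End k (Sec f V)} (hθ : θ ∈ diffOps k (Sec f V))
    (hθ' : θ' ∈ diffOps k (Sec f V)) (heq : ∀ x, θ (res f h x) = θ' (res f h x)) : θ = θ' :=
  eq_of_etale (p := p) (natCast_eq_zero_of_algebra (k := k) _) (γ := resAlg f h)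
    (res_etale hU hV h) hθ hθ' heq

theorem IsChart.endZeroEquiv_mem_iff (hU : IsChart f U) {η : Module.End k (Sec f U)} :
    endZeroEquiv p k (Sec f U) η ∈ wittDiff p 0 k (Sec f U) ↔ η ∈ diffOps k (Sec f U) :=
  let ⟨_, _, _, hz⟩ := hU
  endZeroEquiv_mem_wittDiff hz

/-- Transported from the restriction of Witt differential operators with n = 0, which on charts are
all differential operators. -/
theorem IsChart.exists_diffOps_restrict (p : ℕ) [Fact p.Prime] [CharP k p] [PerfectRing k p]
    (hU : IsChart f U) (hV : IsAffineOpen V) (h : V ≤ U)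
    {θ : Module.End k (Sec f U)} (hθ : θ ∈ diffOps k (Sec f U)) :
    ∃ θ' ∈ diffOps k (Sec f V), ∀ x, θ' (res f h x) = res f h (θ x) := by
  obtain ⟨θ', hθ', h'⟩ := hU.exists_mem_restrict hV h (hU.endZeroEquiv_mem_iff (p := p).mpr hθ)
  obtain ⟨η, rfl⟩ := (endZeroEquiv p k (Sec f V)).surjective θ'
  exact ⟨η, ((hU.of_le hV h).endZeroEquiv_mem_iff).mp hθ',
    (endZeroEquiv_wittMap_iff (res f h)).mp h'⟩

variable (f) in
/-- The affine opens contained in a basic open subset of `U` which is a chart. -/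
theorem isAffineBasis_basicOpen [Smooth f] (hU : IsAffineOpen U) :
    IsAffineBasis U fun T => IsAffineOpen T ∧
      ∃ g : Γ(X, U), IsChart f (X.basicOpen g) ∧ T ≤ X.basicOpen g where
  le := fun ⟨_, _, _, h⟩ => h.trans (X.basicOpen_le _)
  affine h := h.1
  down := fun ⟨_, g, hg, h⟩ h' hle => ⟨h', g, hg, hle.trans h⟩
  cover x hx := by
    obtain ⟨T, hxT, hle, hT⟩ := exists_isChart_le f hx
    obtain ⟨g, hg, hxg⟩ := hU.exists_basicOpen_le ⟨x, hxT⟩ hx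
    exact ⟨_, ⟨hU.basicOpen g, g, hT.of_le (hU.basicOpen g) hg, le_rfl⟩, hxg⟩

/-- Here U is any affine open and may have no coordinates. Uniqueness comes from étaleness of
restrictions. For existence, an operator extends to basic opens of U by localization, then from
basic opens that are charts to smaller affine opens, and the results glue. -/
theorem evalAffine_bijective (p : ℕ) [Fact p.Prime] [CharP k p] [PerfectRing k p] [Smooth f]
    (hU : IsAffineOpen U) : Function.Bijective (evalAffine f hU) := by
  constructor
  · intro θ θ' h
    have h : θ.1 ⟨U, hU, le_rfl⟩ = θ'.1 ⟨U, hU, le_rfl⟩ := congrArg Subtype.val h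
    refine Subtype.ext (funext fun T => eq_of_res_eq p hU T.2.1 T.2.2
      ((diffSections_prop f θ).mem T) ((diffSections_prop f θ').mem T) fun x => ?_)
    rw [(diffSections_prop f θ).compat ⟨U, hU, le_rfl⟩ T T.2.2,
      (diffSections_prop f θ').compat ⟨U, hU, le_rfl⟩ T T.2.2, h]
  · rintro ⟨θ, hθ⟩
    have hP := isAffineBasis_basicOpen f hU
    have hex : ∀ T, (IsAffineOpen T ∧ ∃ g : Γ(X, U), IsChart f (X.basicOpen g) ∧
        T ≤ X.basicOpen g) → ∃ η : diffOps k (Sec f T), ∀ (h : T ≤ U) x,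
        η.1 (res f h x) = res f h (θ x) := by
      rintro T ⟨hT, g, hg, hTg⟩
      obtain ⟨N, hN⟩ := hθ
      obtain ⟨θ₁, hθ₁, h₁⟩ := IsDiffOp.exists_of_away (p := p)
        (natCast_eq_zero_of_algebra (k := k) _) (γ := resAlg f (X.basicOpen_le g))
        (isAwayMap_res (f := f) hU g) hN
      obtain ⟨θ₂, hθ₂, h₂⟩ := hg.exists_diffOps_restrict p hT hTg ⟨N, hθ₁⟩
      refine ⟨⟨θ₂, hθ₂⟩, fun h x => ?_⟩
      have h₁ : θ₁ (res f (X.basicOpen_le g) x) = res f (X.basicOpen_le g) (θ x) := h₁ x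
      rw [← res_res f (X.basicOpen_le g) hTg, ← res_res f (X.basicOpen_le g) hTg, h₂, h₁]
    choose η hη using hex
    obtain ⟨ξ, hξ⟩ := exists_diffSections_glue hP η fun T T' hT hT' h x => by
      obtain ⟨hTa, g, hg, hTg⟩ := id hT
      obtain ⟨θ', hθ', h'⟩ := (hg.of_le hTa hTg).exists_diffOps_restrict p hT'.1 h (η T hT).2
      have : (η T' hT').1 = θ' := eq_of_res_eq p hU hT'.1 (h.trans (hP.le hT)) (η T' hT').2 hθ'
        fun x => by rw [hη T' hT', ← res_res f (hP.le hT) h, ← res_res f (hP.le hT) h, h', hη T hT]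
      rw [this, h']
    refine ⟨ξ, Subtype.ext (LinearMap.ext fun x => hP.ext fun T hT => ?_)⟩
    change res f (hP.le hT) (ξ.1 ⟨U, hU, le_rfl⟩ x) = res f (hP.le hT) (θ x)
    rw [← (diffSections_prop f ξ).compat ⟨U, hU, le_rfl⟩ ⟨T, hP.affine hT, hP.le hT⟩ (hP.le hT),
      hξ T hT, hη T hT]

variable (p f) in
/-- The map from Grothendieck's differential operators to Witt differential operators of
length one. -/
def diffSectionsToWitt (V : X.Opens) : diffSections f V →+* wittDiffSections p 0 f V where
  toFun θ := ⟨fun U => endZeroEquiv p k (Sec f U.1) (θ.1 ⟨U.1, U.2.1.1, U.2.2⟩),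
    fun U => U.2.1.endZeroEquiv_mem_iff.mpr
      ((diffSections_prop f θ).mem ⟨U.1, U.2.1.1, U.2.2⟩),
    fun U U' h => (endZeroEquiv_wittMap_iff (res f h)).mpr
      ((diffSections_prop f θ).compat ⟨U.1, U.2.1.1, U.2.2⟩ ⟨U'.1, U'.2.1.1, U'.2.2⟩ h)⟩
  map_one' := Subtype.ext (funext fun U => map_one (endZeroEquiv p k (Sec f U.1)))
  map_zero' := Subtype.ext (funext fun U => map_zero (endZeroEquiv p k (Sec f U.1)))
  map_add' _ _ := Subtype.ext (funext fun U => map_add (endZeroEquiv p k (Sec f U.1)) _ _)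
  map_mul' _ _ := Subtype.ext (funext fun U => map_mul (endZeroEquiv p k (Sec f U.1)) _ _)

theorem diffSectionsToWitt_apply (θ : diffSections f V) (hU : IsChart f U) (hUV : U ≤ V) :
    (diffSectionsToWitt p f V θ).1 ⟨U, hU, hUV⟩ =
      endZeroEquiv p k (Sec f U) (θ.1 ⟨U, hU.1, hUV⟩) := rfl

/-- Charts form a basis of V, and a compatible family on them extends uniquely to all affine opens
of V. -/
theorem diffSectionsToWitt_bijective [Smooth f] :
    Function.Bijective (diffSectionsToWitt p f V) := by
  have hP := isAffineBasis_isChart f V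
  constructor
  · intro θ θ' h
    refine diffSections_ext_of_basis hP fun U hU => ?_
    apply (endZeroEquiv p k (Sec f U)).injective
    rw [← diffSectionsToWitt_apply θ hU.1 hU.2, h]
    rfl
  · intro θ
    obtain ⟨η, hη⟩ := exists_diffSections_glue hP
      (fun U hU => ⟨(endZeroEquiv p k (Sec f U)).symm (θ.1 ⟨U, hU.1, hU.2⟩),
        (hU.1.endZeroEquiv_mem_iff (p := p)).mp (by
          rw [RingEquiv.apply_symm_apply]
          exact (wittDiffSections_prop f θ).mem ⟨U, hU.1, hU.2⟩)⟩)
      fun U U' hU hU' h => (endZeroEquiv_wittMap_iff (p := p) (res f h)).mp (by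
        rw [RingEquiv.apply_symm_apply, RingEquiv.apply_symm_apply]
        exact (wittDiffSections_prop f θ).compat ⟨U, hU.1, hU.2⟩ ⟨U', hU'.1, hU'.2⟩ h)
    refine ⟨η, Subtype.ext (funext fun U => ?_)⟩
    rw [diffSectionsToWitt_apply η U.2.1 U.2.2, hη U.1 U.2, RingEquiv.apply_symm_apply]

end Grothendieck
end WittDiff
end

/-! ### The main theorem -/

open CategoryTheory Opposite TopologicalSpace AlgebraicGeometry WittDiff

theorem mainTheorem6 {p : ℕ} [Fact p.Prime] (n : ℕ) {k : Type u} [Field k] [CharP k p]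
    [PerfectField k] {X : Scheme.{u}} (f : X ⟶ Spec (.of k)) [Smooth f] :
    -- the local charts form a basis of the topology of `X`
    Opens.IsBasis {U : X.Opens | IsChart f U} ∧
    -- on a chart with coordinates `z`, the lifts `∂_{i,n+1}^[r]` exist and are unique, the
    -- operators `a • ∂_{i,n+1}^[r]` are well defined, and the algebra they generate over
    -- `W_{n+1}(𝒪_X(U))` does not depend on `z` and consists of differential operators
    (∀ U : X.Opens, IsAffineOpen U → ∀ (m : ℕ) (z : Fin m → Sec f U), IsCoord k z →
      (∃! δ : Fin m → ℕ → Module.End (W p n k) (W p n (Sec f U)), IsWittLift p n z δ) ∧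
      (∀ δ : Fin m → ℕ → Module.End (W p n k) (W p n (Sec f U)), IsWittLift p n z δ →
        ∀ (i : Fin m) (r : ℕ) (a : W p n (Sec f U)),
        ∃! θ : Module.End (W p n k) (W p n (Sec f U)), IsBullet r a (δ i r) θ) ∧
      wittDiffOfCoord (k := k) p n z = wittDiff p n k (Sec f U) ∧
      wittDiff p n k (Sec f U) ≤ diffOps (W p n k) (W p n (Sec f U))) ∧
    -- localization on basic open subsets of charts
    (∀ U : X.Opens, IsChart f U → ∀ g : Γ(X, U),
      IsChart f (X.basicOpen g) ∧
      ∃ ρ : wittDiff p n k (Sec f U) →ₛₗ[wres p n f (X.basicOpen_le g)]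
          wittDiff p n k (Sec f (X.basicOpen g)),
        (∀ θ x, (ρ θ).1 (wres p n f (X.basicOpen_le g) x) =
          wres p n f (X.basicOpen_le g) (θ.1 x)) ∧
        IsBaseChangeAlong ρ) ∧
    -- the presheaf is a quasi-coherent sheaf
    (∃ hF : Presheaf.IsSheaf (Opens.grothendieckTopology X) (wittDiffPresheaf p n f).presheaf,
      (⟨wittDiffPresheaf p n f, hF⟩ : SheafOfModules (wittSheaf p n X)).IsQuasicoherent ∧
      -- its sections over a chart
      (∀ (U : X.Opens) (hU : IsChart f U), Function.Bijective (evalChart p n f hU)) ∧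
      -- it is the only sheaf with these sections over the charts of a covering
      (∀ (ι : Type u) (𝒰 : ι → X.Opens), (∀ i, IsChart f (𝒰 i)) → ⨆ i, 𝒰 i = ⊤ →
        ∀ (G : SheafOfModules.{u} (wittSheaf p n X)) (E : ChartIdent f G 𝒰),
          ∃! φ : G ≅ ⟨wittDiffPresheaf p n f, hF⟩,
            ∀ (U : X.Opens) (hU : IsChart f U) (hi : ∃ i, U ≤ 𝒰 i) (s : G.val.obj (op U)),
              evalChart p n f hU ((φ.hom.val.app (op U)).hom s) = E.iso ⟨U, hU, hi⟩ s)) ∧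
    -- for `n = 0`
    (∀ (U : X.Opens) (hU : IsAffineOpen U), Function.Bijective (evalAffine f hU)) ∧
    (∀ V : X.Opens, ∃ Ψ : diffSections f V ≃+* wittDiffSections p 0 f V,
      ∀ (θ : diffSections f V) (U : X.Opens) (hU : IsChart f U) (hUV : U ≤ V)
        (x : W p 0 (Sec f U)),
        ((Ψ θ).1 ⟨U, hU, hUV⟩ x).coeff 0 = θ.1 ⟨U, hU.1, hUV⟩ (x.coeff 0)) := by
  have : PerfectRing k p := PerfectField.toPerfectRing p
  have hq : (wittDiffSheaf p n f).IsQuasicoherent :=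
    SheafOfModules.IsQuasicoherent.mk.{u} ⟨wittDiffQuasicoherentData p n f⟩
  refine ⟨isBasis_isChart f, fun U _ m z hz => ⟨hz.existsUnique_isWittLift p n,
    fun δ hδ i r a => hδ.existsUnique_isBullet hz i r a, wittDiffOfCoord_eq p n hz,
    wittDiff_le_diffOps p n hz⟩, fun U hU g =>
    ⟨hU.of_le (hU.isAffineOpen.basicOpen g) (X.basicOpen_le g),
      wittRestrict p n hU (hU.isAffineOpen.basicOpen g) (X.basicOpen_le g),
      wittRestrict_apply hU (hU.isAffineOpen.basicOpen g) (X.basicOpen_le g),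
      isBaseChangeAlong_wittRestrict hU g⟩,
    ⟨wittDiffPresheaf_isSheaf p n f, hq,
      fun U hU => evalChart_bijective hU, fun ι 𝒰 _ h𝒰 G E => existsUnique_iso h𝒰 E⟩,
    fun U hU => evalAffine_bijective p hU, fun V =>
    ⟨RingEquiv.ofBijective (diffSectionsToWitt p f V) diffSectionsToWitt_bijective,
      fun θ U hU hUV x => coeff_zero_endZeroEquiv (θ.1 ⟨U, hU.1, hUV⟩) x⟩⟩
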